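/- **Setting.** Let $\Omega$ be a finite state space with at least three states, $I=\{1,\dots,n\}$ ($n\ge 1$) a set of traders, and $\Pi=(\Pi_1,\dots,\Pi_n)$ partitions of $\Omega$ with $\bigcap_i\Pi_i(\omega)=\{\omega\}$ for every $\omega$, where $\Pi_i(\omega)$ is the cell of $\omega$. Let $X:\Omega\to\mathbb R$ be a security and $Y=[\min X,\max X]$. A prior is any $\mu\in\Delta(\Omega)$, not necessarily of full support; $\mu_{\Pi_i(\omega)}$ is $\mu$ conditioned on $\Pi_i(\omega)$. A signal $\mathcal R$ has finitely or countably many realizations $\tau$, drawn with probability $\mathcal R(\tau|\omega)$ in state $\omega$; at a belief $\mu$ the realization $\tau$ has probability $m_\mu(\tau)=\sum_\omega\mu(\omega)\mathcal R(\tau|\omega)$ and leads to the Bayesian posterior $\gamma^\tau$, and $\mathcal R_\mu$ is the resulting distribution of posteriors. A cost structure $\kappa=(K,c)$ consists of a set $\mathcal E$ of available signals, a measurable $K:\mathcal E\to[0,\infty]$ and $c>0$, such that some uninformative $\mathcal R_0\in\mathcal E$ has $K(\mathcal R_0)=0$; acquiring $\mathcal R$ costs $cK(\mathcal R)$. Let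 $s(y,x)$ be a scoring rule, continuous in $y\in Y$ and strictly proper, $y_0\in Y$ and $0<\beta\le1$. *Assumption 1.* For every prior $\mu$, every $\mathcal R\in\mathcal E$ and every family $(\mathcal R^\tau)_\tau$ in $\mathcal E$ there is $\mathcal R'\in\mathcal E$ such that $\mathcal R'_\mu$ is the distribution of posteriors generated at $\mu$ by $\mathcal R$ followed by $\mathcal R^\tau$ after each realization $\tau$, and $K(\mathcal R')\le K(\mathcal R)+\sum_\tau m_\mu(\tau)K(\mathcal R^\tau)$. *Assumption 2.* If the supports of $\mathcal R(\cdot|\omega)$ and $\mathcal R(\cdot|\omega')$ differ for some $\omega,\omega'$, then $K(\mathcal R)=+\infty$. **$\kappa$ separability.** The net gain of $\mathcal R$ at a belief $\gamma$ is $\sum_\tau m_\gamma(\tau)\sum_{\omega}\gamma^\tau(\omega)\big[s(E_{\gamma^\tau}[X],X(\omega))-s(E_\gamma[X],X(\omega))\big]-cK(\mathcal R)$. The security $X$ is $\kappa$ non-separable under $\Pi$ if there are a prior $\mu$ and $v\in\mathbb R$ such that $X(\omega)\ne v$ for some $\omega\in\mathrm{Supp}(\mu)$, $E_\mu[X|\Pi_i(\omega)]=v$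 for all $i$ and all $\omega\in\mathrm{Supp}(\mu)$, and for all $\omega\in\mathrm{Supp}(\mu)$, all $i$ and all $\mathcal R\in\mathcal E$ the net gain of $\mathcal R$ at $\mu_{\Pi_i(\omega)}$ is at most $0$. Otherwise $X$ is $\kappa$ separable. **Market.** The state $\omega$ is drawn from $\mu$. In periods $k=1,2,\dots$ the traders move in turn, in the order $1,\dots,n,1,\dots$. The mover chooses a signal $\mathcal R_k\in\mathcal E$ and, for each of its realizations, an announcement in $Y$, as a measurable function of his cell, his own past signals and their realizations, all past announcements, and a fresh independent uniform draw from $[0,1]$; the realization is drawn, given $\omega$, independently of everything else, and only the resulting announcement $y_k$ becomes public. His payoff from period $k$ is $\beta^k\big(s(y_k,X(\omega))-s(y_{k-1},X(\omega))-cK(\mathcal R_k)\big)$, and a trader's total payoff is the expected sum over his periods (if $\beta=1$, where the sum need not converge: the lower limit of the expected partial sums). Nash equilibria are those of this game with common prior $\mu$. If the announcements converge in probability to $p^m$ in an equilibrium $l$, then $p^m$ is the prediction of the market and $A^m(\mu,l)=E_\mu[1-|p^m-X|]$; $A^m(\mu)=\inf_l A^m(\mu,l)$ over all Nash equilibria $l$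 (with $\inf\emptyset=+\infty$). **Poll.** Each trader $i$ in his cell acquires a signal that maximizes the net gain at $\mu_{\Pi_i(\omega)}$, observes its realization, independently across traders given $\omega$, and announces his posterior expectation $y_i$ of $X$. The prediction is $p^p=\frac1n\sum_i y_i$ and the accuracy is $A^p(\mu)=E_\mu[1-|p^p-X|]$. **Proposition.** Under Assumptions 1 and 2, for every prior the announcements converge in probability in every Nash equilibrium of the market. Moreover, $X$ is $\kappa$ separable under $\Pi$ if and only if $$A^m(\mu)>A^p(\mu)$$ for every choice of optimal signals in the poll and every prior $\mu$ under which at least one trader is uncertain about $X$, that is, for which there are a trader $i$ and states $\omega,\omega'\in\mathrm{Supp}(\mu)$ with $\omega'\in\Pi_i(\omega)$ and $X(\omega)\ne X(\omega')$. -/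

import Mathlib

open MeasureTheory Filter Topology
open scoped ENNReal

noncomputable section

namespace InfoMarket

/-! ### Signals and beliefs -/

/-- A signal on the state space `Ω`: in state `ω` the realization `τ` is drawn with probability
`prob ω τ`. The (finitely or countably many) realizations of a signal are labelled by natural
numbers; labels of probability zero in every state are not used. -/
structure Signal (Ω : Type*) where
  prob : Ω → ℕ → ℝ
  nonneg : ∀ ω τ, 0 ≤ prob ω τ
  hasSum_one : ∀ ω, HasSum (prob ω) 1

/-- The σ-algebra on signals generated by the probabilities of the realizations. -/
instance (Ω : Type*) : MeasurableSpace (Signal Ω) :=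
  MeasurableSpace.comap Signal.prob inferInstance

/-- Expected value of `X` under the belief `γ`. -/
def mean {Ω : Type*} [Fintype Ω] (γ X : Ω → ℝ) : ℝ := ∑ ω, γ ω * X ω

/-- Ex ante probability of the realization `τ` of the signal `R` under the belief `γ`. -/
def marg {Ω : Type*} [Fintype Ω] (γ : Ω → ℝ) (R : Signal Ω) (τ : ℕ) : ℝ :=
  ∑ ω, γ ω * R.prob ω τ

/-- Bayesian posterior after the realization `τ` of `R` (meaningful when `marg γ R τ > 0`). -/
def posterior {Ω : Type*} [Fintype Ω] (γ : Ω → ℝ) (R : Signal Ω) (τ : ℕ) : Ω → ℝ :=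
  fun ω => γ ω * R.prob ω τ / marg γ R τ

open Classical in
/-- The random posterior generated by `R` at the belief `γ`: the probability with which the
posterior is `δ`. -/
def randPost {Ω : Type*} [Fintype Ω] (γ : Ω → ℝ) (R : Signal Ω) (δ : Ω → ℝ) : ℝ :=
  ∑' τ, if posterior γ R τ = δ then marg γ R τ else 0

open Classical in
/-- The belief `μ` conditioned on the cell of `ω` in the partition `P` (a partition is given by
its equivalence relation); meaningful when `μ ω > 0`. -/
def cellBelief {Ω : Type*} [Fintype Ω] (P : Setoid Ω) (μ : Ω → ℝ) (ω : Ω) : Ω → ℝ :=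
  fun ω' => if P.r ω ω' then μ ω' / ∑ ω'' with P.r ω ω'', μ ω'' else 0

/-! ### Cost of information -/

/-- A set of available signals, with a cost function `K` and a marginal cost `c`; the signal `R`
costs `c * K R`. -/
structure CostStructure (Ω : Type*) where
  avail : Set (Signal Ω)
  K : avail → ℝ≥0∞
  measurable_K : Measurable K
  c : ℝ
  c_pos : 0 < c
  /-- There is a free uninformative signal. -/
  exists_free : ∃ R₀ : avail, (∀ ω ω', R₀.1.prob ω = R₀.1.prob ω') ∧ K R₀ = 0

/-- A random posterior that is generated by the signal `R` followed, after each realization `τ`,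
by the signal `S τ`, can be generated by one signal that is not more expensive. -/
def CostStructure.SequentialProof {Ω : Type*} [Fintype Ω] (κ : CostStructure Ω) : Prop :=
  ∀ μ ∈ stdSimplex ℝ Ω, ∀ (R : κ.avail) (S : ℕ → κ.avail), ∃ R' : κ.avail,
    (∀ δ, randPost μ R'.1 δ =
      ∑' τ, marg μ R.1 τ * randPost (posterior μ R.1 τ) (S τ).1 δ) ∧
    κ.K R' ≤ κ.K R + ∑' τ, ENNReal.ofReal (marg μ R.1 τ) * κ.K (S τ)

/-- A signal whose support is not the same in all states has infinite cost. -/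
def CostStructure.NoExclusion {Ω : Type*} (κ : CostStructure Ω) : Prop :=
  ∀ (R : κ.avail) (ω ω' : Ω),
    Function.support (R.1.prob ω) ≠ Function.support (R.1.prob ω') → κ.K R = ∞

/-! ### The game -/

/-- All the data of the trading game with `n` traders, except the common prior. -/
structure Game (Ω : Type*) [Fintype Ω] (n : ℕ) where
  /-- The partitions of the traders. -/
  part : Fin n → Setoid Ω
  three_le_card : 3 ≤ Fintype.card Ω
  /-- The pooled private information reveals the state. -/
  join_eq : ∀ ω ω', (∀ i, (part i).r ω ω') → ω = ω'
  /-- The security. -/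
  X : Ω → ℝ
  κ : CostStructure Ω
  /-- The scoring rule `s y x`, for the prediction `y` and the true value `x`. It is continuous in
  the prediction and strictly proper. -/
  s : ℝ → ℝ → ℝ
  s_continuous : ∀ ω, ContinuousOn (fun y => s y (X ω)) (Set.Icc (⨅ ω, X ω) (⨆ ω, X ω))
  s_strictlyProper : ∀ γ ∈ stdSimplex ℝ Ω, ∀ y ∈ Set.Icc (⨅ ω, X ω) (⨆ ω, X ω),
    y ≠ mean γ X → ∑ ω, γ ω * s y (X ω) < ∑ ω, γ ω * s (mean γ X) (X ω)
  /-- The initial announcement of the market maker. -/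
  y₀ : Set.Icc (⨅ ω, X ω) (⨆ ω, X ω)
  /-- The common discount factor. -/
  β : ℝ
  β_pos : 0 < β
  β_le_one : β ≤ 1

namespace Game

variable {Ω : Type*} [Fintype Ω] {n : ℕ} (G : Game Ω n)

/-- The possible announcements: the interval from the least to the greatest value of `X`. -/
abbrev Ann : Type := Set.Icc (⨅ ω, G.X ω) (⨆ ω, G.X ω)

/-! ### Separability -/

/-- Myopic expected gain from the signal `R` at the belief `γ`, gross of its cost. -/
def gain (γ : Ω → ℝ) (R : Signal Ω) : ℝ :=
  ∑' τ, marg γ R τ * ∑ ω, posterior γ R τ ω *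
    (G.s (mean (posterior γ R τ) G.X) (G.X ω) - G.s (mean γ G.X) (G.X ω))

/-- Myopic expected gain from the signal `R` at the belief `γ`, net of its cost. -/
def netGain (γ : Ω → ℝ) (R : G.κ.avail) : EReal :=
  (G.gain γ R.1 : EReal) - ((ENNReal.ofReal G.κ.c * G.κ.K R : ℝ≥0∞) : EReal)

/-- `X` is non-separable at `μ`. -/
def NonSeparableAt (μ : Ω → ℝ) : Prop :=
  ∃ v : ℝ, (∃ ω, 0 < μ ω ∧ G.X ω ≠ v) ∧
    ∀ i ω, 0 < μ ω → mean (cellBelief (G.part i) μ ω) G.X = v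

/-- There is no (myopic) information acquisition at `μ`. -/
def NoAcquisition (μ : Ω → ℝ) : Prop :=
  ∀ ω, 0 < μ ω → ∀ i (R : G.κ.avail), G.netGain (cellBelief (G.part i) μ ω) R ≤ 0

/-- `X` is `κ` separable. -/
def KSeparable : Prop :=
  ¬ ∃ μ ∈ stdSimplex ℝ Ω, G.NonSeparableAt μ ∧ G.NoAcquisition μ

/-- Under the prior `μ`, some trader does not learn the value of `X` from his partition alone. -/
def SomeTraderUncertain (μ : Ω → ℝ) : Prop :=
  ∃ i ω ω', 0 < μ ω ∧ 0 < μ ω' ∧ (G.part i).r ω ω' ∧ G.X ω ≠ G.X ω'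

end Game

/-! ### Full states -/

/-- A full state `(ω, ι, u)`: the state `ω`, the private randomizations `ι k` of the traders, and
the draws `u k` with which nature selects the signal realizations. -/
abbrev FullState (Ω : Type*) : Type _ := Ω × (ℕ → unitInterval) × (ℕ → unitInterval)

/-- `ω` is drawn from `μ`, all other draws are uniform on `[0,1]`, and everything is independent. -/
def law {Ω : Type*} [Fintype Ω] [MeasurableSpace Ω] (μ : Ω → ℝ) : Measure (FullState Ω) :=
  (∑ ω, ENNReal.ofReal (μ ω) • Measure.dirac ω).prod
    ((Measure.infinitePi fun _ : ℕ => (volume : Measure unitInterval)).prod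
      (Measure.infinitePi fun _ : ℕ => (volume : Measure unitInterval)))

/-- Inverse transform sampling: if `u` is uniform on `[0,1]`, then `realize p u` is equal to `τ`
with probability `p τ`. -/
def realize (p : ℕ → ℝ) (u : unitInterval) : ℕ :=
  sInf {m | (u : ℝ) < ∑ j ∈ Finset.range (m + 1), p j}

namespace Game

variable {Ω : Type*} [Fintype Ω] [MeasurableSpace Ω] {n : ℕ} [NeZero n] (G : Game Ω n)

/-! ### Strategies and play

Periods are counted from `0`, so that period `k` is the time `t_{k+1}`. -/

/-- The trader who moves in period `k`. -/
def mover (n : ℕ) [NeZero n] (k : ℕ) : Fin n := Fin.ofNat n k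

/-- What trader `i` knows in period `k` before he moves: his cell, the signals that he acquired in
his own earlier periods with their realizations, and all earlier announcements. -/
abbrev Info (i : Fin n) (k : ℕ) : Type _ :=
  Quotient (G.part i) × ({j : Fin k // mover n j = i} → G.κ.avail × ℕ) × (Fin k → G.Ann)

/-- A mixed strategy of trader `i`: in period `k` it selects, as a function of his information and
of a uniform draw from `[0,1]`, a signal and an announcement for each realization of the signal.
Only the periods in which `i` moves matter. -/
structure Strategy (i : Fin n) where
  signal : (k : ℕ) → G.Info i k × unitInterval → G.κ.avail
  announce : (k : ℕ) → (G.Info i k × unitInterval) × ℕ → G.Ann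
  measurable_signal : ∀ k, Measurable (signal k)
  measurable_announce : ∀ k, Measurable (announce k)

/-- A strategy profile. -/
abbrev Profile : Type _ := (i : Fin n) → G.Strategy i

/-- What happens in one period: the acquired signal, its realization and the announcement. -/
abbrev Record : Type _ := (G.κ.avail × ℕ) × G.Ann

/-- The information of trader `i` in state `ω` after the records `h` of periods `0, …, k - 1`. -/
def infoOf (i : Fin n) (ω : Ω) {k : ℕ} (h : Fin k → G.Record) : G.Info i k :=
  (Quotient.mk (G.part i) ω, fun j => (h j.1).1, fun j => (h j).2)

/-- The record of period `k`, given the records of the earlier periods. -/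
def step (σ : G.Profile) (φ : FullState Ω) (k : ℕ) (h : Fin k → G.Record) : G.Record :=
  let i := mover n k
  let a := (G.infoOf i φ.1 h, φ.2.1 k)
  let R := (σ i).signal k a
  let τ := realize (R.1.prob φ.1) (φ.2.2 k)
  ((R, τ), (σ i).announce k (a, τ))

/-- The records of periods `0, …, k - 1` when `σ` is played in the full state `φ`. -/
def play (σ : G.Profile) (φ : FullState Ω) : (k : ℕ) → Fin k → G.Record
  | 0 => Fin.elim0
  | k + 1 => Fin.snoc (α := fun _ => G.Record) (play σ φ k) (G.step σ φ k (play σ φ k))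

/-- The price before period `k`: the initial announcement if `k = 0`, and otherwise the
announcement made in period `k - 1`. -/
def price (σ : G.Profile) (φ : FullState Ω) : ℕ → ℝ
  | 0 => G.y₀
  | k + 1 => (G.step σ φ k (G.play σ φ k)).2

/-- The signal acquired in period `k`. -/
def acquired (σ : G.Profile) (φ : FullState Ω) (k : ℕ) : G.κ.avail :=
  (G.step σ φ k (G.play σ φ k)).1.1

/-! ### Nash equilibrium -/

/-- Expected discounted payoff of the trader who moves in period `k`, from that period. It is `-∞`
if the expected cost is infinite. -/
def stagePayoff (μ : Ω → ℝ) (σ : G.Profile) (k : ℕ) : EReal :=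
  ((G.β ^ (k + 1) : ℝ) : EReal) *
    (((∫ φ, (G.s (G.price σ φ (k + 1)) (G.X φ.1) - G.s (G.price σ φ k) (G.X φ.1)) ∂(law μ) : ℝ)
        : EReal) -
      ((ENNReal.ofReal G.κ.c * ∫⁻ φ, G.κ.K (G.acquired σ φ k) ∂(law μ) : ℝ≥0∞) : EReal))

/-- Expected total payoff of trader `i`, the limit of the expected payoffs from the first `N`
periods. The limit exists if `β < 1`; if `β = 1` it may fail to exist, and the lower limit is
taken. -/
def payoff (μ : Ω → ℝ) (σ : G.Profile) (i : Fin n) : EReal :=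
  liminf (fun N : ℕ => ∑ k ∈ Finset.range N with mover n k = i, G.stagePayoff μ σ k) atTop

/-- `σ` is a Nash equilibrium of the game with common prior `μ`. -/
def IsNash (μ : Ω → ℝ) (σ : G.Profile) : Prop :=
  ∀ (i : Fin n) (σ' : G.Strategy i),
    G.payoff μ (Function.update σ i σ') i ≤ G.payoff μ σ i

/-! ### Accuracy of the market and of the poll -/

/-- The expected accuracy `E[1 - |p - X|]` of a prediction `p`. -/
def accuracy (μ : Ω → ℝ) (p : FullState Ω → ℝ) : ℝ :=
  ∫ φ, (1 - |p φ - G.X φ.1|) ∂(law μ)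

/-- `p` is the prediction of the market when `σ` is played: the limit (in probability) of the
announcements. -/
def IsMarketPrediction (μ : Ω → ℝ) (σ : G.Profile) (p : FullState Ω → ℝ) : Prop :=
  TendstoInMeasure (law μ) (fun k φ => G.price σ φ k) atTop p

/-- The worst expected accuracy of the market among all Nash equilibria (`+∞` if there is none). -/
def marketAccuracy (μ : Ω → ℝ) : EReal :=
  ⨅ (σ : G.Profile) (_ : G.IsNash μ σ) (p : FullState Ω → ℝ) (_ : G.IsMarketPrediction μ σ p),
    (G.accuracy μ p : EReal)

/-- A choice of a signal for every trader and every cell of his partition. -/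
abbrev PollChoice : Type _ := (i : Fin n) → Quotient (G.part i) → G.κ.avail

/-- All the chosen signals are myopically optimal. -/
def PollChoice.IsOptimal {G : Game Ω n} (μ : Ω → ℝ) (ρ : G.PollChoice) : Prop :=
  ∀ i ω, 0 < μ ω → ∀ R : G.κ.avail,
    G.netGain (cellBelief (G.part i) μ ω) R ≤
      G.netGain (cellBelief (G.part i) μ ω) (ρ i (Quotient.mk _ ω))

/-- The prediction of the poll: the average of the expected values of `X` after each trader has
observed his cell and the realization of his chosen signal. -/
def pollPrediction (μ : Ω → ℝ) (ρ : G.PollChoice) (φ : FullState Ω) : ℝ :=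
  (∑ i : Fin n,
    let R := (ρ i (Quotient.mk _ φ.1)).1
    mean (posterior (cellBelief (G.part i) μ φ.1) R (realize (R.prob φ.1) (φ.2.2 i))) G.X) / n

end Game

end InfoMarket

end

/-!
The scores that the movers earn telescope and are bounded, so in an equilibrium the continuation
payoffs vanish relative to the discount factor. Hence so does what a mover could gain by acquiring
one more signal, announcing a mean, and staying passive afterwards. The public belief is a bounded
martingale. Since announcing its mean must not be profitable in the limit, the prices converge to
the mean of the limit belief; by continuity, given his cell and the limit belief, no trader gains
from any signal or any other announcement. A limit belief is thus a witness against `κ` separability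
unless the price equals `X`, so in the separable case the market has accuracy `1`. The poll falls
short of this: a signal of finite cost excludes no state (Assumption 2), so an uncertain trader
stays uncertain.

Conversely, at a witness of non-separability with common value `v` everyone announcing `v` is an
equilibrium, because by Assumption 1 a deviator's successive signals amount to a single one, whose
net gain is at most `0`. In the poll no acquisition is optimal as well, and both predict `v`.
-/

noncomputable section

namespace InfoMarket

/-! ### Inverse transform sampling -/

section Realize

theorem measurable_sInf_setOf {α : Type*} [MeasurableSpace α] {P : ℕ → α → Prop}
    (hP : ∀ m, MeasurableSet {x | P m x}) : Measurable fun x => sInf {m | P m x} := by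
  refine measurable_of_Iic fun m => ?_
  have preimage_eq : (fun x => sInf {j | P j x}) ⁻¹' Set.Iic m =
      (⋃ j ∈ Set.Iic m, {x | P j x}) ∪ ⋂ j, {x | P j x}ᶜ := by
    ext x
    simp only [Set.mem_preimage, Set.mem_Iic, Set.mem_union, Set.mem_iUnion, Set.mem_ofPred_eq,
      Set.mem_iInter, Set.mem_compl_iff, exists_prop]
    by_cases h : ∃ j, P j x
    · refine ⟨fun hm => .inl ⟨_, hm, Nat.sInf_mem h⟩, ?_⟩
      rintro (⟨j, hj, hjx⟩ | hnone)
      · exact (Nat.sInf_le hjx).trans hj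
      · exact absurd h (not_exists.2 hnone)
    · have hempty : {j | P j x} = ∅ := Set.eq_empty_of_forall_notMem (not_exists.1 h)
      simp only [hempty, Nat.sInf_empty, Nat.zero_le, true_iff]
      exact .inr (not_exists.1 h)
  rw [preimage_eq]
  exact (MeasurableSet.biUnion (Set.to_countable _) fun j _ => hP j).union
    (MeasurableSet.iInter fun j => (hP j).compl)

theorem measurable_realize :
    Measurable fun x : (ℕ → ℝ) × unitInterval => realize x.1 x.2 :=
  measurable_sInf_setOf fun _ => measurableSet_lt (by fun_prop) (by fun_prop)

theorem measurable_realize_right (p : ℕ → ℝ) : Measurable (realize p) :=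
  measurable_realize.comp (measurable_const.prodMk measurable_id)

variable {p : ℕ → ℝ} (h0 : ∀ τ, 0 ≤ p τ) (h1 : HasSum p 1)

include h0 h1

theorem realize_eq_iff {v : unitInterval} (hv : (v : ℝ) < 1) {τ : ℕ} :
    realize p v = τ ↔
      ∑ j ∈ Finset.range τ, p j ≤ v ∧ (v : ℝ) < ∑ j ∈ Finset.range (τ + 1), p j := by
  have hmono : Monotone fun m => ∑ j ∈ Finset.range m, p j := fun a b hab =>
    Finset.sum_le_sum_of_subset_of_nonneg (Finset.range_mono hab) fun j _ _ => h0 j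
  have hex : ∃ m, (v : ℝ) < ∑ j ∈ Finset.range (m + 1), p j :=
    (((tendsto_add_atTop_iff_nat 1).2 h1.tendsto_sum_nat).eventually (lt_mem_nhds hv)).exists
  have hmem : (v : ℝ) < ∑ j ∈ Finset.range (realize p v + 1), p j := Nat.sInf_mem hex
  constructor
  · rintro rfl
    refine ⟨?_, hmem⟩
    rcases hτ : realize p v with _ | m
    · simpa using v.2.1
    · by_contra! hlt
      have : realize p v ≤ m := Nat.sInf_le hlt
      omega
  · rintro ⟨hle, hlt⟩
    refine le_antisymm (Nat.sInf_le hlt) ?_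
    by_contra! h
    exact ((hmono (show realize p v + 1 ≤ τ from h)).trans hle).not_gt hmem

theorem volume_realize_eq (τ : ℕ) :
    volume {v : unitInterval | realize p v = τ} = ENNReal.ofReal (p τ) := by
  have hmem : ∀ m, ∑ j ∈ Finset.range m, p j ∈ Set.Icc (0 : ℝ) 1 := fun m =>
    ⟨Finset.sum_nonneg fun j _ => h0 j, sum_le_hasSum _ (fun j _ => h0 j) h1⟩
  let a : unitInterval := ⟨_, hmem τ⟩
  let b : unitInterval := ⟨_, hmem (τ + 1)⟩
  have hae : {v : unitInterval | realize p v = τ} =ᵐ[volume] Set.Ico a b := by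
    filter_upwards [Measure.ae_ne volume (1 : unitInterval)] with v hv
    exact propext (realize_eq_iff h0 h1 (lt_of_le_of_ne v.2.2 fun h => hv (Subtype.ext h)))
  rw [measure_congr hae, unitInterval.volume_Ico]
  simp only [a, b, Finset.sum_range_succ, add_sub_cancel_left]

theorem lintegral_realize (F : ℕ → ℝ≥0∞) :
    ∫⁻ v : unitInterval, F (realize p v) = ∑' τ, ENNReal.ofReal (p τ) * F τ := by
  have hm := measurable_realize_right p
  rw [← lintegral_map Measurable.of_discrete hm, lintegral_countable']
  refine tsum_congr fun τ => ?_
  rw [Measure.map_apply hm (measurableSet_singleton τ), mul_comm]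
  exact congrArg (· * F τ) (volume_realize_eq h0 h1 τ)

theorem integral_realize {F : ℕ → ℝ} {B : ℝ} (hF : ∀ τ, |F τ| ≤ B) :
    ∫ v : unitInterval, F (realize p v) = ∑' τ, p τ * F τ := by
  have hm := measurable_realize_right p
  have : IsProbabilityMeasure ((volume : Measure unitInterval).map (realize p)) :=
    Measure.isProbabilityMeasure_map hm.aemeasurable
  rw [← integral_map hm.aemeasurable Measurable.of_discrete.aestronglyMeasurable,
    integral_countable]
  · refine tsum_congr fun τ => ?_
    rw [measureReal_def, Measure.map_apply hm (measurableSet_singleton τ)]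
    change (volume {v : unitInterval | realize p v = τ}).toReal • _ = _
    rw [volume_realize_eq h0 h1 τ, ENNReal.toReal_ofReal (h0 τ), smul_eq_mul]
  · exact Integrable.of_bound Measurable.of_discrete.aestronglyMeasurable B (ae_of_all _ hF)

theorem ae_realize_pos : ∀ᵐ v : unitInterval, 0 < p (realize p v) := by
  have hnull : ∀ τ, p τ = 0 → ∀ᵐ v : unitInterval, realize p v ≠ τ := fun τ hτ => by
    rw [ae_iff]
    simpa [hτ] using volume_realize_eq h0 h1 τ
  filter_upwards [ae_all_iff.2 fun τ => eventually_imp_distrib_left.2 (hnull τ)] with v hv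
  exact (h0 _).lt_of_ne fun h => hv _ h.symm rfl

end Realize

theorem Signal.measurable_prob {Ω : Type*} (ω : Ω) : Measurable fun R : Signal Ω => R.prob ω :=
  (measurable_pi_apply ω).comp (comap_measurable _)

theorem CostStructure.measurable_prob {Ω : Type*} [Countable Ω] [MeasurableSpace Ω]
    [MeasurableSingletonClass Ω] (κ : CostStructure Ω) :
    Measurable fun x : Ω × κ.avail => x.2.1.prob x.1 :=
  measurable_from_prod_countable_right fun ω =>
    (Signal.measurable_prob ω).comp measurable_subtype_coe

/-! ### The law of the full state -/

section Law

theorem measurePreserving_update {ι : Type*} [DecidableEq ι] {A : ι → Type*}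
    [∀ i, MeasurableSpace (A i)] (ν : (i : ι) → Measure (A i)) [∀ i, IsProbabilityMeasure (ν i)]
    (k : ι) :
    MeasurePreserving (fun x : (∀ i, A i) × A k => Function.update x.1 k x.2)
      ((Measure.infinitePi ν).prod (ν k)) (Measure.infinitePi ν) := by
  refine ⟨measurable_update', Measure.eq_infinitePi _ fun s t ht => ?_⟩
  rw [Measure.map_apply measurable_update' (.pi s.countable_toSet fun j _ => ht j)]
  have preimage_eq : (fun x : (∀ i, A i) × A k => Function.update x.1 k x.2) ⁻¹' Set.pi s t =
      (Set.pi ↑(s.erase k) t) ×ˢ {v | k ∈ s → v ∈ t k} := by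
    ext x
    simp only [Set.mem_preimage, Set.update_mem_pi_iff, Set.mem_prod, Set.mem_ofPred_eq,
      Finset.coe_erase, Finset.mem_coe]
  rw [preimage_eq, Measure.prod_prod, Measure.infinitePi_pi _ fun j _ => ht j]
  by_cases hk : k ∈ s
  · simp only [hk, true_imp_iff, Set.ofPred_mem_eq]
    exact Finset.prod_erase_mul s (fun i => ν i (t i)) hk
  · simp only [hk, false_imp_iff, Set.ofPred_true, measure_univ, mul_one,
      Finset.erase_eq_of_notMem hk]

/-- The law of a sequence of independent uniform draws from `[0,1]`. -/
abbrev uniformSeq : Measure (ℕ → unitInterval) := Measure.infinitePi fun _ => volume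

variable {Ω : Type*} [Fintype Ω] [MeasurableSpace Ω]

/-- The law of the state under the prior `μ`. -/
def stateLaw (μ : Ω → ℝ) : Measure Ω := ∑ ω, ENNReal.ofReal (μ ω) • Measure.dirac ω

theorem law_eq_prod (μ : Ω → ℝ) : law μ = (stateLaw μ).prod (uniformSeq.prod uniformSeq) := rfl

theorem stateLaw_univ (μ : Ω → ℝ) : stateLaw μ Set.univ = ∑ ω, ENNReal.ofReal (μ ω) := by
  simp only [stateLaw, Measure.coe_finsetSum, Finset.sum_apply, Measure.smul_apply, measure_univ,
    smul_eq_mul, mul_one]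

instance (μ : Ω → ℝ) : IsFiniteMeasure (stateLaw μ) :=
  ⟨by rw [stateLaw_univ]; exact ENNReal.sum_lt_top.2 fun _ _ => ENNReal.ofReal_lt_top⟩

instance (μ : Ω → ℝ) : IsFiniteMeasure (law μ) := by
  rw [law_eq_prod]
  infer_instance

theorem isProbabilityMeasure_law {μ : Ω → ℝ} (hμ : μ ∈ stdSimplex ℝ Ω) :
    IsProbabilityMeasure (law μ) := by
  have : IsProbabilityMeasure (stateLaw μ) := ⟨by
    rw [stateLaw_univ, ← ENNReal.ofReal_sum_of_nonneg fun ω _ => hμ.1 ω, hμ.2, ENNReal.ofReal_one]⟩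
  rw [law_eq_prod]
  infer_instance

/-- The full state in which the draw of nature in period `k` is replaced by a new one. -/
def redraw (k : ℕ) (x : FullState Ω × unitInterval) : FullState Ω :=
  (x.1.1, x.1.2.1, Function.update x.1.2.2 k x.2)

theorem measurePreserving_redraw (μ : Ω → ℝ) (k : ℕ) :
    MeasurePreserving (redraw (Ω := Ω) k) ((law μ).prod volume) (law μ) :=
  ((MeasurePreserving.id (stateLaw μ)).prod
    ((MeasurePreserving.id uniformSeq).prod (measurePreserving_update _ k))).comp
      (((MeasurePreserving.id (stateLaw μ)).prod
        (measurePreserving_prodAssoc uniformSeq uniformSeq volume)).comp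
          (measurePreserving_prodAssoc (stateLaw μ) (uniformSeq.prod uniformSeq) volume))

theorem integral_redraw (μ : Ω → ℝ) (k : ℕ) {F : FullState Ω → ℝ} (hF : Measurable F) {B : ℝ}
    (hB : ∀ φ, |F φ| ≤ B) :
    ∫ φ, F φ ∂(law μ) = ∫ φ, (∫ v : unitInterval, F (redraw k (φ, v))) ∂(law μ) := by
  have hpres := measurePreserving_redraw μ k
  rw [← hpres.map_eq, integral_map hpres.measurable.aemeasurable hF.aestronglyMeasurable,
    hpres.map_eq]
  exact integral_prod _ (Integrable.of_bound
    (hF.comp hpres.measurable).aestronglyMeasurable B (ae_of_all _ fun _ => hB _))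

theorem ae_law_of_ae_redraw (μ : Ω → ℝ) (k : ℕ) {P : FullState Ω → Prop}
    (hP : MeasurableSet {φ | P φ}) (h : ∀ φ, ∀ᵐ v : unitInterval, P (redraw k (φ, v))) :
    ∀ᵐ φ ∂(law μ), P φ := by
  have hpres := measurePreserving_redraw μ k
  rw [← hpres.map_eq, ae_map_iff hpres.measurable.aemeasurable hP]
  exact (Measure.ae_prod_iff_ae_ae (hpres.measurable hP)).2 (ae_of_all _ h)

theorem lintegral_law [MeasurableSingletonClass Ω] (μ : Ω → ℝ) {F : FullState Ω → ℝ≥0∞}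
    (hF : Measurable F) :
    ∫⁻ φ, F φ ∂(law μ) =
      ∫⁻ ι, ∑ ω, ENNReal.ofReal (μ ω) * ∫⁻ u, F (ω, ι, u) ∂uniformSeq ∂uniformSeq := by
  have hinner : ∀ ω, Measurable fun x : (ℕ → unitInterval) × (ℕ → unitInterval) => F (ω, x) :=
    fun ω => hF.comp measurable_prodMk_left
  rw [law_eq_prod, lintegral_prod _ hF.aemeasurable, stateLaw, lintegral_finsetSum_measure,
    lintegral_finsetSum _ fun ω _ => (hinner ω).lintegral_prod_right'.const_mul _]
  refine Finset.sum_congr rfl fun ω _ => ?_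
  rw [lintegral_smul_measure, lintegral_dirac, smul_eq_mul,
    lintegral_prod _ (hinner ω).aemeasurable,
    lintegral_const_mul _ (hinner ω).lintegral_prod_right']

end Law

namespace Game

/-! ### Scores and announcements -/

section Score

variable {Ω : Type*} [Fintype Ω] {n : ℕ} (G : Game Ω n)

/-- The score of the announcement `y` in the state `ω`. -/
def score (y : G.Ann) (ω : Ω) : ℝ := G.s y (G.X ω)

theorem continuous_score (ω : Ω) : Continuous fun y : G.Ann => G.score y ω :=
  continuousOn_iff_continuous_domRestrict.1 (G.s_continuous ω)

theorem exists_abs_score_le : ∃ B : ℝ, 0 < B ∧ ∀ y ω, |G.score y ω| ≤ B := by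
  have h : ∀ ω, ∃ B, ∀ y : G.Ann, |G.score y ω| ≤ B := fun ω => by
    obtain ⟨B, hB⟩ := (isCompact_range (G.continuous_score ω)).isBounded.exists_norm_le
    exact ⟨B, fun y => hB _ ⟨y, rfl⟩⟩
  choose B hB using h
  refine ⟨1 + ∑ ω, |B ω|, by positivity, fun y ω => (hB ω y).trans ?_⟩
  have := Finset.single_le_sum (f := fun ω => |B ω|) (fun ω _ => abs_nonneg _) (Finset.mem_univ ω)
  linarith [le_abs_self (B ω)]

/-- A bound for the absolute values of all scores. -/
def scoreBound : ℝ := G.exists_abs_score_le.choose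

theorem scoreBound_pos : 0 < G.scoreBound := G.exists_abs_score_le.choose_spec.1

theorem abs_score_le (y : G.Ann) (ω : Ω) : |G.score y ω| ≤ G.scoreBound :=
  G.exists_abs_score_le.choose_spec.2 y ω

theorem X_mem (ω : Ω) : G.X ω ∈ Set.Icc (⨅ ω, G.X ω) (⨆ ω, G.X ω) :=
  ⟨ciInf_le (Set.finite_range G.X).bddBelow ω, le_ciSup (Set.finite_range G.X).bddAbove ω⟩

theorem mean_mem {γ : Ω → ℝ} (hγ : γ ∈ stdSimplex ℝ Ω) :
    mean γ G.X ∈ Set.Icc (⨅ ω, G.X ω) (⨆ ω, G.X ω) :=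
  (convex_Icc _ _).sum_mem (fun ω _ => hγ.1 ω) hγ.2 fun ω _ => G.X_mem ω

/-- The last of the announcements `h`, or the initial one if there is none. -/
def lastAnn : {k : ℕ} → (Fin k → G.Ann) → G.Ann
  | 0, _ => G.y₀
  | k + 1, h => h (Fin.last k)

theorem measurable_lastAnn : (k : ℕ) → Measurable (G.lastAnn (k := k))
  | 0 => measurable_const
  | k + 1 => measurable_pi_apply (Fin.last k)

/-- A signal that reveals nothing and costs nothing. -/
def free : G.κ.avail := G.κ.exists_free.choose

theorem free_prob (ω ω' : Ω) : G.free.1.prob ω = G.free.1.prob ω' :=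
  G.κ.exists_free.choose_spec.1 ω ω'

theorem K_free : G.κ.K G.free = 0 := G.κ.exists_free.choose_spec.2

variable [MeasurableSpace Ω]

/-- Expected score of the random announcement `y`. -/
def expScore (μ : Ω → ℝ) (y : FullState Ω → G.Ann) : ℝ := ∫ φ, G.score (y φ) φ.1 ∂(law μ)

theorem abs_expScore_le {μ : Ω → ℝ} (hμ : μ ∈ stdSimplex ℝ Ω) (y : FullState Ω → G.Ann) :
    |G.expScore μ y| ≤ G.scoreBound := by
  have := isProbabilityMeasure_law hμ
  simpa [expScore] using norm_integral_le_of_norm_le_const (μ := law μ)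
    (f := fun φ => G.score (y φ) φ.1) (ae_of_all _ fun φ => G.abs_score_le _ _)

/-- Expected cost of acquiring the random signal `R`. -/
def expCost (μ : Ω → ℝ) (R : FullState Ω → G.κ.avail) : ℝ≥0∞ :=
  ENNReal.ofReal G.κ.c * ∫⁻ φ, G.κ.K (R φ) ∂(law μ)

@[simp]
theorem expCost_free (μ : Ω → ℝ) : G.expCost μ (fun _ => G.free) = 0 := by
  simp only [expCost, K_free, lintegral_zero, mul_zero]

variable [MeasurableSingletonClass Ω]

theorem measurable_score : Measurable fun x : G.Ann × Ω => G.score x.1 x.2 :=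
  measurable_from_prod_countable_left fun ω => (G.continuous_score ω).measurable

theorem integrable_score (μ : Ω → ℝ) {y : FullState Ω → G.Ann} (hy : Measurable y) :
    Integrable (fun φ => G.score (y φ) φ.1) (law μ) :=
  Integrable.of_bound (G.measurable_score.comp (hy.prodMk measurable_fst)).aestronglyMeasurable
    G.scoreBound (ae_of_all _ fun _ => G.abs_score_le _ _)

end Score

/-! ### Play -/

section Play

variable {Ω : Type*} [Fintype Ω] [MeasurableSpace Ω] {n : ℕ} [NeZero n] (G : Game Ω n)

/-- The signal acquired in period `k` after the records `h`. -/
def chosen (σ : G.Profile) (ω : Ω) (ι : ℕ → unitInterval) (k : ℕ) (h : Fin k → G.Record) :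
    G.κ.avail :=
  (σ (mover n k)).signal k (G.infoOf (mover n k) ω h, ι k)

/-- The record of period `k` after the records `h` if the realization of the signal is `τ`. -/
def respond (σ : G.Profile) (ω : Ω) (ι : ℕ → unitInterval) (k : ℕ) (h : Fin k → G.Record)
    (τ : ℕ) : G.Record :=
  ((G.chosen σ ω ι k h, τ), (σ (mover n k)).announce k ((G.infoOf (mover n k) ω h, ι k), τ))

theorem step_eq (σ : G.Profile) (φ : FullState Ω) (k : ℕ) (h : Fin k → G.Record) :
    G.step σ φ k h = G.respond σ φ.1 φ.2.1 k h
      (realize ((G.chosen σ φ.1 φ.2.1 k h).1.prob φ.1) (φ.2.2 k)) := rfl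

/-- All announcements before period `k`. -/
def hist (σ : G.Profile) (k : ℕ) (φ : FullState Ω) : Fin k → G.Ann := fun j => (G.play σ φ k j).2

/-- The price before period `k`, as an admissible announcement. -/
def ann (σ : G.Profile) (k : ℕ) (φ : FullState Ω) : G.Ann := G.lastAnn (G.hist σ k φ)

/-- What the mover of period `k` knows before he moves, with his private randomization. -/
def moverInfo (σ : G.Profile) (k : ℕ) (φ : FullState Ω) : G.Info (mover n k) k × unitInterval :=
  (G.infoOf (mover n k) φ.1 (G.play σ φ k), φ.2.1 k)

theorem play_succ_castSucc (σ : G.Profile) (φ : FullState Ω) (k : ℕ) (j : Fin k) :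
    G.play σ φ (k + 1) j.castSucc = G.play σ φ k j :=
  Fin.snoc_castSucc (α := fun _ => G.Record) _ _ j

theorem play_succ_last (σ : G.Profile) (φ : FullState Ω) (k : ℕ) :
    G.play σ φ (k + 1) (Fin.last k) = G.step σ φ k (G.play σ φ k) :=
  Fin.snoc_last (α := fun _ => G.Record) _ _

theorem ann_succ (σ : G.Profile) (k : ℕ) (φ : FullState Ω) :
    G.ann σ (k + 1) φ = (G.step σ φ k (G.play σ φ k)).2 := by
  simp only [ann, lastAnn, hist, play_succ_last]

theorem price_eq (σ : G.Profile) (φ : FullState Ω) : (k : ℕ) → G.price σ φ k = G.ann σ k φ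
  | 0 => rfl
  | k + 1 => by rw [ann_succ]; rfl

theorem play_congr {σ σ' : G.Profile} {φ φ' : FullState Ω} {k : ℕ}
    (h : ∀ j < k, ∀ h, G.step σ φ j h = G.step σ' φ' j h) : G.play σ φ k = G.play σ' φ' k := by
  induction k with
  | zero => rfl
  | succ k ih => rw [play, play, ih fun j hj => h j (by omega), h k (by omega)]

theorem play_redraw (σ : G.Profile) (φ : FullState Ω) (k : ℕ) (v : unitInterval) :
    G.play σ (redraw k (φ, v)) k = G.play σ φ k := by
  refine G.play_congr fun j hj h => ?_
  simp only [step_eq, redraw, Function.update_of_ne hj.ne]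

theorem measurable_infoOf (i : Fin n) (k : ℕ) :
    Measurable fun x : Ω × (Fin k → G.Record) => G.infoOf i x.1 x.2 := by
  unfold infoOf
  exact (measurable_quotient_mk''.comp measurable_fst).prodMk
    (Measurable.prodMk (by fun_prop) (by fun_prop))

theorem measurable_chosen (σ : G.Profile) (k : ℕ) :
    Measurable fun x : (Ω × (ℕ → unitInterval)) × (Fin k → G.Record) =>
      G.chosen σ x.1.1 x.1.2 k x.2 :=
  ((σ _).measurable_signal k).comp (((G.measurable_infoOf _ k).comp
    ((measurable_fst.comp measurable_fst).prodMk measurable_snd)).prodMk (by fun_prop))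

theorem measurable_respond (σ : G.Profile) (k : ℕ) :
    Measurable fun x : ((Ω × (ℕ → unitInterval)) × (Fin k → G.Record)) × ℕ =>
      G.respond σ x.1.1.1 x.1.1.2 k x.1.2 x.2 := by
  have hinfo : Measurable fun x : ((Ω × (ℕ → unitInterval)) × (Fin k → G.Record)) × ℕ =>
      G.infoOf (mover n k) x.1.1.1 x.1.2 :=
    (G.measurable_infoOf _ k).comp (Measurable.prodMk (by fun_prop) (by fun_prop))
  exact (((G.measurable_chosen σ k).comp measurable_fst).prodMk measurable_snd).prodMk
    (((σ _).measurable_announce k).comp ((hinfo.prodMk (by fun_prop)).prodMk measurable_snd))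

theorem measurable_snoc {α A : Type*} [MeasurableSpace α] [MeasurableSpace A] {k : ℕ}
    {f : α → Fin k → A} {g : α → A} (hf : Measurable f) (hg : Measurable g) :
    Measurable fun x => (Fin.snoc (α := fun _ => A) (f x) (g x) : Fin (k + 1) → A) := by
  refine measurable_pi_lambda _ fun j => Fin.lastCases ?_ (fun j => ?_) j
  · simpa using hg
  · simpa [Function.comp_def] using (measurable_pi_apply j).comp hf

variable [MeasurableSingletonClass Ω]

theorem measurable_step (σ : G.Profile) (k : ℕ) :
    Measurable fun x : FullState Ω × (Fin k → G.Record) => G.step σ x.1 k x.2 := by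
  have hchosen : Measurable fun x : FullState Ω × (Fin k → G.Record) =>
      G.chosen σ x.1.1 x.1.2.1 k x.2 :=
    (G.measurable_chosen σ k).comp
      (f := fun x : FullState Ω × (Fin k → G.Record) => ((x.1.1, x.1.2.1), x.2)) (by fun_prop)
  have hrealize : Measurable fun x : FullState Ω × (Fin k → G.Record) =>
      realize ((G.chosen σ x.1.1 x.1.2.1 k x.2).1.prob x.1.1) (x.1.2.2 k) :=
    measurable_realize.comp
      ((G.κ.measurable_prob.comp (Measurable.prodMk (by fun_prop) hchosen)).prodMk (by fun_prop))
  exact (G.measurable_respond σ k).comp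
    (f := fun x : FullState Ω × (Fin k → G.Record) => (((x.1.1, x.1.2.1), x.2), _))
    (Measurable.prodMk (by fun_prop) hrealize)

theorem measurable_play (σ : G.Profile) (k : ℕ) : Measurable fun φ => G.play σ φ k := by
  induction k with
  | zero => exact measurable_const
  | succ k ih => exact measurable_snoc ih ((G.measurable_step σ k).comp (measurable_id.prodMk ih))

theorem measurable_acquired (σ : G.Profile) (k : ℕ) : Measurable fun φ => G.acquired σ φ k :=
  measurable_fst.comp (measurable_fst.comp
    ((G.measurable_step σ k).comp (measurable_id.prodMk (G.measurable_play σ k))))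

theorem measurable_hist (σ : G.Profile) (k : ℕ) : Measurable (G.hist σ k) := by
  have := G.measurable_play σ k
  unfold hist
  fun_prop

theorem measurable_ann (σ : G.Profile) (k : ℕ) : Measurable (G.ann σ k) :=
  (G.measurable_lastAnn k).comp (G.measurable_hist σ k)

theorem measurable_moverInfo (σ : G.Profile) (k : ℕ) : Measurable (G.moverInfo σ k) :=
  ((G.measurable_infoOf _ k).comp (measurable_fst.prodMk (G.measurable_play σ k))).prodMk
    (by fun_prop)

theorem stagePayoff_eq (μ : Ω → ℝ) (σ : G.Profile) (k : ℕ) :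
    G.stagePayoff μ σ k = ((G.β ^ (k + 1) : ℝ) : EReal) *
      (((G.expScore μ (G.ann σ (k + 1)) - G.expScore μ (G.ann σ k) : ℝ) : EReal) -
        (G.expCost μ fun φ => G.acquired σ φ k : EReal)) := by
  unfold stagePayoff expScore
  rw [← integral_sub (G.integrable_score μ (G.measurable_ann σ (k + 1)))
    (G.integrable_score μ (G.measurable_ann σ k))]
  simp only [price_eq]
  rfl

end Play

/-! ### Deviations in one period -/

section Deviation

variable {Ω : Type*} [Fintype Ω] [MeasurableSpace Ω] {n : ℕ} [NeZero n] (G : Game Ω n)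

/-- What trader `i` can do in period `k`: acquire a signal as a function of his information and
private randomization, and make an announcement that depends also on the realization. -/
structure Move (i : Fin n) (k : ℕ) where
  signal : G.Info i k × unitInterval → G.κ.avail
  announce : (G.Info i k × unitInterval) × ℕ → G.Ann
  measurable_signal : Measurable signal
  measurable_announce : Measurable announce

variable {G}

/-- Play the strategy `τ` before period `k` and make the move `m` in period `k`; afterwards,
acquire no information and repeat the last announcement. -/
def deviation {i : Fin n} (τ : G.Strategy i) {k : ℕ} (m : G.Move i k) : G.Strategy i where
  signal := Function.update (fun j => if j < k then τ.signal j else fun _ => G.free) k m.signal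
  announce := Function.update
    (fun j => if j < k then τ.announce j else fun a => G.lastAnn a.1.1.2.2) k m.announce
  measurable_signal j := by
    obtain rfl | h := eq_or_ne j k
    · simpa using m.measurable_signal
    · rw [Function.update_of_ne h]
      split_ifs
      · exact τ.measurable_signal j
      · exact measurable_const
  measurable_announce j := by
    obtain rfl | h := eq_or_ne j k
    · simpa using m.measurable_announce
    · rw [Function.update_of_ne h]
      split_ifs
      · exact τ.measurable_announce j
      · exact (G.measurable_lastAnn j).comp (by fun_prop)

variable (σ : G.Profile) {k : ℕ} (m : G.Move (mover n k) k)

/-- The profile in which the mover of period `k` makes the move `m` in that period and is passive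
afterwards. -/
def devProfile : G.Profile := Function.update σ (mover n k) (deviation (σ (mover n k)) m)

/-- The signal that the move `m` acquires against the profile `σ`. -/
def Move.signalOn (φ : FullState Ω) : G.κ.avail := m.signal (G.moverInfo σ k φ)

/-- The announcement that the move `m` makes against the profile `σ`. -/
def Move.annOn (φ : FullState Ω) : G.Ann :=
  m.announce (G.moverInfo σ k φ, realize ((m.signalOn σ φ).1.prob φ.1) (φ.2.2 k))

/-- Expected undiscounted gain, net of costs, from the move `m` in its period. -/
def Move.netGain (μ : Ω → ℝ) : EReal :=
  ((G.expScore μ (m.annOn σ) - G.expScore μ (G.ann σ k) : ℝ) : EReal) -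
    (G.expCost μ (m.signalOn σ) : EReal)

theorem step_devProfile_of_lt {j : ℕ} (hj : j < k) (φ : FullState Ω) (h : Fin j → G.Record) :
    G.step (devProfile σ m) φ j h = G.step σ φ j h := by
  have agree : ∀ i, (devProfile σ m i).signal j = (σ i).signal j ∧
      (devProfile σ m i).announce j = (σ i).announce j := fun i => by
    obtain rfl | hi := eq_or_ne i (mover n k)
    · simp [devProfile, deviation, Function.update_of_ne hj.ne, hj]
    · simp [devProfile, Function.update_of_ne hi]
  simp only [step, agree]

theorem play_devProfile_of_le {j : ℕ} (hj : j ≤ k) (φ : FullState Ω) :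
    G.play (devProfile σ m) φ j = G.play σ φ j :=
  G.play_congr fun _ hl => step_devProfile_of_lt σ m (hl.trans_le hj) φ

theorem ann_devProfile_of_le {j : ℕ} (hj : j ≤ k) : G.ann (devProfile σ m) j = G.ann σ j := by
  funext φ
  unfold ann hist
  simp only [play_devProfile_of_le σ m hj]

theorem step_devProfile_self (φ : FullState Ω) :
    (G.step (devProfile σ m) φ k (G.play (devProfile σ m) φ k)).1.1 = m.signalOn σ φ ∧
      (G.step (devProfile σ m) φ k (G.play (devProfile σ m) φ k)).2 = m.annOn σ φ := by
  have hsignal : (devProfile σ m (mover n k)).signal k = m.signal := by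
    simp [devProfile, deviation]
  have hannounce : (devProfile σ m (mover n k)).announce k = m.announce := by
    simp [devProfile, deviation]
  simp only [play_devProfile_of_le σ m le_rfl, step, hsignal, hannounce]
  exact ⟨rfl, rfl⟩

theorem step_devProfile_of_gt {j : ℕ} (hj : k < j) (hm : mover n j = mover n k)
    (φ : FullState Ω) (h : Fin j → G.Record) :
    (G.step (devProfile σ m) φ j h).1.1 = G.free ∧
      (G.step (devProfile σ m) φ j h).2 = G.lastAnn fun l => (h l).2 := by
  have passive : ∀ i, i = mover n k → (∀ a, (devProfile σ m i).signal j a = G.free) ∧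
      ∀ a, (devProfile σ m i).announce j a = G.lastAnn a.1.1.2.2 := by
    rintro i rfl
    simp [devProfile, deviation, Function.update_of_ne hj.ne', hj.not_gt]
  simp only [step, (passive _ hm).1, (passive _ hm).2]
  exact ⟨trivial, rfl⟩

variable [MeasurableSingletonClass Ω] (μ : Ω → ℝ)

theorem stagePayoff_devProfile_of_lt {j : ℕ} (hj : j < k) :
    G.stagePayoff μ (devProfile σ m) j = G.stagePayoff μ σ j := by
  simp only [stagePayoff_eq, acquired, ann_devProfile_of_le σ m hj,
    ann_devProfile_of_le σ m hj.le, play_devProfile_of_le σ m hj.le, step_devProfile_of_lt σ m hj]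

theorem stagePayoff_devProfile_self :
    G.stagePayoff μ (devProfile σ m) k = ((G.β ^ (k + 1) : ℝ) : EReal) * m.netGain σ μ := by
  have hann : G.ann (devProfile σ m) (k + 1) = m.annOn σ :=
    funext fun φ => (G.ann_succ _ _ _).trans (step_devProfile_self σ m φ).2
  have hacq : (fun φ => G.acquired (devProfile σ m) φ k) = m.signalOn σ :=
    funext fun φ => (step_devProfile_self σ m φ).1
  rw [stagePayoff_eq, Move.netGain, hann, hacq, ann_devProfile_of_le σ m le_rfl]

theorem stagePayoff_devProfile_of_gt {j : ℕ} (hj : k < j) (hm : mover n j = mover n k) :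
    G.stagePayoff μ (devProfile σ m) j = 0 := by
  have hann : G.ann (devProfile σ m) (j + 1) = G.ann (devProfile σ m) j :=
    funext fun φ => (G.ann_succ _ _ _).trans (step_devProfile_of_gt σ m hj hm φ _).2
  have hacq : (fun φ => G.acquired (devProfile σ m) φ j) = fun _ => G.free :=
    funext fun φ => (step_devProfile_of_gt σ m hj hm φ _).1
  simp [stagePayoff_eq, hann, hacq]

theorem payoff_devProfile :
    G.payoff μ (devProfile σ m) (mover n k) =
      ∑ j ∈ Finset.range k with mover n j = mover n k, G.stagePayoff μ σ j +
        ((G.β ^ (k + 1) : ℝ) : EReal) * m.netGain σ μ := by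
  have sum_succ : ∑ j ∈ Finset.range (k + 1) with mover n j = mover n k,
      G.stagePayoff μ (devProfile σ m) j = ∑ j ∈ Finset.range k with mover n j = mover n k,
        G.stagePayoff μ σ j + ((G.β ^ (k + 1) : ℝ) : EReal) * m.netGain σ μ := by
    rw [Finset.sum_filter, Finset.sum_range_succ, if_pos rfl, stagePayoff_devProfile_self,
      ← Finset.sum_filter]
    exact congrArg (· + _) (Finset.sum_congr rfl fun j hj =>
      stagePayoff_devProfile_of_lt σ m μ (Finset.mem_range.1 (Finset.mem_filter.1 hj).1))
  rw [← sum_succ]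
  refine (tendsto_const_nhds.congr' ?_).liminf_eq
  filter_upwards [eventually_ge_atTop (k + 1)] with N hN
  refine Finset.sum_subset (Finset.filter_subset_filter _ (Finset.range_mono hN)) fun j hj hjk => ?_
  rw [Finset.mem_filter] at hj
  have hlt : k < j := by
    by_contra! hle
    exact hjk (Finset.mem_filter.2 ⟨Finset.mem_range.2 (Nat.lt_succ_of_le hle), hj.2⟩)
  exact stagePayoff_devProfile_of_gt σ m μ hlt hj.2

variable {σ μ} in
theorem IsNash.add_netGain_le (hσ : G.IsNash μ σ) :
    ∑ j ∈ Finset.range k with mover n j = mover n k, G.stagePayoff μ σ j +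
      ((G.β ^ (k + 1) : ℝ) : EReal) * m.netGain σ μ ≤ G.payoff μ σ (mover n k) :=
  (payoff_devProfile σ m μ).symm.le.trans (hσ _ _)

end Deviation

end Game

/-! ### Continuation payoffs vanish -/

section Continuation

variable {β B L : ℝ} {S C : ℕ → ℝ}

/-- Discounted total payoff of all traders from the first `N` periods, if the expected score is
`S k` before period `k` and the expected cost of period `k` is `C k`. -/
def totalPayoff (β : ℝ) (S C : ℕ → ℝ) (N : ℕ) : ℝ :=
  ∑ k ∈ Finset.range N, β ^ (k + 1) * (S (k + 1) - S k - C k)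

section Total

variable (hβ : 0 < β) (hβ1 : β ≤ 1) (hS : ∀ k, |S k| ≤ B) (hC : ∀ k, 0 ≤ C k)

include hβ hβ1 hS hC

theorem totalPayoff_add_sub_le_telescope (N m : ℕ) :
    totalPayoff β S C (N + m) - totalPayoff β S C N ≤
      β ^ (N + 1) * (B - S N) - β ^ (N + m + 1) * (B - S (N + m)) := by
  induction m with
  | zero => simp
  | succ m ih =>
    have hpow : 0 < β ^ (N + m + 1) := by positivity
    have hdiscount : β ^ (N + m + 1 + 1) * (B - S (N + m + 1)) ≤
        β ^ (N + m + 1) * (B - S (N + m + 1)) :=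
      mul_le_mul_of_nonneg_right (pow_le_pow_of_le_one hβ.le hβ1 (by omega))
        (sub_nonneg.2 (le_of_abs_le (hS _)))
    have hcost := mul_nonneg hpow.le (hC (N + m))
    simp only [totalPayoff, ← add_assoc, Finset.sum_range_succ] at ih ⊢
    linarith

theorem totalPayoff_add_sub_le (N m : ℕ) :
    totalPayoff β S C (N + m) - totalPayoff β S C N ≤ 2 * B * β ^ (N + 1) := by
  have htelescope := totalPayoff_add_sub_le_telescope hβ hβ1 hS hC N m
  have hlast : 0 ≤ β ^ (N + m + 1) * (B - S (N + m)) :=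
    mul_nonneg (by positivity) (sub_nonneg.2 (le_of_abs_le (hS _)))
  have hfirst : β ^ (N + 1) * (B - S N) ≤ β ^ (N + 1) * (2 * B) :=
    mul_le_mul_of_nonneg_left (by linarith [neg_le_of_abs_le (hS N)]) (by positivity)
  linarith

theorem totalPayoff_le (N : ℕ) : totalPayoff β S C N ≤ 2 * B * β := by
  simpa [totalPayoff] using totalPayoff_add_sub_le hβ hβ1 hS hC 0 N

/-- If `β < 1`, then `(1 - β) * ∑ T, (L - totalPayoff β S C T) / β ^ (T + 1)` telescopes, up to
bounded terms. -/
theorem tendsto_totalPayoff_gap_div_pow (hL : Tendsto (totalPayoff β S C) atTop (𝓝 L))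
    (hle : ∀ N, totalPayoff β S C N ≤ L) :
    Tendsto (fun N => (L - totalPayoff β S C N) / β ^ (N + 1)) atTop (𝓝 0) := by
  obtain rfl | hlt := hβ1.eq_or_lt
  · simpa using hL.const_sub L
  have hpow : ∀ N : ℕ, 0 < β ^ (N + 1) := fun N => by positivity
  set Ψ : ℕ → ℝ := fun N => (L - totalPayoff β S C N) / β ^ (N + 1) with hΨ
  have nonneg : ∀ N, 0 ≤ Ψ N := fun N => div_nonneg (sub_nonneg.2 (hle N)) (hpow N).le
  have le_bound : ∀ N, Ψ N ≤ 2 * B := fun N => by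
    refine (div_le_iff₀ (hpow N)).2 (le_of_tendsto (hL.sub_const _) ?_)
    filter_upwards [eventually_ge_atTop N] with M hM
    obtain ⟨m, rfl⟩ := Nat.exists_eq_add_of_le hM
    exact totalPayoff_add_sub_le hβ hβ1 hS hC N m
  have recursion : ∀ N, Ψ N - β * Ψ (N + 1) = S (N + 1) - S N - C N := fun N => by
    simp only [hΨ, totalPayoff, Finset.sum_range_succ]
    field_simp
    ring
  have sum_le : ∀ N,
      (1 - β) * ∑ k ∈ Finset.range N, Ψ k + β * Ψ 0 - β * Ψ N ≤ S N - S 0 := fun N => by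
    induction N with
    | zero => simp
    | succ N ih =>
      rw [Finset.sum_range_succ]
      linarith [recursion N, hC N]
  have hsummable : Summable Ψ := by
    refine summable_of_sum_range_le (c := (2 * B + β * (2 * B)) / (1 - β)) nonneg fun N => ?_
    rw [le_div_iff₀ (sub_pos.2 hlt)]
    linarith [sum_le N, mul_le_mul_of_nonneg_left (le_bound N) hβ.le, mul_nonneg hβ.le (nonneg 0),
      le_of_abs_le (hS N), neg_le_of_abs_le (hS 0)]
  exact hsummable.tendsto_atTop_zero

end Total

variable {n : ℕ} [NeZero n]

/-- Discounted payoff of trader `i` from the first `N` periods. -/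
def partialPayoff (β : ℝ) (S C : ℕ → ℝ) (i : Fin n) (N : ℕ) : ℝ :=
  ∑ k ∈ Finset.range N with Game.mover n k = i, β ^ (k + 1) * (S (k + 1) - S k - C k)

theorem sum_partialPayoff (N : ℕ) :
    ∑ i : Fin n, partialPayoff β S C i N = totalPayoff β S C N :=
  Finset.sum_fiberwise (Finset.range N) (Game.mover n) _

section Limit

variable (hβ : 0 < β) (hβ1 : β ≤ 1) (hS : ∀ k, |S k| ≤ B) (hC : ∀ k, 0 ≤ C k)

include hβ hβ1 hS hC

theorem ne_top_of_tendsto_partialPayoff {U : Fin n → EReal} (hU : ∀ i, 0 ≤ U i)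
    (hlim : ∀ i, Tendsto (fun N => (partialPayoff β S C i N : EReal)) atTop (𝓝 (U i)))
    (i : Fin n) : U i ≠ ⊤ := by
  have eventually_gt : ∀ᶠ N in atTop, ∀ j : Fin n, -1 < partialPayoff β S C j N :=
    eventually_all.2 fun j => by
      have hj : ((-1 : ℝ) : EReal) < U j :=
        (EReal.coe_lt_coe_iff.2 (by norm_num : (-1 : ℝ) < 0)).trans_le (hU j)
      exact ((hlim j).eventually (lt_mem_nhds hj)).mono fun N => EReal.coe_lt_coe_iff.1
  have eventually_le : ∀ᶠ N in atTop,
      (partialPayoff β S C i N : EReal) ≤ ((2 * B * β + n : ℝ) : EReal) := by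
    filter_upwards [eventually_gt] with N hN
    have hothers : -(n : ℝ) ≤ ∑ j ∈ Finset.univ.erase i, partialPayoff β S C j N := by
      refine le_trans ?_ (Finset.sum_le_sum fun j _ => (hN j).le)
      simp
    have htotal := totalPayoff_le hβ hβ1 hS hC N
    rw [← sum_partialPayoff (n := n), ← Finset.add_sum_erase _ _ (Finset.mem_univ i)] at htotal
    exact EReal.coe_le_coe_iff.2 (by linarith)
  exact ne_top_of_le_ne_top (EReal.coe_ne_top _) (le_of_tendsto (hlim i) eventually_le)

theorem exists_tendsto_partialPayoff {U : Fin n → EReal}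
    (hU : ∀ i, U i = liminf (fun N => (partialPayoff β S C i N : EReal)) atTop)
    (hle : ∀ i N, (partialPayoff β S C i N : EReal) ≤ U i) :
    ∃ u : Fin n → ℝ, (∀ i, U i = u i) ∧ (∀ i N, partialPayoff β S C i N ≤ u i) ∧
      ∀ i, Tendsto (partialPayoff β S C i) atTop (𝓝 (u i)) := by
  have hlim : ∀ i, Tendsto (fun N => (partialPayoff β S C i N : EReal)) atTop (𝓝 (U i)) := fun i =>
    tendsto_of_le_liminf_of_limsup_le (hU i).le (limsup_le_of_le (h := .of_forall (hle i)))
  have nonneg : ∀ i, 0 ≤ U i := fun i => by simpa [partialPayoff] using hle i 0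
  have coe_toReal : ∀ i, U i = ((U i).toReal : EReal) := fun i =>
    (EReal.coe_toReal (ne_top_of_tendsto_partialPayoff hβ hβ1 hS hC nonneg hlim i)
      (EReal.bot_lt_zero.trans_le (nonneg i)).ne').symm
  refine ⟨fun i => (U i).toReal, coe_toReal, fun i N => ?_, fun i => ?_⟩
  · exact EReal.coe_le_coe_iff.1 (coe_toReal i ▸ hle i N)
  · exact EReal.tendsto_coe.1 (coe_toReal i ▸ hlim i)

theorem tendsto_partialPayoff_gap_div_pow {u : Fin n → ℝ}
    (hle : ∀ i N, partialPayoff β S C i N ≤ u i)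
    (hlim : ∀ i, Tendsto (partialPayoff β S C i) atTop (𝓝 (u i))) :
    Tendsto (fun k => (u (Game.mover n k) - partialPayoff β S C (Game.mover n k) k) / β ^ (k + 1))
      atTop (𝓝 0) := by
  have hsum : ∀ N, ∑ i, (u i - partialPayoff β S C i N) = ∑ i, u i - totalPayoff β S C N :=
    fun N => by rw [Finset.sum_sub_distrib, sum_partialPayoff]
  have hgap : ∀ i N, 0 ≤ u i - partialPayoff β S C i N := fun i N => sub_nonneg.2 (hle i N)
  refine squeeze_zero (fun k => div_nonneg (hgap _ _) (by positivity)) (fun k => ?_)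
    (tendsto_totalPayoff_gap_div_pow hβ hβ1 hS hC (L := ∑ i, u i) ?_ fun N => ?_)
  · rw [← hsum]
    exact div_le_div_of_nonneg_right (Finset.single_le_sum
      (f := fun i => u i - partialPayoff β S C i k) (fun i _ => hgap i k) (Finset.mem_univ _))
      (by positivity)
  · simpa only [sum_partialPayoff] using tendsto_finsetSum Finset.univ fun i _ => hlim i
  · exact sub_nonneg.1 (hsum N ▸ Finset.sum_nonneg fun i _ => hgap i N)

end Limit

end Continuation

namespace Game

variable {Ω : Type*} [Fintype Ω] [MeasurableSpace Ω] {n : ℕ} [NeZero n] {G : Game Ω n}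

theorem exists_mover_eq (i : Fin n) (N : ℕ) : ∃ k, N ≤ k ∧ mover n k = i := by
  refine ⟨n * N + i, ?_, ?_⟩
  · have := Nat.le_mul_of_pos_left N (NeZero.pos n)
    omega
  · ext
    simp [mover, Fin.ofNat, Nat.mod_eq_of_lt i.2]

theorem exists_mover_eq_and_filter_range_eq (i : Fin n) (N : ℕ) :
    ∃ k, mover n k = i ∧ {j ∈ Finset.range k | mover n j = i} =
      {j ∈ Finset.range N | mover n j = i} := by
  classical
  have hex := exists_mover_eq i N
  refine ⟨Nat.find hex, (Nat.find_spec hex).2, ?_⟩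
  ext j
  simp only [Finset.mem_filter, Finset.mem_range, and_congr_left_iff, Nat.lt_find_iff]
  refine fun hj => ⟨fun h => ?_, fun h m hm hmN => by omega⟩
  by_contra! hN
  exact h j le_rfl ⟨hN, hj⟩

/-- The move in which the trader acquires no information and repeats the last announcement. -/
def Move.passive (i : Fin n) (k : ℕ) : G.Move i k where
  signal _ := G.free
  announce a := G.lastAnn a.1.1.2.2
  measurable_signal := measurable_const
  measurable_announce := (G.measurable_lastAnn k).comp (by fun_prop)

theorem Move.netGain_passive (σ : G.Profile) (μ : Ω → ℝ) (k : ℕ) :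
    (Move.passive (mover n k) k).netGain σ μ = 0 := by
  have hann : (Move.passive (mover n k) k).annOn σ = G.ann σ k := rfl
  have hsignal : (Move.passive (mover n k) k).signalOn σ = fun _ => G.free := rfl
  simp [Move.netGain, hann, hsignal]

variable [MeasurableSingletonClass Ω] {μ : Ω → ℝ} {σ : G.Profile}

theorem payoff_of_expCost_eq_top {k : ℕ} (h : (G.expCost μ fun φ => G.acquired σ φ k) = ⊤) :
    G.payoff μ σ (mover n k) = ⊥ := by
  have hstage : G.stagePayoff μ σ k = ⊥ := by
    rw [stagePayoff_eq, h, EReal.coe_ennreal_top, EReal.sub_top,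
      EReal.coe_mul_bot_of_pos (pow_pos G.β_pos _)]
  refine (tendsto_const_nhds.congr' ?_).liminf_eq
  filter_upwards [eventually_gt_atTop k] with N hN
  rw [← Finset.add_sum_erase _ _ (show k ∈ (Finset.range N).filter _ by simp [hN]), hstage,
    EReal.bot_add]

theorem sum_stagePayoff (h : ∀ k, (G.expCost μ fun φ => G.acquired σ φ k) ≠ ⊤) (i : Fin n)
    (N : ℕ) :
    ∑ k ∈ Finset.range N with mover n k = i, G.stagePayoff μ σ k =
      (partialPayoff G.β (fun k => G.expScore μ (G.ann σ k))
        (fun k => (G.expCost μ fun φ => G.acquired σ φ k).toReal) i N : EReal) := by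
  have hstage : ∀ k, G.stagePayoff μ σ k = ((G.β ^ (k + 1) *
      (G.expScore μ (G.ann σ (k + 1)) - G.expScore μ (G.ann σ k) -
        (G.expCost μ fun φ => G.acquired σ φ k).toReal) : ℝ) : EReal) := fun k => by
    rw [stagePayoff_eq, ← EReal.coe_ennreal_toReal (h k)]
    norm_cast
  simp only [hstage, partialPayoff]
  exact (map_sum (⟨⟨Real.toEReal, EReal.coe_zero⟩, EReal.coe_add⟩ : ℝ →+ EReal) _ _).symm

theorem IsNash.sum_stagePayoff_le (hσ : G.IsNash μ σ) (i : Fin n) (N : ℕ) :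
    ∑ k ∈ Finset.range N with mover n k = i, G.stagePayoff μ σ k ≤ G.payoff μ σ i := by
  obtain ⟨k, rfl, hk⟩ := exists_mover_eq_and_filter_range_eq i N
  rw [← hk]
  simpa only [Move.netGain_passive, mul_zero, add_zero] using
    hσ.add_netGain_le (Move.passive (mover n k) k)

theorem IsNash.expCost_acquired_ne_top (hσ : G.IsNash μ σ) (k : ℕ) :
    (G.expCost μ fun φ => G.acquired σ φ k) ≠ ⊤ := by
  intro h
  have := hσ.sum_stagePayoff_le (mover n k) 0
  simp [payoff_of_expCost_eq_top h] at this

/-- Discounting does not hide the gains: the sum of the continuation payoffs of all traders vanishes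
relative to the discount factor. -/
theorem IsNash.exists_netGain_le (hμ : μ ∈ stdSimplex ℝ Ω) (hσ : G.IsNash μ σ) :
    ∃ e : ℕ → ℝ, Tendsto e atTop (𝓝 0) ∧
      ∀ k (m : G.Move (mover n k) k), m.netGain σ μ ≤ e k := by
  have hfin := hσ.expCost_acquired_ne_top
  have hS : ∀ k, |G.expScore μ (G.ann σ k)| ≤ G.scoreBound := fun k => G.abs_expScore_le hμ _
  have hC : ∀ k, 0 ≤ (G.expCost μ fun φ => G.acquired σ φ k).toReal :=
    fun k => ENNReal.toReal_nonneg
  obtain ⟨u, hu, hle, hlim⟩ := exists_tendsto_partialPayoff G.β_pos G.β_le_one hS hC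
    (U := G.payoff μ σ) (fun i => by simp only [← sum_stagePayoff hfin]; rfl)
    (fun i N => sum_stagePayoff hfin i N ▸ hσ.sum_stagePayoff_le i N)
  refine ⟨_, tendsto_partialPayoff_gap_div_pow G.β_pos G.β_le_one hS hC hle hlim, fun k m => ?_⟩
  have hpow : 0 < G.β ^ (k + 1) := pow_pos G.β_pos _
  have hdev := hσ.add_netGain_le m
  rw [sum_stagePayoff hfin, hu] at hdev
  induction hd : m.netGain σ μ with
  | bot => exact bot_le
  | top =>
    rw [hd, EReal.coe_mul_top_of_pos hpow, EReal.coe_add_top, top_le_iff] at hdev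
    exact absurd hdev (EReal.coe_ne_top _)
  | coe d =>
    rw [hd] at hdev
    norm_cast at hdev ⊢
    rw [le_div_iff₀ hpow]
    linarith

end Game

/-! ### Strict propriety on the simplex of beliefs -/

theorem continuous_mean {Ω : Type*} [Fintype Ω] (X : Ω → ℝ) :
    Continuous fun γ : Ω → ℝ => mean γ X := by
  unfold mean
  fun_prop

namespace Game

section Proper

variable {Ω : Type*} [Fintype Ω] {n : ℕ} (G : Game Ω n)

/-- The mean of `X` under the belief `γ`, as an announcement (projected to the admissible interval
if `γ` is not a probability). -/
def meanAnn (γ : Ω → ℝ) : G.Ann := Set.projIcc _ _ (G.y₀.2.1.trans G.y₀.2.2) (mean γ G.X)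

theorem continuous_meanAnn : Continuous G.meanAnn := continuous_projIcc.comp (continuous_mean G.X)

theorem coe_meanAnn {γ : Ω → ℝ} (hγ : γ ∈ stdSimplex ℝ Ω) : (G.meanAnn γ : ℝ) = mean γ G.X := by
  rw [meanAnn, Set.projIcc_of_mem _ (G.mean_mem hγ)]

theorem sum_score_lt {γ : Ω → ℝ} (hγ : γ ∈ stdSimplex ℝ Ω) {y : G.Ann}
    (hy : (y : ℝ) ≠ mean γ G.X) :
    ∑ ω, γ ω * G.score y ω < ∑ ω, γ ω * G.score (G.meanAnn γ) ω := by
  simpa only [score, G.coe_meanAnn hγ] using G.s_strictlyProper γ hγ y y.2 hy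

theorem sum_score_le {γ : Ω → ℝ} (hγ : γ ∈ stdSimplex ℝ Ω) (y : G.Ann) :
    ∑ ω, γ ω * G.score y ω ≤ ∑ ω, γ ω * G.score (G.meanAnn γ) ω := by
  by_cases hy : (y : ℝ) = mean γ G.X
  · rw [show y = G.meanAnn γ from Subtype.ext (hy.trans (G.coe_meanAnn hγ).symm)]
  · exact (G.sum_score_lt hγ hy).le

/-- The expected loss from the announcement `y` at the belief `γ`, for the pair `(γ, y)`. -/
def loss (x : (Ω → ℝ) × G.Ann) : ℝ :=
  ∑ ω, x.1 ω * (G.score (G.meanAnn x.1) ω - G.score x.2 ω)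

theorem continuous_loss : Continuous G.loss :=
  continuous_finsetSum _ fun ω _ => Continuous.mul (by fun_prop)
    (((G.continuous_score ω).comp (G.continuous_meanAnn.comp continuous_fst)).sub
      ((G.continuous_score ω).comp continuous_snd))

theorem loss_eq (x : (Ω → ℝ) × G.Ann) :
    G.loss x = ∑ ω, x.1 ω * G.score (G.meanAnn x.1) ω - ∑ ω, x.1 ω * G.score x.2 ω := by
  simp only [loss, mul_sub, Finset.sum_sub_distrib]

theorem loss_nonneg {x : (Ω → ℝ) × G.Ann} (hx : x.1 ∈ stdSimplex ℝ Ω) : 0 ≤ G.loss x := by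
  rw [loss_eq]
  exact sub_nonneg.2 (G.sum_score_le hx x.2)

theorem exists_le_loss {ε : ℝ} (hε : 0 < ε) : ∃ δ > 0, ∀ x : (Ω → ℝ) × G.Ann,
    x.1 ∈ stdSimplex ℝ Ω → ε ≤ |(x.2 : ℝ) - mean x.1 G.X| → δ ≤ G.loss x := by
  set far : Set ((Ω → ℝ) × G.Ann) := (stdSimplex ℝ Ω ×ˢ Set.univ) ∩
    {x | ε ≤ |(x.2 : ℝ) - mean x.1 G.X|}
  have far_compact : IsCompact far := by
    refine ((isCompact_stdSimplex ℝ Ω).prod isCompact_univ).inter_right ?_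
    exact isClosed_le continuous_const ((continuous_subtype_val.comp continuous_snd).sub
      ((continuous_mean G.X).comp continuous_fst)).abs
  obtain hempty | hne := far.eq_empty_or_nonempty
  · exact ⟨1, one_pos, fun x hx hfar =>
      (Set.eq_empty_iff_forall_notMem.1 hempty x ⟨⟨hx, trivial⟩, hfar⟩).elim⟩
  · obtain ⟨x₀, ⟨⟨hx₀, -⟩, hfar₀⟩, hmin⟩ :=
      far_compact.exists_isMinOn hne G.continuous_loss.continuousOn
    have hne : (x₀.2 : ℝ) ≠ mean x₀.1 G.X := sub_ne_zero.1 (abs_pos.1 (hε.trans_le hfar₀))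
    refine ⟨G.loss x₀, ?_, fun x hx hfar => hmin ⟨⟨hx, trivial⟩, hfar⟩⟩
    rw [gt_iff_lt, loss_eq]
    exact sub_pos.2 (G.sum_score_lt hx₀ hne)

theorem exists_norm_le_of_continuous {f : (Ω → ℝ) × G.Ann → ℝ} (hf : Continuous f) :
    ∃ C, ∀ x : (Ω → ℝ) × G.Ann, x.1 ∈ stdSimplex ℝ Ω → ‖f x‖ ≤ C := by
  obtain ⟨C, hC⟩ := ((isCompact_stdSimplex ℝ Ω).prod
    (isCompact_univ : IsCompact (Set.univ : Set G.Ann))).exists_bound_of_continuousOn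
    hf.continuousOn
  exact ⟨C, fun x hx => hC x ⟨hx, trivial⟩⟩

theorem integrable_comp_belief {A : Type*} [MeasurableSpace A] {P : Measure A} [IsFiniteMeasure P]
    {f : (Ω → ℝ) × G.Ann → ℝ} (hf : Continuous f) {γ : A → Ω → ℝ} (hγ : Measurable γ)
    (hsimplex : ∀ᵐ a ∂P, γ a ∈ stdSimplex ℝ Ω) {y : A → G.Ann} (hy : Measurable y) :
    Integrable (fun a => f (γ a, y a)) P := by
  obtain ⟨C, hC⟩ := G.exists_norm_le_of_continuous hf
  exact Integrable.of_bound (hf.measurable.comp (hγ.prodMk hy)).aestronglyMeasurable C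
    (hsimplex.mono fun a ha => hC (γ a, y a) ha)

end Proper

end Game

/-! ### Public beliefs -/

section Belief

variable {Ω : Type*} [Fintype Ω]

theorem sum_mul_indicator_state (f : Ω → ℝ) (φ : FullState Ω) :
    ∑ ω, f ω * (Prod.fst ⁻¹' {ω} : Set (FullState Ω)).indicator (fun _ => (1 : ℝ)) φ = f φ.1 := by
  classical
  rw [Finset.sum_eq_single φ.1]
  · simp
  · intro ω _ hω
    simp [hω.symm]
  · simp

variable [MeasurableSpace Ω]

/-- The conditional probability of the state `ω` given the information `m`. -/
def belief (μ : Ω → ℝ) (m : MeasurableSpace (FullState Ω)) (φ : FullState Ω) (ω : Ω) : ℝ :=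
  ((law μ)[(Prod.fst ⁻¹' {ω}).indicator (fun _ => (1 : ℝ)) | m]) φ

variable {μ : Ω → ℝ} {m : MeasurableSpace (FullState Ω)}

theorem measurable_belief : Measurable[m] (belief μ m) :=
  measurable_pi_lambda _ fun _ => stronglyMeasurable_condExp.measurable

variable [MeasurableSingletonClass Ω]

theorem integrable_indicator_state (μ : Ω → ℝ) (ω : Ω) :
    Integrable ((Prod.fst ⁻¹' {ω}).indicator (fun _ => (1 : ℝ)) : FullState Ω → ℝ) (law μ) :=
  (integrable_const 1).indicator (measurable_fst (measurableSet_singleton ω))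

theorem belief_mem_stdSimplex (hm : m ≤ Prod.instMeasurableSpace) :
    ∀ᵐ φ ∂(law μ), belief μ m φ ∈ stdSimplex ℝ Ω := by
  have nonneg : ∀ᵐ φ ∂(law μ), ∀ ω, 0 ≤ belief μ m φ ω := ae_all_iff.2 fun ω =>
    condExp_nonneg (ae_of_all _ fun φ => Set.indicator_nonneg (fun _ _ => zero_le_one) φ)
  have sum_one := condExp_finsetSum (μ := law μ) (m := m) (s := Finset.univ)
    (f := fun ω : Ω => ((Prod.fst ⁻¹' {ω}).indicator (fun _ => (1 : ℝ)) : FullState Ω → ℝ))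
    fun ω _ => integrable_indicator_state μ ω
  have sum_indicator : (∑ ω : Ω, (Prod.fst ⁻¹' {ω}).indicator (fun _ => (1 : ℝ)) :
      FullState Ω → ℝ) = fun _ => 1 := by
    ext φ
    simpa only [Finset.sum_apply, one_mul] using sum_mul_indicator_state (fun _ => 1) φ
  rw [sum_indicator, condExp_const hm] at sum_one
  filter_upwards [nonneg, sum_one] with φ hφ0 hφ1
  exact ⟨hφ0, by rw [Finset.sum_apply] at hφ1; exact hφ1.symm⟩

theorem integral_belief (hm : m ≤ Prod.instMeasurableSpace) {F : FullState Ω → Ω → ℝ} {B : ℝ}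
    (hF : ∀ ω, StronglyMeasurable[m] fun φ => F φ ω) (hB : ∀ φ ω, |F φ ω| ≤ B) :
    ∫ φ, F φ φ.1 ∂(law μ) = ∫ φ, ∑ ω, belief μ m φ ω * F φ ω ∂(law μ) := by
  have bound : ∀ ω, ∀ᵐ φ ∂(law μ), ‖F φ ω‖ ≤ B := fun ω => ae_of_all _ fun φ => hB φ ω
  have integrable_left : ∀ ω, Integrable (fun φ => F φ ω *
      (Prod.fst ⁻¹' {ω} : Set (FullState Ω)).indicator (fun _ => (1 : ℝ)) φ) (law μ) := fun ω =>
    (integrable_indicator_state μ ω).bdd_mul ((hF ω).mono hm).aestronglyMeasurable (bound ω)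
  have integrable_right : ∀ ω, Integrable (fun φ => belief μ m φ ω * F φ ω) (law μ) := fun ω =>
    (integrable_condExp (m := m)).mul_bdd ((hF ω).mono hm).aestronglyMeasurable (bound ω)
  simp_rw [← fun φ : FullState Ω => sum_mul_indicator_state (F φ) φ]
  rw [integral_finsetSum _ fun ω _ => integrable_left ω,
    integral_finsetSum _ fun ω _ => integrable_right ω]
  refine Finset.sum_congr rfl fun ω _ => ?_
  rw [← integral_condExp hm]
  refine integral_congr_ae ?_
  filter_upwards [condExp_stronglyMeasurable_mul_of_bound hm (hF ω)
    (integrable_indicator_state μ ω) B (bound ω)] with φ hφ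
  rw [mul_comm]
  exact hφ

theorem ae_belief_pos (hm : m ≤ Prod.instMeasurableSpace) :
    ∀ᵐ φ ∂(law μ), 0 < belief μ m φ φ.1 := by
  classical
  set excluded : FullState Ω → Ω → ℝ := fun φ ω => if belief μ m φ ω ≤ 0 then 1 else 0
    with hexcluded
  have hmeas : ∀ ω, Measurable[m] fun φ => excluded φ ω := fun ω =>
    Measurable.ite (measurableSet_le ((measurable_pi_apply ω).comp measurable_belief)
      measurable_const) measurable_const measurable_const
  have nonneg : ∀ φ ω, 0 ≤ excluded φ ω := fun φ ω => by
    simp only [hexcluded]; split_ifs <;> simp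
  have le_one : ∀ φ ω, |excluded φ ω| ≤ 1 := fun φ ω => by
    simp only [hexcluded]; split_ifs <;> simp
  have hintegral : ∫ φ, excluded φ φ.1 ∂(law μ) = 0 := by
    rw [integral_belief hm (fun ω => (hmeas ω).stronglyMeasurable) le_one]
    refine integral_eq_zero_of_ae ?_
    filter_upwards [belief_mem_stdSimplex (μ := μ) hm] with φ hφ
    refine Finset.sum_eq_zero fun ω _ => ?_
    simp only [hexcluded]
    split_ifs with hle
    · rw [le_antisymm hle (hφ.1 ω), zero_mul]
    · rw [mul_zero]
  have hint : Integrable (fun φ => excluded φ φ.1) (law μ) :=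
    Integrable.of_bound ((measurable_from_prod_countable_right (f := fun x : Ω × FullState Ω =>
      excluded x.2 x.1) fun ω => (hmeas ω).mono hm le_rfl).comp
        (measurable_fst.prodMk measurable_id)).aestronglyMeasurable 1
      (ae_of_all _ fun φ => le_one φ φ.1)
  filter_upwards [(integral_eq_zero_iff_of_nonneg (fun φ => nonneg φ φ.1) hint).1 hintegral]
    with φ hφ
  by_contra! hle
  simp [hexcluded, hle] at hφ

end Belief

namespace Game

section PublicBelief

variable {Ω : Type*} [Fintype Ω] [MeasurableSpace Ω] {n : ℕ} [NeZero n] (G : Game Ω n)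
  [MeasurableSingletonClass Ω]

/-- The public information: before period `k`, the σ-algebra generated by the earlier
announcements. -/
def pub (σ : G.Profile) : Filtration ℕ (inferInstance : MeasurableSpace (FullState Ω)) where
  seq k := MeasurableSpace.comap (G.hist σ k) inferInstance
  mono' := by
    refine monotone_nat_of_le_succ fun k => ?_
    have hist_init : G.hist σ k =
        (fun (h : Fin (k + 1) → G.Ann) j => h j.castSucc) ∘ G.hist σ (k + 1) := by
      ext φ j
      simp only [hist, Function.comp, play_succ_castSucc]
    rw [hist_init, ← MeasurableSpace.comap_comp]
    exact MeasurableSpace.comap_mono (Measurable.comap_le (by fun_prop))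
  le' k := (G.measurable_hist σ k).comap_le

/-- The public belief before period `k`. -/
def pubBelief (μ : Ω → ℝ) (σ : G.Profile) (k : ℕ) : FullState Ω → Ω → ℝ := belief μ (G.pub σ k)

/-- The public belief in the limit. -/
def limitBelief (μ : Ω → ℝ) (σ : G.Profile) : FullState Ω → Ω → ℝ := belief μ (⨆ k, G.pub σ k)

theorem pubBelief_mem_stdSimplex (μ : Ω → ℝ) (σ : G.Profile) (k : ℕ) :
    ∀ᵐ φ ∂(law μ), G.pubBelief μ σ k φ ∈ stdSimplex ℝ Ω :=
  belief_mem_stdSimplex ((G.pub σ).le k)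

theorem limitBelief_mem_stdSimplex (μ : Ω → ℝ) (σ : G.Profile) :
    ∀ᵐ φ ∂(law μ), G.limitBelief μ σ φ ∈ stdSimplex ℝ Ω :=
  belief_mem_stdSimplex (iSup_le (G.pub σ).le)

theorem measurable_pubBelief (μ : Ω → ℝ) (σ : G.Profile) (k : ℕ) :
    Measurable (G.pubBelief μ σ k) :=
  measurable_belief.mono ((G.pub σ).le k) le_rfl

theorem measurable_limitBelief (μ : Ω → ℝ) (σ : G.Profile) : Measurable (G.limitBelief μ σ) :=
  measurable_belief.mono (iSup_le (G.pub σ).le) le_rfl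

theorem exists_pubBelief_eq (μ : Ω → ℝ) (σ : G.Profile) (k : ℕ) :
    ∃ b : (Fin k → G.Ann) → Ω → ℝ, Measurable b ∧
      ∀ φ, G.pubBelief μ σ k φ = b (G.hist σ k φ) := by
  obtain ⟨b, hb, heq⟩ := StronglyMeasurable.exists_eq_measurable_comp (f := G.hist σ k)
    (Measurable.stronglyMeasurable (measurable_belief (μ := μ) (m := G.pub σ k)))
  exact ⟨b, hb.measurable, congrFun heq⟩

theorem tendsto_pubBelief (μ : Ω → ℝ) (σ : G.Profile) :
    ∀ᵐ φ ∂(law μ), Tendsto (fun k => G.pubBelief μ σ k φ) atTop (𝓝 (G.limitBelief μ σ φ)) := by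
  filter_upwards [ae_all_iff.2 fun ω : Ω => tendsto_ae_condExp (μ := law μ) (ℱ := G.pub σ)
    ((Prod.fst ⁻¹' {ω}).indicator (fun _ => (1 : ℝ)))] with φ hφ
  exact tendsto_pi_nhds.2 hφ

theorem stronglyMeasurable_ann (σ : G.Profile) (k : ℕ) :
    StronglyMeasurable[G.pub σ k] (G.ann σ k) :=
  ((G.measurable_lastAnn k).comp (comap_measurable _)).stronglyMeasurable

/-- Acquire no information and announce the mean of `X` under the public belief, given as the
function `b` of the past announcements. -/
def Move.announceMean (i : Fin n) {k : ℕ} {b : (Fin k → G.Ann) → Ω → ℝ} (hb : Measurable b) :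
    G.Move i k where
  signal _ := G.free
  announce a := G.meanAnn (b a.1.1.2.2)
  measurable_signal := measurable_const
  measurable_announce := G.continuous_meanAnn.measurable.comp (hb.comp (by fun_prop))

theorem integral_loss_eq (μ : Ω → ℝ) (σ : G.Profile) (k : ℕ) :
    ∫ φ, G.loss (G.pubBelief μ σ k φ, G.ann σ k φ) ∂(law μ) =
      G.expScore μ (fun φ => G.meanAnn (G.pubBelief μ σ k φ)) - G.expScore μ (G.ann σ k) := by
  have hmean : StronglyMeasurable[G.pub σ k] fun φ => G.meanAnn (G.pubBelief μ σ k φ) :=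
    (G.continuous_meanAnn.measurable.comp measurable_belief).stronglyMeasurable
  rw [expScore, expScore, ← integral_sub
    (G.integrable_score μ (hmean.mono ((G.pub σ).le k)).measurable)
    (G.integrable_score μ (G.measurable_ann σ k))]
  refine (integral_belief ((G.pub σ).le k) (B := G.scoreBound + G.scoreBound)
    (F := fun φ ω => G.score (G.meanAnn (G.pubBelief μ σ k φ)) ω - G.score (G.ann σ k φ) ω)
    (fun ω => ?_) fun φ ω => ?_).symm
  · exact ((G.continuous_score ω).comp_stronglyMeasurable hmean).sub
      ((G.continuous_score ω).comp_stronglyMeasurable (G.stronglyMeasurable_ann σ k))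
  · exact (abs_sub _ _).trans (add_le_add (G.abs_score_le _ _) (G.abs_score_le _ _))

variable {G} {μ : Ω → ℝ} (hμ : μ ∈ stdSimplex ℝ Ω) {σ : G.Profile} (hσ : G.IsNash μ σ)
include hμ hσ

theorem IsNash.exists_integral_loss_le : ∃ e : ℕ → ℝ, Tendsto e atTop (𝓝 0) ∧
    ∀ k, ∫ φ, G.loss (G.pubBelief μ σ k φ, G.ann σ k φ) ∂(law μ) ≤ e k := by
  obtain ⟨e, he, hgain⟩ := hσ.exists_netGain_le hμ
  refine ⟨e, he, fun k => ?_⟩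
  obtain ⟨b, hb, hpub⟩ := G.exists_pubBelief_eq μ σ k
  have hmove := hgain k (Move.announceMean G (mover n k) hb)
  have hann : (Move.announceMean G (mover n k) hb).annOn σ =
      fun φ => G.meanAnn (G.pubBelief μ σ k φ) := funext fun φ => congrArg G.meanAnn (hpub φ).symm
  have hcost : G.expCost μ ((Move.announceMean G (mover n k) hb).signalOn σ) = 0 := G.expCost_free μ
  rw [Move.netGain, hcost, EReal.coe_ennreal_zero, sub_zero, EReal.coe_le_coe_iff, hann] at hmove
  rwa [integral_loss_eq]

theorem IsNash.tendsto_measureReal_ann_sub {ε : ℝ} (hε : 0 < ε) :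
    Tendsto (fun k => (law μ).real {φ | ε ≤ |(G.ann σ k φ : ℝ) -
      mean (G.pubBelief μ σ k φ) G.X|}) atTop (𝓝 0) := by
  obtain ⟨e, he, hloss⟩ := hσ.exists_integral_loss_le hμ
  obtain ⟨δ, hδ, far_le_loss⟩ := G.exists_le_loss hε
  refine squeeze_zero (fun k => measureReal_nonneg) (fun k => ?_) (by simpa using he.div_const δ)
  have markov := mul_meas_ge_le_integral_of_nonneg
    ((G.pubBelief_mem_stdSimplex μ σ k).mono fun φ hφ => G.loss_nonneg hφ)
    (G.integrable_comp_belief G.continuous_loss (G.measurable_pubBelief μ σ k)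
      (G.pubBelief_mem_stdSimplex μ σ k) (G.measurable_ann σ k)) δ
  rw [le_div_iff₀ hδ, mul_comm]
  refine le_trans (mul_le_mul_of_nonneg_left ?_ hδ.le) (markov.trans (hloss k))
  refine ENNReal.toReal_mono (measure_ne_top _ _) (measure_mono_ae ?_)
  filter_upwards [G.pubBelief_mem_stdSimplex μ σ k] with φ hφ using far_le_loss (_, _) hφ

theorem IsNash.isMarketPrediction :
    G.IsMarketPrediction μ σ fun φ => mean (G.limitBelief μ σ φ) G.X := by
  have tendsto_mean : TendstoInMeasure (law μ) (fun k φ => mean (G.pubBelief μ σ k φ) G.X) atTop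
      fun φ => mean (G.limitBelief μ σ φ) G.X := by
    refine tendstoInMeasure_of_tendsto_ae (fun k => ?_) ?_
    · exact ((continuous_mean G.X).measurable.comp
        (G.measurable_pubBelief μ σ k)).aestronglyMeasurable
    · filter_upwards [G.tendsto_pubBelief μ σ] with φ hφ
      exact ((continuous_mean G.X).tendsto _).comp hφ
  unfold IsMarketPrediction
  rw [tendstoInMeasure_iff_measureReal_dist] at tendsto_mean ⊢
  intro ε hε
  have tendsto_sum := (hσ.tendsto_measureReal_ann_sub hμ (half_pos hε)).add
    (tendsto_mean (ε / 2) (half_pos hε))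
  rw [add_zero] at tendsto_sum
  refine squeeze_zero (fun _ => measureReal_nonneg) (fun k => ?_) tendsto_sum
  refine (measureReal_mono fun φ (hφ : ε ≤ dist _ _) => ?_).trans (measureReal_union_le _ _)
  by_contra! hnear
  obtain ⟨hann, hlimit⟩ := not_or.1 hnear
  rw [Set.mem_ofPred_eq, not_le, ← Real.dist_eq] at hann
  rw [Set.mem_ofPred_eq, not_le] at hlimit
  have triangle := dist_triangle (G.price σ φ k) (mean (G.pubBelief μ σ k φ) G.X)
    (mean (G.limitBelief μ σ φ) G.X)
  rw [G.price_eq] at triangle hφ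
  linarith

end PublicBelief

end Game

/-! ### Posteriors and conditioning on a cell -/

section Posterior

variable {Ω : Type*} [Fintype Ω] {γ : Ω → ℝ}

theorem marg_nonneg (hγ : ∀ ω, 0 ≤ γ ω) (R : Signal Ω) (τ : ℕ) : 0 ≤ marg γ R τ :=
  Finset.sum_nonneg fun ω _ => mul_nonneg (hγ ω) (R.nonneg ω τ)

theorem marg_mul_posterior (hγ : ∀ ω, 0 ≤ γ ω) (R : Signal Ω) (τ : ℕ) (ω : Ω) :
    marg γ R τ * posterior γ R τ ω = γ ω * R.prob ω τ := by
  by_cases h : marg γ R τ = 0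
  · rw [h, zero_mul, (Finset.sum_eq_zero_iff_of_nonneg
      fun ω _ => mul_nonneg (hγ ω) (R.nonneg ω τ)).1 h ω (Finset.mem_univ ω)]
  · exact mul_div_cancel₀ _ h

theorem posterior_nonneg (hγ : ∀ ω, 0 ≤ γ ω) (R : Signal Ω) (τ : ℕ) (ω : Ω) :
    0 ≤ posterior γ R τ ω :=
  div_nonneg (mul_nonneg (hγ ω) (R.nonneg ω τ)) (marg_nonneg hγ R τ)

theorem posterior_mem_stdSimplex (hγ : ∀ ω, 0 ≤ γ ω) (R : Signal Ω) {τ : ℕ}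
    (h : marg γ R τ ≠ 0) : posterior γ R τ ∈ stdSimplex ℝ Ω := by
  refine ⟨posterior_nonneg hγ R τ, ?_⟩
  simp only [posterior, ← Finset.sum_div]
  exact div_self h

theorem hasSum_marg (γ : Ω → ℝ) (R : Signal Ω) : HasSum (marg γ R) (∑ ω, γ ω) := by
  have := hasSum_sum (s := Finset.univ) fun (ω : Ω) _ => (R.hasSum_one ω).mul_left (γ ω)
  simp only [mul_one] at this
  exact this

open Classical in
/-- The probability of the cell of `ω`. -/
def cellMass (P : Setoid Ω) (μ : Ω → ℝ) (ω : Ω) : ℝ := ∑ ω' with P.r ω ω', μ ω'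

theorem cellBelief_nonneg {P : Setoid Ω} {μ : Ω → ℝ} (hμ : ∀ ω, 0 ≤ μ ω) (ω ω' : Ω) :
    0 ≤ cellBelief P μ ω ω' := by
  unfold cellBelief
  split_ifs
  · exact div_nonneg (hμ ω') (Finset.sum_nonneg fun _ _ => hμ _)
  · exact le_rfl

variable {P : Setoid Ω} {μ : Ω → ℝ} {ω : Ω} (hμ : ∀ ω, 0 ≤ μ ω) (hω : 0 < μ ω)
include hμ hω

theorem cellMass_pos : 0 < cellMass P μ ω := by
  classical
  exact hω.trans_le (Finset.single_le_sum (f := μ) (fun ω _ => hμ ω)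
    (Finset.mem_filter.2 ⟨Finset.mem_univ ω, P.refl ω⟩))

open Classical in
theorem cellMass_mul_cellBelief (ω' : Ω) :
    cellMass P μ ω * cellBelief P μ ω ω' = if P.r ω ω' then μ ω' else 0 := by
  unfold cellBelief
  split_ifs
  · exact mul_div_cancel₀ _ (cellMass_pos hμ hω).ne'
  · exact mul_zero _

theorem cellBelief_mem_stdSimplex : cellBelief P μ ω ∈ stdSimplex ℝ Ω := by
  classical
  refine ⟨cellBelief_nonneg hμ ω, mul_left_cancel₀ (cellMass_pos (P := P) hμ hω).ne' ?_⟩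
  simp only [Finset.mul_sum, cellMass_mul_cellBelief hμ hω]
  rw [← Finset.sum_filter, mul_one]
  rfl

theorem cellBelief_pos {ω' : Ω} (hr : P.r ω ω') (hω' : 0 < μ ω') : 0 < cellBelief P μ ω ω' := by
  unfold cellBelief
  rw [if_pos hr]
  exact div_pos hω' (cellMass_pos hμ hω)

end Posterior

/-! ### Profitable tests -/

namespace Game

section Static

variable {Ω : Type*} [Fintype Ω] {n : ℕ} (G : Game Ω n)

/-- Expected score in state `ω` if the signal `R` is acquired and `a τ` is announced after the
realization `τ`. -/
def signalScore (R : Signal Ω) (a : ℕ → G.Ann) (ω : Ω) : ℝ :=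
  ∑' τ, R.prob ω τ * G.score (a τ) ω

theorem norm_prob_mul_score_le (R : Signal Ω) (a : ℕ → G.Ann) (ω : Ω) (τ : ℕ) :
    ‖R.prob ω τ * G.score (a τ) ω‖ ≤ R.prob ω τ * G.scoreBound := by
  rw [norm_mul, Real.norm_of_nonneg (R.nonneg ω τ)]
  exact mul_le_mul_of_nonneg_left (G.abs_score_le _ _) (R.nonneg ω τ)

theorem summable_signalScore (R : Signal Ω) (a : ℕ → G.Ann) (ω : Ω) :
    Summable fun τ => R.prob ω τ * G.score (a τ) ω :=
  Summable.of_norm_bounded ((R.hasSum_one ω).summable.mul_right G.scoreBound)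
    (G.norm_prob_mul_score_le R a ω)

theorem abs_signalScore_le (R : Signal Ω) (a : ℕ → G.Ann) (ω : Ω) :
    |G.signalScore R a ω| ≤ G.scoreBound :=
  tsum_of_norm_bounded (by simpa only [one_mul] using (R.hasSum_one ω).mul_right G.scoreBound)
    (G.norm_prob_mul_score_le R a ω)

theorem signalScore_const (R : Signal Ω) (y : G.Ann) (ω : Ω) :
    G.signalScore R (fun _ => y) ω = G.score y ω := by
  rw [signalScore, tsum_mul_right, (R.hasSum_one ω).tsum_eq, one_mul]

theorem gain_eq {γ : Ω → ℝ} (hγ : γ ∈ stdSimplex ℝ Ω) (R : Signal Ω) :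
    G.gain γ R = ∑ ω, γ ω * (G.signalScore R (fun τ => G.meanAnn (posterior γ R τ)) ω -
      G.score (G.meanAnn γ) ω) := by
  have term_eq : ∀ τ, marg γ R τ * ∑ ω, posterior γ R τ ω *
      (G.s (mean (posterior γ R τ) G.X) (G.X ω) - G.s (mean γ G.X) (G.X ω)) =
      ∑ ω, γ ω * (R.prob ω τ * G.score (G.meanAnn (posterior γ R τ)) ω -
        R.prob ω τ * G.score (G.meanAnn γ) ω) := by
    intro τ
    rw [Finset.mul_sum]
    refine Finset.sum_congr rfl fun ω _ => ?_
    rw [← mul_assoc, marg_mul_posterior hγ.1, ← mul_sub, ← mul_assoc]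
    by_cases h : marg γ R τ = 0
    · rw [← marg_mul_posterior hγ.1, h, zero_mul, zero_mul, zero_mul]
    · rw [score, score, G.coe_meanAnn hγ, G.coe_meanAnn (posterior_mem_stdSimplex hγ.1 R h)]
  rw [gain, tsum_congr term_eq]
  refine HasSum.tsum_eq (hasSum_sum fun ω _ => HasSum.mul_left _ ?_)
  have := (G.summable_signalScore R (fun τ => G.meanAnn (posterior γ R τ)) ω).hasSum.sub
    ((R.hasSum_one ω).mul_right (G.score (G.meanAnn γ) ω))
  rwa [one_mul] at this

open Classical in
/-- Expected gain, for an outside observer with the belief `x.1` at the price `x.2`, if in the cell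
`q` trader `i` acquires the signal `R` and announces `a τ` after the realization `τ`. Meaningful
when `K R < ∞`. -/
def testGain (i : Fin n) (q : Quotient (G.part i)) (R : G.κ.avail) (a : ℕ → G.Ann)
    (x : (Ω → ℝ) × G.Ann) : ℝ :=
  ∑ ω, x.1 ω * if Quotient.mk _ ω = q then
    G.signalScore R.1 a ω - G.κ.c * (G.κ.K R).toReal - G.score x.2 ω else 0

theorem continuous_testGain (i : Fin n) (q : Quotient (G.part i)) (R : G.κ.avail)
    (a : ℕ → G.Ann) : Continuous (G.testGain i q R a) := by
  unfold testGain
  refine continuous_finsetSum _ fun ω _ => Continuous.mul (by fun_prop) ?_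
  split_ifs
  · exact continuous_const.sub ((G.continuous_score ω).comp continuous_snd)
  · exact continuous_const

theorem testGain_mk {γ : Ω → ℝ} (hγ : γ ∈ stdSimplex ℝ Ω) {i : Fin n} {ω₀ : Ω} (hω : 0 < γ ω₀)
    (R : G.κ.avail) (a : ℕ → G.Ann) (y : G.Ann) :
    G.testGain i (Quotient.mk _ ω₀) R a (γ, y) = cellMass (G.part i) γ ω₀ *
      (∑ ω, cellBelief (G.part i) γ ω₀ ω * (G.signalScore R.1 a ω - G.score y ω) -
        G.κ.c * (G.κ.K R).toReal) := by
  classical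
  have cost_eq : G.κ.c * (G.κ.K R).toReal =
      ∑ ω, cellBelief (G.part i) γ ω₀ ω * (G.κ.c * (G.κ.K R).toReal) := by
    rw [← Finset.sum_mul, (cellBelief_mem_stdSimplex hγ.1 hω).2, one_mul]
  conv_rhs => rw [cost_eq]
  rw [← Finset.sum_sub_distrib, Finset.mul_sum, testGain]
  refine Finset.sum_congr rfl fun ω _ => ?_
  rw [← mul_sub, ← mul_assoc, cellMass_mul_cellBelief hγ.1 hω, mul_ite, mul_zero, ite_mul,
    zero_mul, sub_right_comm]
  exact if_congr (Quotient.eq.trans ⟨(G.part i).symm, (G.part i).symm⟩) rfl rfl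

theorem K_ne_top_of_bot_lt_netGain {γ : Ω → ℝ} {R : G.κ.avail} (h : ⊥ < G.netGain γ R) :
    G.κ.K R ≠ ⊤ := by
  intro hK
  rw [netGain, hK, ENNReal.mul_top (by simpa using G.κ.c_pos), EReal.coe_ennreal_top,
    EReal.sub_top] at h
  exact lt_irrefl _ h

theorem netGain_eq {γ : Ω → ℝ} {R : G.κ.avail} (h : G.κ.K R ≠ ⊤) :
    G.netGain γ R = ((G.gain γ R.1 - G.κ.c * (G.κ.K R).toReal : ℝ) : EReal) := by
  rw [netGain, ← EReal.coe_ennreal_toReal (ENNReal.mul_ne_top ENNReal.ofReal_ne_top h),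
    ENNReal.toReal_mul, ENNReal.toReal_ofReal G.κ.c_pos.le, EReal.coe_sub]

theorem testGain_pos_of_netGain_pos {γ : Ω → ℝ} (hγ : γ ∈ stdSimplex ℝ Ω) {i : Fin n} {ω : Ω}
    (hω : 0 < γ ω) (hmean : mean (cellBelief (G.part i) γ ω) G.X = mean γ G.X) {R : G.κ.avail}
    (hR : 0 < G.netGain (cellBelief (G.part i) γ ω) R) :
    0 < G.testGain i (Quotient.mk _ ω) R
      (fun τ => G.meanAnn (posterior (cellBelief (G.part i) γ ω) R.1 τ)) (γ, G.meanAnn γ) := by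
  rw [G.testGain_mk hγ hω]
  refine mul_pos (cellMass_pos hγ.1 hω) ?_
  rwa [G.netGain_eq (G.K_ne_top_of_bot_lt_netGain (bot_le.trans_lt hR)),
    G.gain_eq (cellBelief_mem_stdSimplex hγ.1 hω), EReal.coe_pos, meanAnn.eq_1 G (cellBelief _ _ _),
    hmean, ← meanAnn.eq_1 G γ] at hR

theorem testGain_free_pos {γ : Ω → ℝ} (hγ : γ ∈ stdSimplex ℝ Ω) {i : Fin n} {ω : Ω}
    (hω : 0 < γ ω) (hmean : mean (cellBelief (G.part i) γ ω) G.X ≠ mean γ G.X) :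
    0 < G.testGain i (Quotient.mk _ ω) G.free
      (fun _ => G.meanAnn (cellBelief (G.part i) γ ω)) (γ, G.meanAnn γ) := by
  rw [G.testGain_mk hγ hω]
  refine mul_pos (cellMass_pos hγ.1 hω) ?_
  rw [K_free, ENNReal.toReal_zero, mul_zero, sub_zero]
  simp only [signalScore_const, mul_sub, Finset.sum_sub_distrib]
  refine sub_pos.2 (G.sum_score_lt (cellBelief_mem_stdSimplex hγ.1 hω) ?_)
  rw [G.coe_meanAnn hγ]
  exact hmean.symm

variable {G} in
theorem KSeparable.exists_testGain_pos (hG : G.KSeparable) {γ : Ω → ℝ} (hγ : γ ∈ stdSimplex ℝ Ω)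
    (hne : ∃ ω, 0 < γ ω ∧ G.X ω ≠ mean γ G.X) :
    ∃ (i : Fin n) (q : Quotient (G.part i)) (R : G.κ.avail) (a : ℕ → G.Ann), G.κ.K R ≠ ⊤ ∧
      0 < G.testGain i q R a (γ, G.meanAnn γ) := by
  by_cases hmean : ∀ i ω, 0 < γ ω → mean (cellBelief (G.part i) γ ω) G.X = mean γ G.X
  · have hacq : ¬ G.NoAcquisition γ := fun hno => hG ⟨γ, hγ, ⟨_, hne, hmean⟩, hno⟩
    unfold NoAcquisition at hacq
    push Not at hacq
    obtain ⟨ω, hω, i, R, hR⟩ := hacq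
    exact ⟨i, _, R, _, G.K_ne_top_of_bot_lt_netGain (bot_le.trans_lt hR),
      G.testGain_pos_of_netGain_pos hγ hω (hmean i ω hω) hR⟩
  · push Not at hmean
    obtain ⟨i, ω, hω, hmean⟩ := hmean
    exact ⟨i, _, G.free, _, by simp [K_free], G.testGain_free_pos hγ hω hmean⟩

end Static

section Test

variable {Ω : Type*} [Fintype Ω] [MeasurableSpace Ω] {n : ℕ} [NeZero n] (G : Game Ω n)

theorem moverInfo_redraw (σ : G.Profile) (φ : FullState Ω) (k : ℕ) (v : unitInterval) :
    G.moverInfo σ k (redraw k (φ, v)) = G.moverInfo σ k φ := by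
  unfold moverInfo
  rw [play_redraw]
  rfl

open Classical in
/-- If the information lies in `D`, acquire `R` and announce `a τ` after the realization `τ`;
otherwise acquire no information and repeat the last announcement. -/
def Move.test {i : Fin n} {k : ℕ} {D : Set (G.Info i k × unitInterval)} (hD : MeasurableSet D)
    (R : G.κ.avail) (a : ℕ → G.Ann) : G.Move i k where
  signal x := if x ∈ D then R else G.free
  announce x := if x.1 ∈ D then a x.2 else G.lastAnn x.1.1.2.2
  measurable_signal := Measurable.ite hD measurable_const measurable_const
  measurable_announce := Measurable.ite (measurable_fst hD)
    (Measurable.of_discrete.comp measurable_snd) ((G.measurable_lastAnn k).comp (by fun_prop))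

variable [MeasurableSingletonClass Ω]

variable {G} in
theorem Move.measurable_annOn (σ : G.Profile) {k : ℕ} (m : G.Move (mover n k) k) :
    Measurable (m.annOn σ) :=
  m.measurable_announce.comp ((G.measurable_moverInfo σ k).prodMk (measurable_realize.comp
    ((G.κ.measurable_prob.comp (measurable_fst.prodMk
      (m.measurable_signal.comp (G.measurable_moverInfo σ k)))).prodMk (by fun_prop))))

variable {G} in
theorem Move.expScore_annOn (μ : Ω → ℝ) (σ : G.Profile) {k : ℕ} (m : G.Move (mover n k) k) :
    G.expScore μ (m.annOn σ) = ∫ φ, G.signalScore (m.signalOn σ φ).1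
      (fun τ => m.announce (G.moverInfo σ k φ, τ)) φ.1 ∂(law μ) := by
  rw [expScore, integral_redraw μ k (F := fun φ => G.score (m.annOn σ φ) φ.1)
    (G.measurable_score.comp ((m.measurable_annOn σ).prodMk measurable_fst))
    fun φ => G.abs_score_le _ _]
  refine integral_congr_ae (ae_of_all _ fun φ => ?_)
  simp only [annOn, signalOn, moverInfo_redraw]
  simp only [redraw, Function.update_self]
  exact integral_realize ((m.signalOn σ φ).1.nonneg φ.1) ((m.signalOn σ φ).1.hasSum_one φ.1)
    (F := fun τ => G.score (m.announce (G.moverInfo σ k φ, τ)) φ.1) fun τ => G.abs_score_le _ _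

variable (μ : Ω → ℝ) (σ : G.Profile) {k : ℕ} {D : Set (G.Info (mover n k) k × unitInterval)}
  (hD : MeasurableSet D) (R : G.κ.avail) (a : ℕ → G.Ann)

open Classical in
theorem Move.expScore_annOn_test : G.expScore μ ((Move.test G hD R a).annOn σ) =
    ∫ φ, (if G.moverInfo σ k φ ∈ D then G.signalScore R.1 a φ.1 else
      G.score (G.ann σ k φ) φ.1) ∂(law μ) := by
  rw [expScore_annOn]
  refine integral_congr_ae (ae_of_all _ fun φ => ?_)
  by_cases h : G.moverInfo σ k φ ∈ D
  · simp only [signalOn, test, if_pos h]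
  · simp only [signalOn, test, if_neg h, signalScore_const]
    rfl

theorem Move.expCost_signalOn_test : G.expCost μ ((Move.test G hD R a).signalOn σ) =
    ENNReal.ofReal G.κ.c * (G.κ.K R * law μ (G.moverInfo σ k ⁻¹' D)) := by
  have hK : ∀ φ, G.κ.K ((Move.test G hD R a).signalOn σ φ) =
      (G.moverInfo σ k ⁻¹' D).indicator (fun _ => G.κ.K R) φ := fun φ => by
    by_cases h : G.moverInfo σ k φ ∈ D
    · simp [signalOn, test, h]
    · simp [signalOn, test, h, K_free]
  simp only [expCost, hK]
  rw [lintegral_indicator_const (G.measurable_moverInfo σ k hD)]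

open Classical in
theorem Move.netGain_test (hR : G.κ.K R ≠ ⊤) : (Move.test G hD R a).netGain σ μ =
    ((∫ φ, (if G.moverInfo σ k φ ∈ D then G.signalScore R.1 a φ.1 - G.κ.c * (G.κ.K R).toReal -
      G.score (G.ann σ k φ) φ.1 else 0) ∂(law μ) : ℝ) : EReal) := by
  have hE : MeasurableSet (G.moverInfo σ k ⁻¹' D) := G.measurable_moverInfo σ k hD
  have hscore : Measurable fun φ : FullState Ω => G.score (G.ann σ k φ) φ.1 :=
    G.measurable_score.comp ((G.measurable_ann σ k).prodMk measurable_fst)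
  have hnew : Integrable (fun φ => if G.moverInfo σ k φ ∈ D then G.signalScore R.1 a φ.1 else
      G.score (G.ann σ k φ) φ.1) (law μ) := by
    refine Integrable.of_bound (Measurable.ite hE ((Measurable.of_discrete
      (f := G.signalScore R.1 a)).comp measurable_fst) hscore).aestronglyMeasurable
      G.scoreBound (ae_of_all _ fun φ => ?_)
    split_ifs
    · exact G.abs_signalScore_le _ _ _
    · exact G.abs_score_le _ _
  have hold := G.integrable_score μ (G.measurable_ann σ k)
  have hdiff : Integrable (fun φ => (if G.moverInfo σ k φ ∈ D then G.signalScore R.1 a φ.1 else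
      G.score (G.ann σ k φ) φ.1) - G.score (G.ann σ k φ) φ.1) (law μ) := hnew.sub hold
  have hcost : (law μ).real (G.moverInfo σ k ⁻¹' D) * (G.κ.c * (G.κ.K R).toReal) =
      ∫ φ, (G.moverInfo σ k ⁻¹' D).indicator (fun _ => G.κ.c * (G.κ.K R).toReal) φ ∂(law μ) := by
    rw [integral_indicator_const _ hE, smul_eq_mul]
  rw [netGain, expScore_annOn_test, expCost_signalOn_test, ← EReal.coe_ennreal_toReal
    (ENNReal.mul_ne_top ENNReal.ofReal_ne_top (ENNReal.mul_ne_top hR (measure_ne_top _ _))),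
    ← EReal.coe_sub, ENNReal.toReal_mul, ENNReal.toReal_ofReal G.κ.c_pos.le, ENNReal.toReal_mul,
    ← mul_assoc, mul_comm _ (law μ _).toReal, ← measureReal_def, hcost, expScore,
    ← integral_sub hnew hold, ← integral_sub hdiff ((integrable_const _).indicator hE)]
  refine congrArg _ (integral_congr_ae (ae_of_all _ fun φ => ?_))
  by_cases h : G.moverInfo σ k φ ∈ D
  · simp only [if_pos h, Set.indicator_of_mem (Set.mem_preimage.2 h)]
    ring
  · simp only [if_neg h, Set.indicator_of_notMem (mt Set.mem_preimage.1 h)]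
    ring

open Classical in
theorem integral_max_testGain_eq (i : Fin n) (q : Quotient (G.part i)) :
    ∫ φ, max (G.testGain i q R a (G.pubBelief μ σ k φ, G.ann σ k φ)) 0 ∂(law μ) =
      ∫ φ, (if 0 < G.testGain i q R a (G.pubBelief μ σ k φ, G.ann σ k φ) then
        (if Quotient.mk _ φ.1 = q then G.signalScore R.1 a φ.1 - G.κ.c * (G.κ.K R).toReal -
          G.score (G.ann σ k φ) φ.1 else 0) else 0) ∂(law μ) := by
  set c := G.κ.c * (G.κ.K R).toReal
  have hann := G.stronglyMeasurable_ann σ k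
  have hpos : MeasurableSet[G.pub σ k]
      {φ | 0 < G.testGain i q R a (G.pubBelief μ σ k φ, G.ann σ k φ)} :=
    measurableSet_lt measurable_const ((G.continuous_testGain i q R a).measurable.comp
      (measurable_belief.prodMk hann.measurable))
  rw [integral_belief ((G.pub σ).le k) (B := G.scoreBound + |c| + G.scoreBound)
    (F := fun φ ω => if 0 < G.testGain i q R a (G.pubBelief μ σ k φ, G.ann σ k φ) then
      (if Quotient.mk _ ω = q then G.signalScore R.1 a ω - c - G.score (G.ann σ k φ) ω else 0)
      else 0)]
  · refine integral_congr_ae (ae_of_all _ fun φ => ?_)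
    by_cases h : 0 < G.testGain i q R a (G.pubBelief μ σ k φ, G.ann σ k φ)
    · simp only [if_pos h, max_eq_left h.le]
      rfl
    · simp only [if_neg h, mul_zero, Finset.sum_const_zero, max_eq_right (not_lt.1 h)]
  · intro ω
    refine StronglyMeasurable.ite hpos ?_ stronglyMeasurable_const
    split_ifs
    · exact stronglyMeasurable_const.sub ((G.continuous_score ω).comp_stronglyMeasurable hann)
    · exact stronglyMeasurable_const
  · intro φ ω
    have := G.scoreBound_pos
    split_ifs
    · refine (abs_sub _ _).trans (add_le_add ?_ (G.abs_score_le _ _))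
      exact (abs_sub _ _).trans (add_le_add_left (G.abs_signalScore_le _ _ _) _)
    · rw [abs_zero]; positivity
    · rw [abs_zero]; positivity

variable {G μ σ} (hμ : μ ∈ stdSimplex ℝ Ω) (hσ : G.IsNash μ σ)
include hμ hσ

theorem IsNash.exists_integral_testGain_le :
    ∃ e : ℕ → ℝ, Tendsto e atTop (𝓝 0) ∧ ∀ k i (q : Quotient (G.part i)) (R : G.κ.avail)
      (a : ℕ → G.Ann), mover n k = i → G.κ.K R ≠ ⊤ →
      ∫ φ, max (G.testGain i q R a (G.pubBelief μ σ k φ, G.ann σ k φ)) 0 ∂(law μ) ≤ e k := by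
  classical
  obtain ⟨e, he, hgain⟩ := hσ.exists_netGain_le hμ
  refine ⟨e, he, ?_⟩
  rintro k _ q R a rfl hR
  obtain ⟨b, hb, hpub⟩ := G.exists_pubBelief_eq μ σ k
  have hD : MeasurableSet {x : G.Info (mover n k) k × unitInterval | x.1.1 = q ∧
      0 < G.testGain (mover n k) q R a (b x.1.2.2, G.lastAnn x.1.2.2)} :=
    MeasurableSet.inter ((show Measurable fun x : G.Info (mover n k) k × unitInterval => x.1.1 by
        fun_prop) (measurableSet_singleton q))
      (measurableSet_lt measurable_const ((G.continuous_testGain _ q R a).measurable.comp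
        ((hb.comp (by fun_prop)).prodMk ((G.measurable_lastAnn k).comp (by fun_prop)))))
  have hmove := hgain k (Move.test G hD R a)
  rw [Move.netGain_test G μ σ hD R a hR, EReal.coe_le_coe_iff] at hmove
  refine (Eq.le ?_).trans hmove
  rw [integral_max_testGain_eq]
  refine integral_congr_ae (ae_of_all _ fun φ => ?_)
  dsimp only
  rw [← ite_and, hpub φ]
  congr 1
  exact propext and_comm

theorem IsNash.ae_testGain_limitBelief_le (i : Fin n) (q : Quotient (G.part i)) {R : G.κ.avail}
    (a : ℕ → G.Ann) (hR : G.κ.K R ≠ ⊤) :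
    ∀ᵐ φ ∂(law μ),
      G.testGain i q R a (G.limitBelief μ σ φ, G.meanAnn (G.limitBelief μ σ φ)) ≤ 0 := by
  set H : (Ω → ℝ) × G.Ann → ℝ := fun x => max (G.testGain i q R a x) 0
  have hH : Continuous H := (G.continuous_testGain i q R a).max continuous_const
  obtain ⟨e, he, hle⟩ := hσ.exists_integral_testGain_le hμ
  set period : ℕ → ℕ := fun j => n * j + i with hperiod
  have mover_period : ∀ j, mover n (period j) = i := fun j => by
    ext
    simp [hperiod, mover, Fin.ofNat, Nat.mod_eq_of_lt i.2]
  have tendsto_period : Tendsto period atTop atTop := by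
    refine tendsto_atTop_mono (fun j => ?_) tendsto_id
    exact (Nat.le_mul_of_pos_left j (NeZero.pos n)).trans (Nat.le_add_right _ _)
  have hprice : TendstoInMeasure (law μ) (fun j φ => G.price σ φ (period j)) atTop
      fun φ => mean (G.limitBelief μ σ φ) G.X := (hσ.isMarketPrediction hμ).comp tendsto_period
  obtain ⟨ns, hns, hae⟩ := hprice.exists_seq_tendsto_ae
  have htime := tendsto_period.comp hns.tendsto_atTop
  have hlim : ∀ᵐ φ ∂(law μ), Tendsto (fun j => H (G.pubBelief μ σ (period (ns j)) φ,
      G.ann σ (period (ns j)) φ)) atTop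
      (𝓝 (H (G.limitBelief μ σ φ, G.meanAnn (G.limitBelief μ σ φ)))) := by
    filter_upwards [hae, G.tendsto_pubBelief μ σ, G.limitBelief_mem_stdSimplex μ σ]
      with φ hprice hbelief hsimplex
    refine (hH.tendsto _).comp (Tendsto.prodMk_nhds (hbelief.comp htime) ?_)
    rw [tendsto_subtype_rng, G.coe_meanAnn hsimplex]
    simpa only [G.price_eq] using hprice
  obtain ⟨C, hC⟩ := G.exists_norm_le_of_continuous hH
  have hdom := tendsto_integral_of_dominated_convergence (fun _ => C)
    (fun j => (hH.measurable.comp ((G.measurable_pubBelief μ σ (period (ns j))).prodMk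
      (G.measurable_ann σ (period (ns j))))).aestronglyMeasurable)
    (integrable_const C)
    (fun j => (G.pubBelief_mem_stdSimplex μ σ (period (ns j))).mono fun φ hφ => hC (_, _) hφ) hlim
  have hnonneg : ∀ φ, 0 ≤ H (G.limitBelief μ σ φ, G.meanAnn (G.limitBelief μ σ φ)) :=
    fun φ => le_max_right _ _
  have hzero := (integral_nonneg hnonneg).antisymm' (le_of_tendsto_of_tendsto' hdom
    (he.comp htime) fun j => hle _ i q R a (mover_period _) hR)
  filter_upwards [(integral_eq_zero_iff_of_nonneg hnonneg (G.integrable_comp_belief hH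
    (G.measurable_limitBelief μ σ) (G.limitBelief_mem_stdSimplex μ σ)
    (G.continuous_meanAnn.measurable.comp (G.measurable_limitBelief μ σ)))).1 hzero] with φ hφ
  exact max_eq_right_iff.1 hφ

theorem IsNash.ae_mean_limitBelief_eq (hG : G.KSeparable) :
    ∀ᵐ φ ∂(law μ), mean (G.limitBelief μ σ φ) G.X = G.X φ.1 := by
  set uncertain : Set (Ω → ℝ) := stdSimplex ℝ Ω ∩ {γ | ∃ ω, 0 < γ ω ∧ G.X ω ≠ mean γ G.X}
  have hnull : (law μ).map (G.limitBelief μ σ) uncertain = 0 := by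
    by_contra hne
    obtain ⟨γ, hγ, hpos⟩ := exists_mem_forall_mem_nhdsWithin_pos_measure hne
    obtain ⟨i, q, R, a, hR, hgain⟩ := hG.exists_testGain_pos hγ.1 hγ.2
    have hopen : IsOpen {γ | 0 < G.testGain i q R a (γ, G.meanAnn γ)} := isOpen_lt continuous_const
      ((G.continuous_testGain i q R a).comp (continuous_id.prodMk G.continuous_meanAnn))
    have hmap := hpos _ (mem_nhdsWithin_of_mem_nhds (hopen.mem_nhds hgain))
    rw [Measure.map_apply (G.measurable_limitBelief μ σ) hopen.measurableSet] at hmap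
    refine hmap.ne' (measure_eq_zero_iff_ae_notMem.2 ?_)
    filter_upwards [hσ.ae_testGain_limitBelief_le hμ i q a hR] with φ hφ using not_lt.2 hφ
  have hcertain := measure_eq_zero_iff_ae_notMem.1 (nonpos_iff_eq_zero.1
    ((Measure.le_map_apply (G.measurable_limitBelief μ σ).aemeasurable _).trans hnull.le))
  filter_upwards [hcertain, G.limitBelief_mem_stdSimplex μ σ,
    ae_belief_pos (μ := μ) (iSup_le (G.pub σ).le)] with φ hφ hsimplex hpos
  by_contra hne
  exact hφ ⟨hsimplex, φ.1, hpos, Ne.symm hne⟩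

end Test

end Game

/-! ### The poll -/

section Posterior

variable {Ω : Type*} [Fintype Ω] {γ : Ω → ℝ}

theorem marg_pos (hγ : ∀ ω, 0 ≤ γ ω) {R : Signal Ω} {τ : ℕ} {ω : Ω} (hω : 0 < γ ω)
    (hR : 0 < R.prob ω τ) : 0 < marg γ R τ :=
  (mul_pos hω hR).trans_le (Finset.single_le_sum (f := fun ω => γ ω * R.prob ω τ)
    (fun ω _ => mul_nonneg (hγ ω) (R.nonneg ω τ)) (Finset.mem_univ ω))

theorem posterior_pos (hγ : ∀ ω, 0 ≤ γ ω) {R : Signal Ω} {τ : ℕ} {ω : Ω} (hω : 0 < γ ω)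
    (hR : 0 < R.prob ω τ) : 0 < posterior γ R τ ω :=
  div_pos (mul_pos hω hR) (marg_pos hγ hω hR)

theorem pos_of_posterior_pos (hγ : ∀ ω, 0 ≤ γ ω) {R : Signal Ω} {τ : ℕ} {ω : Ω}
    (h : 0 < posterior γ R τ ω) : 0 < γ ω := by
  refine (hγ ω).lt_of_ne' fun h0 => h.ne' ?_
  rw [posterior, h0, zero_mul, zero_div]

theorem rel_and_pos_of_cellBelief_pos {P : Setoid Ω} {μ : Ω → ℝ} (hμ : ∀ ω, 0 ≤ μ ω) {ω ω' : Ω}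
    (h : 0 < cellBelief P μ ω ω') : P.r ω ω' ∧ 0 < μ ω' := by
  rw [cellBelief] at h
  split_ifs at h with hr
  · refine ⟨hr, (hμ ω').lt_of_ne' fun h0 => h.ne' ?_⟩
    rw [h0, zero_div]
  · exact absurd h (lt_irrefl _)

theorem mean_le {X : Ω → ℝ} (hγ : γ ∈ stdSimplex ℝ Ω) {x : ℝ} (hX : ∀ ω, 0 < γ ω → X ω ≤ x) :
    mean γ X ≤ x := by
  calc mean γ X ≤ ∑ ω, γ ω * x := Finset.sum_le_sum fun ω _ => by
        rcases (hγ.1 ω).eq_or_lt with h0 | h0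
        · rw [← h0, zero_mul, zero_mul]
        · exact mul_le_mul_of_nonneg_left (hX ω h0) h0.le
    _ = x := by rw [← Finset.sum_mul, hγ.2, one_mul]

theorem mean_lt {X : Ω → ℝ} (hγ : γ ∈ stdSimplex ℝ Ω) {x : ℝ} (hX : ∀ ω, 0 < γ ω → X ω ≤ x)
    {ω' : Ω} (hω' : 0 < γ ω') (hlt : X ω' < x) : mean γ X < x := by
  refine (mean_le hγ hX).lt_of_ne fun heq => ?_
  have hgap : ∑ ω, γ ω * (x - X ω) = 0 := by
    simp only [mul_sub, Finset.sum_sub_distrib, ← Finset.sum_mul, hγ.2, one_mul]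
    exact sub_eq_zero.2 heq.symm
  refine (mul_pos hω' (sub_pos.2 hlt)).ne' ((Finset.sum_eq_zero_iff_of_nonneg fun ω _ => ?_).1
    hgap ω' (Finset.mem_univ ω'))
  rcases (hγ.1 ω).eq_or_lt with h0 | h0
  · rw [← h0, zero_mul]
  · exact mul_nonneg h0.le (sub_nonneg.2 (hX ω h0))

end Posterior

theorem CostStructure.NoExclusion.prob_pos {Ω : Type*} {κ : CostStructure Ω} (h : κ.NoExclusion)
    {R : κ.avail} (hR : κ.K R ≠ ⊤) {ω ω' : Ω} {τ : ℕ} (hτ : 0 < R.1.prob ω τ) :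
    0 < R.1.prob ω' τ := by
  have hsupp : Function.support (R.1.prob ω) = Function.support (R.1.prob ω') := by
    by_contra hne
    exact hR (h R ω ω' hne)
  have hmem : τ ∈ Function.support (R.1.prob ω') := hsupp ▸ hτ.ne'
  exact (R.1.nonneg ω' τ).lt_of_ne' hmem

theorem measurable_realize_signal {Ω : Type*} [Countable Ω] [MeasurableSpace Ω]
    [MeasurableSingletonClass Ω] (R : Ω → Signal Ω) (k : ℕ) :
    Measurable fun φ : FullState Ω => realize ((R φ.1).prob φ.1) (φ.2.2 k) :=
  measurable_realize.comp (((Measurable.of_discrete (f := fun ω => (R ω).prob ω)).comp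
    measurable_fst).prodMk (by fun_prop))

section State

variable {Ω : Type*} [Fintype Ω] [MeasurableSpace Ω] [MeasurableSingletonClass Ω]

theorem law_state (μ : Ω → ℝ) (ω : Ω) :
    law μ (Prod.fst ⁻¹' {ω} : Set (FullState Ω)) = ENNReal.ofReal (μ ω) := by
  classical
  rw [law_eq_prod, ← Set.prod_univ, Measure.prod_prod, measure_univ, mul_one, stateLaw]
  simp [Measure.coe_finsetSum, Finset.sum_apply, Set.indicator]

theorem ae_state_pos {μ : Ω → ℝ} (hμ : ∀ ω, 0 ≤ μ ω) : ∀ᵐ φ ∂(law μ), 0 < μ φ.1 := by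
  have hnull : ∀ ω, μ ω = 0 → ∀ᵐ φ ∂(law μ), φ.1 ≠ ω := fun ω h0 =>
    (measure_eq_zero_iff_ae_notMem (s := Prod.fst ⁻¹' {ω})).1
      (by rw [law_state, h0, ENNReal.ofReal_zero])
  filter_upwards [ae_all_iff.2 fun ω => eventually_imp_distrib_left.2 (hnull ω)] with φ hφ
  exact (hμ _).lt_of_ne' fun h => hφ _ h rfl

theorem ae_realize_signal_pos (μ : Ω → ℝ) (R : Ω → Signal Ω) (k : ℕ) :
    ∀ᵐ φ ∂(law μ), 0 < (R φ.1).prob φ.1 (realize ((R φ.1).prob φ.1) (φ.2.2 k)) := by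
  refine ae_law_of_ae_redraw μ k (measurableSet_lt measurable_const ((Measurable.of_discrete
    (f := fun x : Ω × ℕ => (R x.1).prob x.1 x.2)).comp
      (measurable_fst.prodMk (measurable_realize_signal R k)))) fun φ => ?_
  simpa only [redraw, Function.update_self] using
    ae_realize_pos ((R φ.1).nonneg φ.1) ((R φ.1).hasSum_one φ.1)

end State

namespace Game

section Poll

variable {Ω : Type*} [Fintype Ω] {n : ℕ} (G : Game Ω n)

/-- The belief of trader `i` in the poll, after he has observed his signal. -/
def pollPosterior (μ : Ω → ℝ) (ρ : G.PollChoice) (i : Fin n) (φ : FullState Ω) : Ω → ℝ :=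
  posterior (cellBelief (G.part i) μ φ.1) (ρ i (Quotient.mk _ φ.1)).1
    (realize ((ρ i (Quotient.mk _ φ.1)).1.prob φ.1) (φ.2.2 i))

theorem pollPrediction_eq (μ : Ω → ℝ) (ρ : G.PollChoice) (φ : FullState Ω) :
    G.pollPrediction μ ρ φ = (∑ i : Fin n, mean (G.pollPosterior μ ρ i φ) G.X) / n := rfl

theorem PollChoice.IsOptimal.K_ne_top {G : Game Ω n} {μ : Ω → ℝ} {ρ : G.PollChoice}
    (hρ : ρ.IsOptimal μ) {i : Fin n} {ω : Ω} (hω : 0 < μ ω) :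
    G.κ.K (ρ i (Quotient.mk _ ω)) ≠ ⊤ := by
  refine G.K_ne_top_of_bot_lt_netGain (lt_of_lt_of_le ?_ (hρ i ω hω G.free))
  rw [G.netGain_eq (by simp [K_free])]
  exact EReal.bot_lt_coe _

theorem SomeTraderUncertain.exists_isMax {G : Game Ω n} {μ : Ω → ℝ}
    (h : G.SomeTraderUncertain μ) : ∃ i ω ω', 0 < μ ω ∧ 0 < μ ω' ∧ (G.part i).r ω ω' ∧
      G.X ω' < G.X ω ∧ ∀ j ω'', (G.part j).r ω ω'' → 0 < μ ω'' → G.X ω'' ≤ G.X ω := by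
  classical
  set uncertain : Finset Ω := Finset.univ.filter fun ω =>
    ∃ i ω', 0 < μ ω ∧ 0 < μ ω' ∧ (G.part i).r ω ω' ∧ G.X ω ≠ G.X ω'
  have hne : uncertain.Nonempty := by
    obtain ⟨i, ω, ω', h⟩ := h
    exact ⟨ω, Finset.mem_filter.2 ⟨Finset.mem_univ _, i, ω', h⟩⟩
  obtain ⟨ω, hmem, hmax⟩ := uncertain.exists_max_image G.X hne
  obtain ⟨-, i, ω', hω, hω', hr, hX⟩ := Finset.mem_filter.1 hmem
  have hle : ∀ j ω'', (G.part j).r ω ω'' → 0 < μ ω'' → G.X ω'' ≤ G.X ω := by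
    intro j ω'' hr'' hω''
    by_cases heq : G.X ω'' = G.X ω
    · exact heq.le
    · exact hmax ω'' (Finset.mem_filter.2
        ⟨Finset.mem_univ _, j, ω, hω'', hω, (G.part j).symm hr'', heq⟩)
  exact ⟨i, ω, ω', hω, hω', hr, (hle i ω' hr hω').lt_of_ne hX.symm, hle⟩

end Poll

section PollLaw

variable {Ω : Type*} [Fintype Ω] [MeasurableSpace Ω] {n : ℕ} (G : Game Ω n)
variable [MeasurableSingletonClass Ω] {μ : Ω → ℝ}

theorem measurable_pollPosterior (μ : Ω → ℝ) (ρ : G.PollChoice) (i : Fin n) :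
    Measurable (G.pollPosterior μ ρ i) :=
  (Measurable.of_discrete (f := fun x : Ω × ℕ =>
    posterior (cellBelief (G.part i) μ x.1) (ρ i (Quotient.mk _ x.1)).1 x.2)).comp
      (measurable_fst.prodMk
        (measurable_realize_signal (fun ω => (ρ i (Quotient.mk _ ω)).1) i))

theorem pollPosterior_mem_stdSimplex (hμ : ∀ ω, 0 ≤ μ ω) (ρ : G.PollChoice) (i : Fin n) :
    ∀ᵐ φ ∂(law μ), G.pollPosterior μ ρ i φ ∈ stdSimplex ℝ Ω := by
  filter_upwards [ae_state_pos hμ,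
    ae_realize_signal_pos μ (fun ω => (ρ i (Quotient.mk _ ω)).1) i] with φ hω hτ
  exact posterior_mem_stdSimplex (cellBelief_nonneg hμ _) _ (marg_pos (cellBelief_nonneg hμ _)
    (cellBelief_pos hμ hω ((G.part i).refl φ.1) hω) hτ).ne'

theorem integrable_pollPrediction (hμ : ∀ ω, 0 ≤ μ ω) (ρ : G.PollChoice) :
    Integrable (G.pollPrediction μ ρ) (law μ) := by
  rw [funext (G.pollPrediction_eq μ ρ)]
  exact (integrable_finsetSum _ fun i _ => G.integrable_comp_belief
    ((continuous_mean G.X).comp continuous_fst) (G.measurable_pollPosterior μ ρ i)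
    (G.pollPosterior_mem_stdSimplex hμ ρ i) (measurable_const (a := G.y₀))).div_const _

theorem integrable_X (μ : Ω → ℝ) : Integrable (fun φ : FullState Ω => G.X φ.1) (law μ) :=
  Integrable.of_bound ((Measurable.of_discrete (f := G.X)).comp measurable_fst).aestronglyMeasurable
    ‖G.X‖ (ae_of_all _ fun φ => norm_le_pi_norm G.X φ.1)

variable {G} [NeZero n]

theorem PollChoice.IsOptimal.exists_ae_pollPrediction_lt (h₂ : G.κ.NoExclusion)
    (hμ : ∀ ω, 0 ≤ μ ω) (hunc : G.SomeTraderUncertain μ) {ρ : G.PollChoice}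
    (hρ : ρ.IsOptimal μ) :
    ∃ ω, 0 < μ ω ∧ ∀ᵐ φ ∂(law μ), φ.1 = ω → G.pollPrediction μ ρ φ < G.X φ.1 := by
  obtain ⟨i, ω, ω', hω, hω', hr, hlt, hmax⟩ := hunc.exists_isMax
  refine ⟨ω, hω, ?_⟩
  filter_upwards [ae_realize_signal_pos μ (fun ω => (ρ i (Quotient.mk _ ω)).1) i,
    ae_all_iff.2 (G.pollPosterior_mem_stdSimplex hμ ρ)] with φ hτ hmem hφ
  obtain rfl := hφ
  have hle : ∀ j ω'', 0 < G.pollPosterior μ ρ j φ ω'' → G.X ω'' ≤ G.X φ.1 := fun j ω'' hpos => by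
    obtain ⟨hr'', hω''⟩ :=
      rel_and_pos_of_cellBelief_pos hμ (pos_of_posterior_pos (cellBelief_nonneg hμ _) hpos)
    exact hmax j ω'' hr'' hω''
  have hpos : 0 < G.pollPosterior μ ρ i φ ω' := posterior_pos (cellBelief_nonneg hμ _)
    (cellBelief_pos hμ hω hr hω') (h₂.prob_pos (hρ.K_ne_top hω) hτ)
  rw [pollPrediction_eq, div_lt_iff₀ (Nat.cast_pos.2 (NeZero.pos n))]
  calc ∑ j : Fin n, mean (G.pollPosterior μ ρ j φ) G.X < ∑ _ : Fin n, G.X φ.1 :=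
        Finset.sum_lt_sum (fun j _ => mean_le (hmem j) (hle j))
          ⟨i, Finset.mem_univ _, mean_lt (hmem i) (hle i) hpos hlt⟩
    _ = G.X φ.1 * n := by rw [Finset.sum_const, Finset.card_fin, nsmul_eq_mul, mul_comm]

theorem PollChoice.IsOptimal.accuracy_pollPrediction_lt_one (h₂ : G.κ.NoExclusion)
    (hμ : μ ∈ stdSimplex ℝ Ω) (hunc : G.SomeTraderUncertain μ) {ρ : G.PollChoice}
    (hρ : ρ.IsOptimal μ) : G.accuracy μ (G.pollPrediction μ ρ) < 1 := by
  have hprob := isProbabilityMeasure_law hμ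
  have hint : Integrable (fun φ => |G.pollPrediction μ ρ φ - G.X φ.1|) (law μ) :=
    ((G.integrable_pollPrediction hμ.1 ρ).sub (G.integrable_X μ)).abs
  have herror : 0 < ∫ φ, |G.pollPrediction μ ρ φ - G.X φ.1| ∂(law μ) := by
    obtain ⟨ω, hω, hlt⟩ := hρ.exists_ae_pollPrediction_lt h₂ hμ.1 hunc
    refine lt_of_le_of_ne (integral_nonneg fun φ => abs_nonneg _) fun h0 => ?_
    have hnull : ∀ᵐ φ ∂(law μ), φ ∉ (Prod.fst ⁻¹' {ω} : Set (FullState Ω)) := by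
      filter_upwards [(integral_eq_zero_iff_of_nonneg (fun φ => abs_nonneg _) hint).1 h0.symm, hlt]
        with φ hzero hlt hφ
      exact (hlt hφ).ne (sub_eq_zero.1 (abs_eq_zero.1 hzero))
    have hmass := measure_eq_zero_iff_ae_notMem.2 hnull
    rw [law_state, ENNReal.ofReal_eq_zero] at hmass
    exact hω.not_ge hmass
  rw [accuracy, integral_sub (integrable_const 1) hint, integral_const, probReal_univ, one_smul]
  exact sub_lt_self 1 herror

end PollLaw

end Game

/-! ### The value of information -/

section RandPost

variable {Ω : Type*} [Fintype Ω] {γ : Ω → ℝ}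

theorem sum_ofReal_mul_ofReal_add (hγ : γ ∈ stdSimplex ℝ Ω) {f : Ω → ℝ} {b : ℝ}
    (hf : ∀ ω, 0 ≤ f ω + b) :
    ∑ ω, ENNReal.ofReal (γ ω) * ENNReal.ofReal (f ω + b) =
      ENNReal.ofReal (∑ ω, γ ω * f ω + b) := by
  have h : ∑ ω, γ ω * f ω + b = ∑ ω, γ ω * (f ω + b) := by
    simp only [mul_add, Finset.sum_add_distrib, ← Finset.sum_mul, hγ.2, one_mul]
  rw [h, ENNReal.ofReal_sum_of_nonneg fun ω _ => mul_nonneg (hγ.1 ω) (hf ω)]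
  exact Finset.sum_congr rfl fun ω _ => (ENNReal.ofReal_mul (hγ.1 ω)).symm

theorem tsum_ofReal_marg (hγ : γ ∈ stdSimplex ℝ Ω) (R : Signal Ω) :
    ∑' τ, ENNReal.ofReal (marg γ R τ) = 1 := by
  have h := hasSum_marg γ R
  rw [← ENNReal.ofReal_tsum_of_nonneg (marg_nonneg hγ.1 R) h.summable, h.tsum_eq, hγ.2,
    ENNReal.ofReal_one]

theorem tsum_ofReal_marg_mul_le (R : Signal Ω) {f g : ℕ → ℝ≥0∞}
    (h : ∀ τ, marg γ R τ ≠ 0 → f τ ≤ g τ) :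
    ∑' τ, ENNReal.ofReal (marg γ R τ) * f τ ≤ ∑' τ, ENNReal.ofReal (marg γ R τ) * g τ := by
  refine ENNReal.tsum_le_tsum fun τ => ?_
  rcases eq_or_ne (marg γ R τ) 0 with h0 | h0
  · rw [h0, ENNReal.ofReal_zero, zero_mul, zero_mul]
  · exact mul_le_mul_right (h τ h0) _

theorem tsum_ofReal_marg_mul_const (hγ : γ ∈ stdSimplex ℝ Ω) (R : Signal Ω) (b : ℝ≥0∞) :
    ∑' τ, ENNReal.ofReal (marg γ R τ) * b = b := by
  rw [ENNReal.tsum_mul_right, tsum_ofReal_marg hγ, one_mul]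

theorem tsum_ofReal_marg_mul_sum_posterior (hγ : ∀ ω, 0 ≤ γ ω) (R : Signal Ω)
    (f : ℕ → Ω → ℝ≥0∞) :
    ∑' τ, ENNReal.ofReal (marg γ R τ) * ∑ ω, ENNReal.ofReal (posterior γ R τ ω) * f τ ω =
      ∑ ω, ENNReal.ofReal (γ ω) * ∑' τ, ENNReal.ofReal (R.prob ω τ) * f τ ω := by
  simp only [Finset.mul_sum, ← ENNReal.tsum_mul_left]
  rw [Summable.tsum_finsetSum fun _ _ => ENNReal.summable]
  refine Finset.sum_congr rfl fun ω _ => tsum_congr fun τ => ?_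
  rw [← mul_assoc, ← mul_assoc, ← ENNReal.ofReal_mul (marg_nonneg hγ R τ),
    marg_mul_posterior hγ, ENNReal.ofReal_mul (hγ ω)]

open Classical in
theorem ofReal_randPost (hγ : ∀ ω, 0 ≤ γ ω) (R : Signal Ω) (δ : Ω → ℝ) :
    ENNReal.ofReal (randPost γ R δ) =
      ∑' τ, if posterior γ R τ = δ then ENNReal.ofReal (marg γ R τ) else 0 := by
  have h0 : ∀ τ, 0 ≤ if posterior γ R τ = δ then marg γ R τ else 0 := fun τ =>
    ite_nonneg (marg_nonneg hγ R τ) le_rfl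
  have hle : ∀ τ, (if posterior γ R τ = δ then marg γ R τ else 0) ≤ marg γ R τ := fun τ =>
    ite_le_sup _ _ _ |>.trans (sup_le le_rfl (marg_nonneg hγ R τ))
  rw [randPost, ENNReal.ofReal_tsum_of_nonneg h0
    (Summable.of_nonneg_of_le h0 hle (hasSum_marg γ R).summable)]
  exact tsum_congr fun τ => by rw [apply_ite ENNReal.ofReal, ENNReal.ofReal_zero]

theorem tsum_ofReal_randPost_mul (hγ : ∀ ω, 0 ≤ γ ω) (R : Signal Ω) (V : (Ω → ℝ) → ℝ≥0∞) :
    ∑' δ, ENNReal.ofReal (randPost γ R δ) * V δ =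
      ∑' τ, ENNReal.ofReal (marg γ R τ) * V (posterior γ R τ) := by
  classical
  simp only [ofReal_randPost hγ, ← ENNReal.tsum_mul_right, ite_mul, zero_mul]
  rw [ENNReal.tsum_comm]
  exact tsum_congr fun τ =>
    tsum_ite_eq' (posterior γ R τ) fun δ => ENNReal.ofReal (marg γ R τ) * V δ

theorem randPost_nonneg (hγ : ∀ ω, 0 ≤ γ ω) (R : Signal Ω) (δ : Ω → ℝ) : 0 ≤ randPost γ R δ :=
  tsum_nonneg fun τ => ite_nonneg (marg_nonneg hγ R τ) le_rfl

theorem randPost_le_one (hγ : γ ∈ stdSimplex ℝ Ω) (R : Signal Ω) (δ : Ω → ℝ) :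
    randPost γ R δ ≤ 1 := by
  classical
  rw [← ENNReal.ofReal_le_one, ofReal_randPost hγ.1, ← tsum_ofReal_marg hγ R]
  exact ENNReal.tsum_le_tsum fun τ => ite_le_sup _ _ _ |>.trans (sup_le le_rfl zero_le)

theorem ofReal_tsum_marg_mul_randPost (hγ : ∀ ω, 0 ≤ γ ω) (R : Signal Ω) (S : ℕ → Signal Ω)
    (δ : Ω → ℝ) :
    ENNReal.ofReal (∑' τ, marg γ R τ * randPost (posterior γ R τ) (S τ) δ) =
      ∑' τ, ENNReal.ofReal (marg γ R τ) *
        ENNReal.ofReal (randPost (posterior γ R τ) (S τ) δ) := by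
  have h0 : ∀ τ, 0 ≤ marg γ R τ * randPost (posterior γ R τ) (S τ) δ := fun τ =>
    mul_nonneg (marg_nonneg hγ R τ) (randPost_nonneg (posterior_nonneg hγ R τ) _ _)
  have hle : ∀ τ, marg γ R τ * randPost (posterior γ R τ) (S τ) δ ≤ marg γ R τ := by
    intro τ
    rcases eq_or_ne (marg γ R τ) 0 with h | h
    · rw [h, zero_mul]
    · exact mul_le_of_le_one_right (marg_nonneg hγ R τ)
        (randPost_le_one (posterior_mem_stdSimplex hγ R h) _ _)
  rw [ENNReal.ofReal_tsum_of_nonneg h0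
    (Summable.of_nonneg_of_le h0 hle (hasSum_marg γ R).summable)]
  exact tsum_congr fun τ => ENNReal.ofReal_mul (marg_nonneg hγ R τ)

end RandPost

namespace Game

section Value

variable {Ω : Type*} [Fintype Ω] {n : ℕ} (G : Game Ω n) {γ : Ω → ℝ}

/-- The score, shifted so as to be nonnegative. -/
def posScore (y : G.Ann) (ω : Ω) : ℝ≥0∞ := ENNReal.ofReal (G.score y ω + G.scoreBound)

theorem score_add_nonneg (y : G.Ann) (ω : Ω) : 0 ≤ G.score y ω + G.scoreBound := by
  linarith [neg_abs_le (G.score y ω), G.abs_score_le y ω]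

theorem posScore_le (y : G.Ann) (ω : Ω) :
    G.posScore y ω ≤ ENNReal.ofReal (G.scoreBound + G.scoreBound) :=
  ENNReal.ofReal_le_ofReal (add_le_add_left ((le_abs_self _).trans (G.abs_score_le y ω)) _)

theorem measurable_posScore (ω : Ω) : Measurable fun y : G.Ann => G.posScore y ω :=
  ENNReal.measurable_ofReal.comp ((G.continuous_score ω).measurable.add_const _)

/-- The (shifted) score of the last announcement. -/
def lastScore (ω : Ω) (k : ℕ) (h : Fin k → G.Record) : ℝ≥0∞ :=
  G.posScore (G.lastAnn fun j => (h j).2) ω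

theorem measurable_lastScore (ω : Ω) (k : ℕ) : Measurable (G.lastScore ω k) :=
  (G.measurable_posScore ω).comp ((G.measurable_lastAnn k).comp (by fun_prop))

theorem tsum_ofReal_prob_mul_posScore (R : Signal Ω) (a : ℕ → G.Ann) (ω : Ω) :
    ∑' τ, ENNReal.ofReal (R.prob ω τ) * G.posScore (a τ) ω =
      ENNReal.ofReal (G.signalScore R a ω + G.scoreBound) := by
  have h := (G.summable_signalScore R a ω).hasSum.add ((R.hasSum_one ω).mul_right G.scoreBound)
  simp only [← mul_add, one_mul] at h
  rw [signalScore, ← h.tsum_eq, ENNReal.ofReal_tsum_of_nonneg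
    (fun τ => mul_nonneg (R.nonneg ω τ) (G.score_add_nonneg _ _)) h.summable]
  exact tsum_congr fun τ => (ENNReal.ofReal_mul (R.nonneg ω τ)).symm

/-- Expected (shifted) score of the best announcement at the belief `γ`. -/
def beliefValue (γ : Ω → ℝ) : ℝ≥0∞ := ∑ ω, ENNReal.ofReal (γ ω) * G.posScore (G.meanAnn γ) ω

theorem sum_ofReal_mul_posScore (hγ : γ ∈ stdSimplex ℝ Ω) (y : G.Ann) :
    ∑ ω, ENNReal.ofReal (γ ω) * G.posScore y ω =
      ENNReal.ofReal (∑ ω, γ ω * G.score y ω + G.scoreBound) :=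
  sum_ofReal_mul_ofReal_add hγ (G.score_add_nonneg y)

theorem sum_ofReal_mul_posScore_le (hγ : γ ∈ stdSimplex ℝ Ω) (y : G.Ann) :
    ∑ ω, ENNReal.ofReal (γ ω) * G.posScore y ω ≤ G.beliefValue γ := by
  rw [beliefValue, G.sum_ofReal_mul_posScore hγ, G.sum_ofReal_mul_posScore hγ]
  exact ENNReal.ofReal_le_ofReal (by linarith [G.sum_score_le hγ y])

theorem beliefValue_le (hγ : γ ∈ stdSimplex ℝ Ω) :
    G.beliefValue γ ≤ ENNReal.ofReal (G.scoreBound + G.scoreBound) := by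
  calc G.beliefValue γ
      ≤ ∑ ω, ENNReal.ofReal (γ ω) * ENNReal.ofReal (G.scoreBound + G.scoreBound) :=
        Finset.sum_le_sum fun ω _ => mul_le_mul_right (G.posScore_le _ ω) _
    _ = ENNReal.ofReal (G.scoreBound + G.scoreBound) := by
        rw [← Finset.sum_mul, ← ENNReal.ofReal_sum_of_nonneg fun ω _ => hγ.1 ω, hγ.2,
          ENNReal.ofReal_one, one_mul]

/-- Expected (shifted) score at the belief `γ` if `R` is acquired. -/
def signalValue (γ : Ω → ℝ) (R : Signal Ω) : ℝ≥0∞ :=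
  ∑' τ, ENNReal.ofReal (marg γ R τ) * G.beliefValue (posterior γ R τ)

theorem signalValue_le (hγ : γ ∈ stdSimplex ℝ Ω) (R : Signal Ω) :
    G.signalValue γ R ≤ ENNReal.ofReal (G.scoreBound + G.scoreBound) := by
  calc G.signalValue γ R
      ≤ ∑' τ, ENNReal.ofReal (marg γ R τ) * ENNReal.ofReal (G.scoreBound + G.scoreBound) :=
        tsum_ofReal_marg_mul_le R fun τ h =>
          G.beliefValue_le (posterior_mem_stdSimplex hγ.1 R h)
    _ = ENNReal.ofReal (G.scoreBound + G.scoreBound) := tsum_ofReal_marg_mul_const hγ R _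

theorem signalValue_eq (hγ : γ ∈ stdSimplex ℝ Ω) (R : Signal Ω) :
    G.signalValue γ R = ENNReal.ofReal (∑ ω, γ ω *
      G.signalScore R (fun τ => G.meanAnn (posterior γ R τ)) ω + G.scoreBound) := by
  simp only [signalValue, beliefValue]
  rw [tsum_ofReal_marg_mul_sum_posterior hγ.1]
  simp only [G.tsum_ofReal_prob_mul_posScore R fun τ => G.meanAnn (posterior γ R τ)]
  refine sum_ofReal_mul_ofReal_add hγ fun ω => ?_
  linarith [neg_le_of_abs_le (G.abs_signalScore_le R (fun τ => G.meanAnn (posterior γ R τ)) ω)]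

theorem posterior_free (hγ : γ ∈ stdSimplex ℝ Ω) {τ : ℕ} (h : marg γ G.free.1 τ ≠ 0) :
    posterior γ G.free.1 τ = γ := by
  have marg_eq : ∀ ω, marg γ G.free.1 τ = G.free.1.prob ω τ := by
    intro ω
    simp only [marg, fun ω' => G.free_prob ω' ω]
    rw [← Finset.sum_mul, hγ.2, one_mul]
  ext ω
  rw [posterior, ← marg_eq ω, mul_div_cancel_right₀ _ h]

theorem signalValue_free (hγ : γ ∈ stdSimplex ℝ Ω) :
    G.signalValue γ G.free.1 = G.beliefValue γ := by
  have term_eq : ∀ τ, ENNReal.ofReal (marg γ G.free.1 τ) *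
      G.beliefValue (posterior γ G.free.1 τ) =
      ENNReal.ofReal (marg γ G.free.1 τ) * G.beliefValue γ := by
    intro τ
    rcases eq_or_ne (marg γ G.free.1 τ) 0 with h | h
    · rw [h, ENNReal.ofReal_zero, zero_mul, zero_mul]
    · rw [G.posterior_free hγ h]
  rw [signalValue, tsum_congr term_eq, tsum_ofReal_marg_mul_const hγ]

/-- The cost `c K(R)` of acquiring the signal `R`. -/
def cost (R : G.κ.avail) : ℝ≥0∞ := ENNReal.ofReal G.κ.c * G.κ.K R

theorem cost_free : G.cost G.free = 0 := by rw [cost, K_free, mul_zero]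

theorem measurable_cost : Measurable G.cost :=
  Measurable.const_mul G.κ.measurable_K _

/-- Value of the best signal at the belief `γ`, net of its cost. The subtraction is truncated at
`0`, which does not affect the supremum since the values of the free signal are nonnegative. -/
def optValue (γ : Ω → ℝ) : ℝ≥0∞ := ⨆ R : G.κ.avail, (G.signalValue γ R.1 - G.cost R)

theorem signalValue_le_optValue_add (γ : Ω → ℝ) (R : G.κ.avail) :
    G.signalValue γ R.1 ≤ G.optValue γ + G.cost R :=
  tsub_le_iff_right.1 (le_iSup (fun R : G.κ.avail => G.signalValue γ R.1 - G.cost R) R)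

theorem beliefValue_le_optValue (hγ : γ ∈ stdSimplex ℝ Ω) : G.beliefValue γ ≤ G.optValue γ := by
  have := G.signalValue_le_optValue_add γ G.free
  rwa [G.signalValue_free hγ, cost_free, add_zero] at this

theorem optValue_ne_top (hγ : γ ∈ stdSimplex ℝ Ω) : G.optValue γ ≠ ⊤ :=
  ne_top_of_le_ne_top ENNReal.ofReal_ne_top
    (iSup_le fun R => tsub_le_self.trans (G.signalValue_le hγ R.1))

theorem exists_optValue_add_le (hγ : γ ∈ stdSimplex ℝ Ω) {ε : ℝ≥0∞} (hε : ε ≠ 0) :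
    ∃ S : G.κ.avail, G.optValue γ + G.cost S ≤ G.signalValue γ S.1 + ε := by
  rcases eq_or_ne (G.optValue γ) 0 with h0 | h0
  · exact ⟨G.free, by rw [h0, cost_free, zero_add]; exact zero_le⟩
  obtain ⟨S, hS⟩ := lt_iSup_iff.1 (ENNReal.sub_lt_self (G.optValue_ne_top hγ) h0 hε)
  have cost_le : G.cost S ≤ G.signalValue γ S.1 :=
    (tsub_pos_iff_lt.1 (zero_le.trans_lt hS)).le
  refine ⟨S, ?_⟩
  calc G.optValue γ + G.cost S ≤ G.signalValue γ S.1 - G.cost S + ε + G.cost S :=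
        add_le_add_left (tsub_le_iff_right.1 hS.le) _
    _ = G.signalValue γ S.1 + ε := by rw [add_right_comm, tsub_add_cancel_of_le cost_le]

theorem signalValue_of_randPost_eq (hγ : ∀ ω, 0 ≤ γ ω) {R R' : Signal Ω} {S : ℕ → Signal Ω}
    (h : ∀ δ, randPost γ R' δ = ∑' τ, marg γ R τ * randPost (posterior γ R τ) (S τ) δ) :
    G.signalValue γ R' =
      ∑' τ, ENNReal.ofReal (marg γ R τ) * G.signalValue (posterior γ R τ) (S τ) := by
  simp only [signalValue]
  rw [← tsum_ofReal_randPost_mul hγ R' G.beliefValue]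
  simp only [h, ofReal_tsum_marg_mul_randPost hγ, ← ENNReal.tsum_mul_right]
  rw [ENNReal.tsum_comm]
  refine tsum_congr fun τ => ?_
  rw [← tsum_ofReal_randPost_mul (posterior_nonneg hγ R τ), ← ENNReal.tsum_mul_left]
  exact tsum_congr fun δ => mul_assoc _ _ _

theorem tsum_signalValue_posterior_le (h₁ : G.κ.SequentialProof) (hγ : γ ∈ stdSimplex ℝ Ω)
    (R : G.κ.avail) (S : ℕ → G.κ.avail) :
    ∑' τ, ENNReal.ofReal (marg γ R.1 τ) * G.signalValue (posterior γ R.1 τ) (S τ).1 ≤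
      G.optValue γ + (G.cost R + ∑' τ, ENNReal.ofReal (marg γ R.1 τ) * G.cost (S τ)) := by
  obtain ⟨R', randPost_eq, K_le⟩ := h₁ γ hγ R S
  have cost_le : G.cost R' ≤
      G.cost R + ∑' τ, ENNReal.ofReal (marg γ R.1 τ) * G.cost (S τ) := by
    simp only [cost, mul_left_comm _ (ENNReal.ofReal G.κ.c)]
    rw [ENNReal.tsum_mul_left, ← mul_add]
    gcongr
  rw [← G.signalValue_of_randPost_eq hγ.1 randPost_eq]
  exact (G.signalValue_le_optValue_add γ R').trans (by gcongr)

theorem tsum_optValue_posterior_le (h₁ : G.κ.SequentialProof) (hγ : γ ∈ stdSimplex ℝ Ω)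
    (R : G.κ.avail) :
    ∑' τ, ENNReal.ofReal (marg γ R.1 τ) * G.optValue (posterior γ R.1 τ) ≤
      G.optValue γ + G.cost R := by
  refine ENNReal.le_of_forall_pos_le_add fun ε hε _ => ?_
  have exists_signal : ∀ τ, ∃ S : G.κ.avail, marg γ R.1 τ ≠ 0 →
      G.optValue (posterior γ R.1 τ) + G.cost S ≤
        G.signalValue (posterior γ R.1 τ) S.1 + ε := by
    intro τ
    by_cases h : marg γ R.1 τ = 0
    · exact ⟨G.free, fun h' => absurd h h'⟩
    · obtain ⟨S, hS⟩ := G.exists_optValue_add_le (posterior_mem_stdSimplex hγ.1 R.1 h)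
        (ENNReal.coe_ne_zero.2 hε.ne')
      exact ⟨S, fun _ => hS⟩
  choose S hS using exists_signal
  set Q : ℝ≥0∞ := ∑' τ, ENNReal.ofReal (marg γ R.1 τ) * G.cost (S τ) with hQ
  set V : ℝ≥0∞ := ∑' τ, ENNReal.ofReal (marg γ R.1 τ) *
    G.signalValue (posterior γ R.1 τ) (S τ).1 with hV
  have add_le : ∑' τ, ENNReal.ofReal (marg γ R.1 τ) * G.optValue (posterior γ R.1 τ) + Q ≤
      V + ε := by
    rw [hQ, hV, ← tsum_ofReal_marg_mul_const hγ R.1 ε, ← ENNReal.tsum_add, ← ENNReal.tsum_add]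
    simp only [← mul_add]
    exact tsum_ofReal_marg_mul_le R.1 hS
  have V_le : V ≤ ENNReal.ofReal (G.scoreBound + G.scoreBound) := by
    rw [← tsum_ofReal_marg_mul_const hγ R.1 (ENNReal.ofReal (G.scoreBound + G.scoreBound))]
    exact tsum_ofReal_marg_mul_le R.1 fun τ h =>
      G.signalValue_le (posterior_mem_stdSimplex hγ.1 R.1 h) (S τ).1
  have Q_ne_top : Q ≠ ⊤ := ne_top_of_le_ne_top
    (ENNReal.add_ne_top.2 ⟨ne_top_of_le_ne_top ENNReal.ofReal_ne_top V_le, ENNReal.coe_ne_top⟩)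
    (le_add_self.trans add_le)
  refine (ENNReal.add_le_add_iff_right Q_ne_top).1 (add_le.trans ?_)
  calc V + ε ≤ G.optValue γ + (G.cost R + Q) + ε :=
        add_le_add_left (G.tsum_signalValue_posterior_le h₁ hγ R S) _
    _ = G.optValue γ + G.cost R + ε + Q := by ring

theorem optValue_le_beliefValue (hγ : γ ∈ stdSimplex ℝ Ω)
    (h : ∀ R : G.κ.avail, G.netGain γ R ≤ 0) : G.optValue γ ≤ G.beliefValue γ := by
  refine iSup_le fun R => tsub_le_iff_right.2 ?_
  by_cases hK : G.κ.K R = ⊤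
  · rw [cost, hK, ENNReal.mul_top (by simpa using G.κ.c_pos), add_top]
    exact le_top
  · have gain_le := h R
    rw [G.netGain_eq hK, ← EReal.coe_zero, EReal.coe_le_coe_iff, G.gain_eq hγ] at gain_le
    simp only [mul_sub, Finset.sum_sub_distrib] at gain_le
    have cost_eq : G.cost R = ENNReal.ofReal (G.κ.c * (G.κ.K R).toReal) := by
      rw [ENNReal.ofReal_mul G.κ.c_pos.le, ENNReal.ofReal_toReal hK, cost]
    rw [G.signalValue_eq hγ, beliefValue, G.sum_ofReal_mul_posScore hγ, cost_eq]
    refine (ENNReal.ofReal_le_ofReal ?_).trans ENNReal.ofReal_add_le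
    linarith

end Value

end Game

/-! ### Play as a tree -/

namespace Game

variable {Ω : Type*} [Fintype Ω] [MeasurableSpace Ω] {n : ℕ} [NeZero n] (G : Game Ω n)

/-- Expectation in state `ω`, after the records `h` of the first `k` periods and given the private
randomizations `ι`, of the sum of `r` over the next `m` periods and of `g` after these periods. -/
def treeSum (σ : G.Profile) (ω : Ω) (ι : ℕ → unitInterval)
    (g r : (k : ℕ) → (Fin k → G.Record) → ℝ≥0∞) :
    ℕ → (k : ℕ) → (Fin k → G.Record) → ℝ≥0∞
  | 0, k, h => g k h
  | m + 1, k, h => r k h + ∑' τ, ENNReal.ofReal ((G.chosen σ ω ι k h).1.prob ω τ) *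
      treeSum σ ω ι g r m (k + 1) (Fin.snoc (α := fun _ => G.Record) h (G.respond σ ω ι k h τ))

section Expectation

variable (σ : G.Profile) (ω : Ω) (ι : ℕ → unitInterval)
  {g r : (k : ℕ) → (Fin k → G.Record) → ℝ≥0∞}

theorem measurable_chosen_right (k : ℕ) : Measurable (G.chosen σ ω ι k) :=
  (G.measurable_chosen σ k).comp (f := fun h => ((ω, ι), h)) (by fun_prop)

theorem measurable_treeSum (hg : ∀ k, Measurable (g k)) (hr : ∀ k, Measurable (r k)) (m k : ℕ) :
    Measurable (G.treeSum σ ω ι g r m k) := by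
  induction m generalizing k with
  | zero => exact hg k
  | succ m ih =>
    refine (hr k).add (Measurable.tsum fun τ => Measurable.mul ?_ ?_)
    · exact ENNReal.measurable_ofReal.comp ((measurable_pi_apply τ).comp
        ((Signal.measurable_prob ω).comp
          (measurable_subtype_coe.comp (G.measurable_chosen_right σ ω ι k))))
    · have hrespond : Measurable fun h : Fin k → G.Record => G.respond σ ω ι k h τ :=
        (G.measurable_respond σ k).comp (f := fun h => (((ω, ι), h), τ)) (by fun_prop)
      exact (ih (k + 1)).comp (measurable_snoc measurable_id hrespond)

variable [MeasurableSingletonClass Ω]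

theorem measurable_play_right (k : ℕ) :
    Measurable fun u : ℕ → unitInterval => G.play σ (ω, ι, u) k :=
  (G.measurable_play σ k).comp (f := fun u => (ω, ι, u)) (by fun_prop)

theorem lintegral_play_succ (k : ℕ) {F : (Fin (k + 1) → G.Record) → ℝ≥0∞} (hF : Measurable F) :
    ∫⁻ u, F (G.play σ (ω, ι, u) (k + 1)) ∂uniformSeq =
      ∫⁻ u, ∑' τ, ENNReal.ofReal ((G.chosen σ ω ι k (G.play σ (ω, ι, u) k)).1.prob ω τ) *
        F (Fin.snoc (α := fun _ => G.Record) (G.play σ (ω, ι, u) k)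
          (G.respond σ ω ι k (G.play σ (ω, ι, u) k) τ)) ∂uniformSeq := by
  have hmp := measurePreserving_update (fun _ : ℕ => (volume : Measure unitInterval)) k
  have hm : Measurable fun u => F (G.play σ (ω, ι, u) (k + 1)) :=
    hF.comp (G.measurable_play_right σ ω ι (k + 1))
  have hm_update : Measurable fun x : (ℕ → unitInterval) × unitInterval =>
      F (G.play σ (ω, ι, Function.update x.1 k x.2) (k + 1)) := hm.comp hmp.measurable
  rw [uniformSeq, ← hmp.lintegral_comp hm, lintegral_prod _ hm_update.aemeasurable]
  refine lintegral_congr fun u => ?_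
  have play_update : ∀ v, G.play σ (ω, ι, Function.update u k v) k = G.play σ (ω, ι, u) k :=
    fun v => G.play_redraw σ (ω, ι, u) k v
  simp only [play, play_update, step_eq, Function.update_self]
  exact lintegral_realize (Signal.nonneg _ ω) (Signal.hasSum_one _ ω) fun τ =>
    F (Fin.snoc (α := fun _ => G.Record) (G.play σ (ω, ι, u) k)
      (G.respond σ ω ι k (G.play σ (ω, ι, u) k) τ))

theorem lintegral_treeSum (hg : ∀ k, Measurable (g k)) (hr : ∀ k, Measurable (r k))
    {m k N : ℕ} (hN : k + m = N) :
    ∫⁻ u, G.treeSum σ ω ι g r m k (G.play σ (ω, ι, u) k) ∂uniformSeq =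
      ∫⁻ u, (∑ j ∈ Finset.Ico k N, r j (G.play σ (ω, ι, u) j) +
        g N (G.play σ (ω, ι, u) N)) ∂uniformSeq := by
  induction m generalizing k with
  | zero =>
    obtain rfl : k = N := hN
    simp only [treeSum, Finset.Ico_self, Finset.sum_empty, zero_add]
  | succ m ih =>
    have hrk : Measurable fun u => r k (G.play σ (ω, ι, u) k) :=
      (hr k).comp (G.measurable_play_right σ ω ι k)
    simp only [treeSum]
    rw [lintegral_add_left hrk,
      ← G.lintegral_play_succ σ ω ι k (G.measurable_treeSum σ ω ι hg hr m (k + 1)),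
      ih (by omega), ← lintegral_add_left hrk]
    simp only [Finset.sum_eq_sum_Ico_succ_bot (show k < N by omega), add_assoc]

theorem treeSum_zero (hg : ∀ k, Measurable (g k)) (hr : ∀ k, Measurable (r k)) (N : ℕ) :
    G.treeSum σ ω ι g r N 0 Fin.elim0 = ∫⁻ u, (∑ j ∈ Finset.range N, r j (G.play σ (ω, ι, u) j) +
      g N (G.play σ (ω, ι, u) N)) ∂uniformSeq := by
  have h := G.lintegral_treeSum σ ω ι hg hr (zero_add N)
  simp only [play, lintegral_const, measure_univ, mul_one] at h
  rw [h, Finset.range_eq_Ico]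

end Expectation

/-- The cost of the signal acquired after the records `h`. -/
def chosenCost (σ : G.Profile) (ω : Ω) (ι : ℕ → unitInterval) (k : ℕ) (h : Fin k → G.Record) :
    ℝ≥0∞ := G.cost (G.chosen σ ω ι k h)

theorem measurable_chosenCost (σ : G.Profile) (ω : Ω) (ι : ℕ → unitInterval) (k : ℕ) :
    Measurable (G.chosenCost σ ω ι k) :=
  G.measurable_cost.comp (G.measurable_chosen_right σ ω ι k)

/-- Within `A`, the play depends on the state only through the realizations of the signals. -/
def StateFreeOn (σ : G.Profile) (ι : ℕ → unitInterval) (A : Set Ω) : Prop :=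
  ∀ ω ∈ A, ∀ ω' ∈ A, ∀ k h, G.respond σ ω ι k h = G.respond σ ω' ι k h

namespace StateFreeOn

variable {G} {σ : G.Profile} {ι : ℕ → unitInterval} {A : Set Ω} (hσ : G.StateFreeOn σ ι A)
include hσ

theorem chosen_eq {ω ω' : Ω} (hω : ω ∈ A) (hω' : ω' ∈ A) (k : ℕ) (h : Fin k → G.Record) :
    G.chosen σ ω ι k h = G.chosen σ ω' ι k h :=
  congrArg (fun f : ℕ → G.Record => (f 0).1.1) (hσ ω hω ω' hω' k h)

section OneStep

variable {γ : Ω → ℝ} (hγ : γ ∈ stdSimplex ℝ Ω) (hsupp : ∀ ω, γ ω ≠ 0 → ω ∈ A) {ω₀ : Ω}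
  (hω₀ : ω₀ ∈ A)
include hγ hsupp hω₀

theorem sum_mul_chosenCost (k : ℕ) (h : Fin k → G.Record) :
    ∑ ω, ENNReal.ofReal (γ ω) * G.chosenCost σ ω ι k h = G.cost (G.chosen σ ω₀ ι k h) := by
  have term_eq : ∀ ω, ENNReal.ofReal (γ ω) * G.chosenCost σ ω ι k h =
      ENNReal.ofReal (γ ω) * G.cost (G.chosen σ ω₀ ι k h) := by
    intro ω
    rcases eq_or_ne (γ ω) 0 with h0 | h0
    · rw [h0, ENNReal.ofReal_zero, zero_mul, zero_mul]
    · rw [chosenCost, hσ.chosen_eq (hsupp ω h0) hω₀]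
  simp only [term_eq]
  rw [← Finset.sum_mul, ← ENNReal.ofReal_sum_of_nonneg fun ω _ => hγ.1 ω, hγ.2,
    ENNReal.ofReal_one, one_mul]

theorem sum_mul_treeSum_succ (g r : Ω → (k : ℕ) → (Fin k → G.Record) → ℝ≥0∞) (m k : ℕ)
    (h : Fin k → G.Record) :
    ∑ ω, ENNReal.ofReal (γ ω) * G.treeSum σ ω ι (g ω) (r ω) (m + 1) k h =
      ∑ ω, ENNReal.ofReal (γ ω) * r ω k h +
        ∑' τ, ENNReal.ofReal (marg γ (G.chosen σ ω₀ ι k h).1 τ) *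
          ∑ ω, ENNReal.ofReal (posterior γ (G.chosen σ ω₀ ι k h).1 τ ω) *
            G.treeSum σ ω ι (g ω) (r ω) m (k + 1)
              (Fin.snoc (α := fun _ => G.Record) h (G.respond σ ω₀ ι k h τ)) := by
  simp only [treeSum, mul_add, Finset.sum_add_distrib]
  rw [tsum_ofReal_marg_mul_sum_posterior hγ.1]
  congr 1
  refine Finset.sum_congr rfl fun ω _ => ?_
  rcases eq_or_ne (γ ω) 0 with h0 | h0
  · rw [h0, ENNReal.ofReal_zero, zero_mul, zero_mul]
  · rw [hσ.chosen_eq (hsupp ω h0) hω₀, hσ ω (hsupp ω h0) ω₀ hω₀]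

end OneStep

theorem sum_mul_treeSum_le (h₁ : G.κ.SequentialProof) {γ : Ω → ℝ} (hγ : γ ∈ stdSimplex ℝ Ω)
    (hsupp : ∀ ω, γ ω ≠ 0 → ω ∈ A) (m k : ℕ) (h : Fin k → G.Record) :
    ∑ ω, ENNReal.ofReal (γ ω) * G.treeSum σ ω ι (G.lastScore ω) (fun _ _ => 0) m k h ≤
      G.optValue γ + ∑ ω, ENNReal.ofReal (γ ω) *
        G.treeSum σ ω ι (fun _ _ => 0) (G.chosenCost σ ω ι) m k h := by
  induction m generalizing γ k with
  | zero =>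
    exact le_add_right ((G.sum_ofReal_mul_posScore_le hγ _).trans (G.beliefValue_le_optValue hγ))
  | succ m ih =>
    obtain ⟨ω₀, hω₀⟩ : ∃ ω, γ ω ≠ 0 := by
      by_contra! h0
      exact zero_ne_one ((Finset.sum_eq_zero fun ω _ => h0 ω).symm.trans hγ.2)
    have hω₀A := hsupp ω₀ hω₀
    rw [hσ.sum_mul_treeSum_succ hγ hsupp hω₀A (fun ω => G.lastScore ω) (fun _ _ _ => 0),
      hσ.sum_mul_treeSum_succ hγ hsupp hω₀A (fun _ _ _ => 0) (fun ω => G.chosenCost σ ω ι),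
      hσ.sum_mul_chosenCost hγ hsupp hω₀A]
    simp only [mul_zero, Finset.sum_const_zero, zero_add]
    rw [← add_assoc]
    set R := G.chosen σ ω₀ ι k h
    have supp_posterior : ∀ τ ω, posterior γ R.1 τ ω ≠ 0 → ω ∈ A := fun τ ω hω =>
      hsupp ω fun h0 => hω (by rw [posterior, h0, zero_mul, zero_div])
    refine (tsum_ofReal_marg_mul_le R.1 fun τ h0 => ih (posterior_mem_stdSimplex hγ.1 R.1 h0)
      (supp_posterior τ) (k + 1) _).trans ?_
    simp only [mul_add]
    rw [ENNReal.tsum_add]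
    exact add_le_add_left (G.tsum_optValue_posterior_le h₁ hγ R) _

end StateFreeOn

end Game

/-! ### An equilibrium without information acquisition -/

section Cell

variable {Ω : Type*} [Fintype Ω] {P : Setoid Ω} {μ : Ω → ℝ} (hμ : ∀ ω, 0 ≤ μ ω)
include hμ

open Classical in
theorem sum_cell_ofReal_mul {ω₀ : Ω} (hω₀ : 0 < μ ω₀) (F : Ω → ℝ≥0∞) :
    ∑ ω with Quotient.mk P ω = Quotient.mk P ω₀, ENNReal.ofReal (μ ω) * F ω =
      ENNReal.ofReal (cellMass P μ ω₀) * ∑ ω, ENNReal.ofReal (cellBelief P μ ω₀ ω) * F ω := by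
  rw [Finset.mul_sum, Finset.sum_filter]
  refine Finset.sum_congr rfl fun ω _ => ?_
  have hrel : Quotient.mk P ω = Quotient.mk P ω₀ ↔ P.r ω₀ ω :=
    Quotient.eq.trans ⟨fun h => P.symm h, fun h => P.symm h⟩
  rw [← mul_assoc, ← ENNReal.ofReal_mul (cellMass_pos hμ hω₀).le, cellMass_mul_cellBelief hμ hω₀]
  by_cases hr : P.r ω₀ ω
  · rw [if_pos (hrel.2 hr), if_pos hr]
  · rw [if_neg (mt hrel.1 hr), if_neg hr, ENNReal.ofReal_zero, zero_mul]

theorem sum_ofReal_mul_le_of_cellBelief {F F' : Ω → ℝ≥0∞}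
    (h : ∀ ω₀, 0 < μ ω₀ → ∑ ω, ENNReal.ofReal (cellBelief P μ ω₀ ω) * F ω ≤
      ∑ ω, ENNReal.ofReal (cellBelief P μ ω₀ ω) * F' ω) :
    ∑ ω, ENNReal.ofReal (μ ω) * F ω ≤ ∑ ω, ENNReal.ofReal (μ ω) * F' ω := by
  classical
  rw [← Finset.sum_fiberwise Finset.univ (Quotient.mk P),
    ← Finset.sum_fiberwise Finset.univ (Quotient.mk P)]
  refine Finset.sum_le_sum fun q _ => ?_
  by_cases hq : ∃ ω₀, Quotient.mk P ω₀ = q ∧ 0 < μ ω₀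
  · obtain ⟨ω₀, rfl, hω₀⟩ := hq
    rw [sum_cell_ofReal_mul hμ hω₀, sum_cell_ofReal_mul hμ hω₀]
    exact mul_le_mul_right (h ω₀ hω₀) _
  · push Not at hq
    refine (Finset.sum_eq_zero fun ω hω => ?_).trans_le zero_le
    rw [ENNReal.ofReal_of_nonpos (hq ω (Finset.mem_filter.1 hω).2), zero_mul]

end Cell

theorem partialPayoff_succ_le {n : ℕ} [NeZero n] {β s : ℝ} {S C : ℕ → ℝ} {i : Fin n}
    (hβ : 0 < β) (hβ1 : β ≤ 1) (hle : ∀ N, S N ≤ s + ∑ j ∈ Finset.range N, C j)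
    (hS₀ : Game.mover n 0 ≠ i → S 1 = s)
    (hS : ∀ k, Game.mover n (k + 1) ≠ i → S (k + 2) = S (k + 1))
    (hC : ∀ k, Game.mover n k ≠ i → C k = 0) (N : ℕ) :
    partialPayoff β S C i (N + 1) ≤ if Game.mover n 0 = i then β * (s - S 0) else 0 := by
  -- Collecting the net gains `S (k + 1) - S k - C k` of all periods costs `i` nothing.
  suffices hgap : partialPayoff β S C i (N + 1) ≤ (if Game.mover n 0 = i then β * (s - S 0) else 0)
      + β ^ (N + 1) * (S (N + 1) - s - ∑ j ∈ Finset.range (N + 1), C j) from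
    hgap.trans (add_le_of_nonpos_right (mul_nonpos_of_nonneg_of_nonpos (pow_pos hβ _).le
      (by linarith [hle (N + 1)])))
  simp only [partialPayoff, Finset.sum_filter]
  induction N with
  | zero =>
    simp only [zero_add, Finset.sum_range_one, pow_one]
    split_ifs with hi
    · exact le_of_eq (by ring)
    · simp [hS₀ hi, hC 0 hi]
  | succ N ih =>
    have hpow : β ^ (N + 2) ≤ β ^ (N + 1) := pow_le_pow_of_le_one hβ.le hβ1 (by omega)
    have hstep : (if Game.mover n (N + 1) = i then
        β ^ (N + 2) * (S (N + 2) - S (N + 1) - C (N + 1)) else 0) =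
          β ^ (N + 2) * (S (N + 2) - S (N + 1) - C (N + 1)) := by
      split_ifs with hi
      · rfl
      · rw [hS N hi, hC (N + 1) hi, sub_self, sub_zero, mul_zero]
    rw [Finset.sum_range_succ, Finset.sum_range_succ (f := C), hstep]
    nlinarith [hle (N + 1)]

namespace Game

section

variable {Ω : Type*} [Fintype Ω] [MeasurableSpace Ω] [MeasurableSingletonClass Ω] {n : ℕ}
  (G : Game Ω n)

theorem measurable_posScore_ann {y : FullState Ω → G.Ann} (hy : Measurable y) :
    Measurable fun φ : FullState Ω => G.posScore (y φ) φ.1 :=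
  ENNReal.measurable_ofReal.comp ((G.measurable_score.comp (hy.prodMk measurable_fst)).add_const _)

theorem lintegral_posScore {μ : Ω → ℝ} (hμ : μ ∈ stdSimplex ℝ Ω) {y : FullState Ω → G.Ann}
    (hy : Measurable y) :
    ∫⁻ φ, G.posScore (y φ) φ.1 ∂(law μ) = ENNReal.ofReal (G.expScore μ y + G.scoreBound) := by
  have := isProbabilityMeasure_law hμ
  have hint := G.integrable_score μ hy
  have hadd : G.expScore μ y + G.scoreBound = ∫ φ, (G.score (y φ) φ.1 + G.scoreBound) ∂(law μ) := by
    rw [integral_add hint (integrable_const _), integral_const, probReal_univ, one_smul, expScore]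
  rw [hadd]
  exact (ofReal_integral_eq_lintegral_ofReal (hint.add (integrable_const G.scoreBound))
    (ae_of_all _ fun φ => G.score_add_nonneg _ _)).symm

end

variable {Ω : Type*} [Fintype Ω] {n : ℕ} [NeZero n] (G : Game Ω n)

theorem infoOf_congr {i : Fin n} {ω ω' : Ω} (h : (G.part i).r ω ω') {k : ℕ} (x : Fin k → G.Record) :
    G.infoOf i ω x = G.infoOf i ω' x := by
  unfold infoOf
  rw [Quotient.sound (s := G.part i) h]

variable [MeasurableSpace Ω]

/-- Acquire no information, announce `v` in the first period and repeat the last announcement in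
all others. -/
def echo (v : G.Ann) (i : Fin n) : G.Strategy i where
  signal _ _ := G.free
  announce k a := if k = 0 then v else G.lastAnn a.1.1.2.2
  measurable_signal _ := measurable_const
  measurable_announce k :=
    Measurable.ite (MeasurableSet.const _) measurable_const
      ((G.measurable_lastAnn k).comp (by fun_prop))

section Echo

variable {v : G.Ann} {σ : G.Profile} {k : ℕ} (hk : σ (mover n k) = G.echo v (mover n k))
include hk

theorem acquired_of_echo (φ : FullState Ω) : G.acquired σ φ k = G.free := by
  simp only [acquired, step, hk]
  rfl

theorem expCost_of_echo (μ : Ω → ℝ) : (G.expCost μ fun φ => G.acquired σ φ k) = 0 := by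
  simp only [G.acquired_of_echo hk, expCost_free]

theorem ann_succ_of_echo : G.ann σ (k + 1) = if k = 0 then fun _ => v else G.ann σ k := by
  funext φ
  rw [ann_succ]
  simp only [step, hk]
  cases k <;> rfl

end Echo

theorem ann_echo_succ (v : G.Ann) (k : ℕ) : G.ann (G.echo v) (k + 1) = fun _ => v := by
  induction k with
  | zero => rw [G.ann_succ_of_echo rfl, if_pos rfl]
  | succ k ih => rw [G.ann_succ_of_echo rfl, if_neg k.succ_ne_zero, ih]

variable (v : G.Ann) {i : Fin n} (τ : G.Strategy i)

/-- Trader `i` plays `τ` and all others play `echo`. -/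
def echoExcept : G.Profile := Function.update (G.echo v) i τ

theorem echoExcept_of_ne {j : Fin n} (h : j ≠ i) : G.echoExcept v τ j = G.echo v j :=
  Function.update_of_ne h _ _

theorem stateFreeOn_echoExcept (ω₀ : Ω) (ι : ℕ → unitInterval) :
    G.StateFreeOn (G.echoExcept v τ) ι {ω | (G.part i).r ω₀ ω} := by
  intro ω hω ω' hω' k h
  funext t
  unfold respond chosen
  by_cases hj : mover n k = i
  · subst hj
    rw [G.infoOf_congr ((G.part _).trans ((G.part _).symm hω) hω')]
  · rw [G.echoExcept_of_ne v τ hj]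
    rfl

section Value

variable {v} {μ : Ω → ℝ} (hμ : μ ∈ stdSimplex ℝ Ω) (h₁ : G.κ.SequentialProof)
  (hv : ∀ ω, 0 < μ ω → mean (cellBelief (G.part i) μ ω) G.X = v) (hacq : G.NoAcquisition μ)
include hμ h₁ hv hacq

theorem sum_cellBelief_mul_treeSum_le (ι : ℕ → unitInterval) (m : ℕ) {ω₀ : Ω} (hω₀ : 0 < μ ω₀) :
    ∑ ω, ENNReal.ofReal (cellBelief (G.part i) μ ω₀ ω) *
        G.treeSum (G.echoExcept v τ) ω ι (G.lastScore ω) (fun _ _ => 0) m 0 Fin.elim0 ≤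
      ∑ ω, ENNReal.ofReal (cellBelief (G.part i) μ ω₀ ω) * (G.posScore v ω +
        G.treeSum (G.echoExcept v τ) ω ι (fun _ _ => 0) (G.chosenCost (G.echoExcept v τ) ω ι)
          m 0 Fin.elim0) := by
  have hγ := cellBelief_mem_stdSimplex (P := G.part i) hμ.1 hω₀
  have hmean : G.meanAnn (cellBelief (G.part i) μ ω₀) = v :=
    Subtype.ext ((G.coe_meanAnn hγ).trans (hv ω₀ hω₀))
  have hvalue := G.optValue_le_beliefValue hγ (hacq ω₀ hω₀ i)
  rw [beliefValue, hmean] at hvalue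
  simp only [mul_add, Finset.sum_add_distrib]
  exact ((G.stateFreeOn_echoExcept v τ ω₀ ι).sum_mul_treeSum_le h₁ hγ
    (fun ω hω => (rel_and_pos_of_cellBelief_pos hμ.1 ((hγ.1 ω).lt_of_ne' hω)).1) m 0 _).trans
    (add_le_add_left hvalue _)

end Value

variable [MeasurableSingletonClass Ω]

theorem lintegral_lastAnn_eq_treeSum (σ : G.Profile) (ω : Ω) (ι : ℕ → unitInterval) (m : ℕ) :
    ∫⁻ u, G.posScore (G.ann σ m (ω, ι, u)) ω ∂uniformSeq =
      G.treeSum σ ω ι (G.lastScore ω) (fun _ _ => 0) m 0 Fin.elim0 := by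
  rw [G.treeSum_zero σ ω ι (G.measurable_lastScore ω) (fun _ => measurable_const)]
  simp only [Finset.sum_const_zero, zero_add]
  rfl

theorem lintegral_sum_cost_eq_treeSum (σ : G.Profile) (ω : Ω) (ι : ℕ → unitInterval) (m : ℕ) :
    ∫⁻ u, ∑ j ∈ Finset.range m, G.cost (G.acquired σ (ω, ι, u) j) ∂uniformSeq =
      G.treeSum σ ω ι (fun _ _ => 0) (G.chosenCost σ ω ι) m 0 Fin.elim0 := by
  rw [G.treeSum_zero σ ω ι (fun _ => measurable_const) (G.measurable_chosenCost σ ω ι)]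
  simp only [add_zero]
  rfl

theorem lintegral_cost_acquired (μ : Ω → ℝ) (σ : G.Profile) (k : ℕ) :
    ∫⁻ φ, G.cost (G.acquired σ φ k) ∂(law μ) = G.expCost μ fun φ => G.acquired σ φ k :=
  lintegral_const_mul _ (G.κ.measurable_K.comp (G.measurable_acquired σ k))

theorem payoff_echo (μ : Ω → ℝ) (v : G.Ann) (i : Fin n) : G.payoff μ (G.echo v) i =
    ((if mover n 0 = i then G.β * (G.expScore μ (fun _ => v) - G.expScore μ fun _ => G.y₀)
      else 0 : ℝ) : EReal) := by
  have hcost : ∀ k, (G.expCost μ fun φ => G.acquired (G.echo v) φ k) = 0 := fun k =>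
    G.expCost_of_echo rfl μ
  have hann_zero : G.ann (G.echo v) 0 = fun _ => G.y₀ := rfl
  refine (tendsto_const_nhds.congr' ?_).liminf_eq
  filter_upwards [eventually_ge_atTop 1] with N hN
  obtain ⟨N, rfl⟩ := Nat.exists_eq_add_of_le' hN
  rw [sum_stagePayoff fun k => by rw [hcost]; exact ENNReal.zero_ne_top]
  simp only [partialPayoff, Finset.sum_filter, Finset.sum_range_succ', hcost,
    ann_echo_succ, hann_zero, zero_add, pow_one, ENNReal.toReal_zero, sub_zero, sub_self, mul_zero,
    ite_self, Finset.sum_const_zero]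

variable {μ : Ω → ℝ} (hμ : μ ∈ stdSimplex ℝ Ω)
include hμ

variable {v} (h₁ : G.κ.SequentialProof)
  (hv : ∀ ω, 0 < μ ω → mean (cellBelief (G.part i) μ ω) G.X = v) (hacq : G.NoAcquisition μ)
include h₁ hv hacq

theorem lintegral_posScore_echoExcept_le (m : ℕ) :
    ∫⁻ φ, G.posScore (G.ann (G.echoExcept v τ) m φ) φ.1 ∂(law μ) ≤
      ∫⁻ φ, G.posScore v φ.1 ∂(law μ) +
        ∑ j ∈ Finset.range m, G.expCost μ fun φ => G.acquired (G.echoExcept v τ) φ j := by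
  set σ := G.echoExcept v τ
  have hscore := G.measurable_posScore_ann (G.measurable_ann σ m)
  have hconst := G.measurable_posScore_ann (measurable_const (a := v))
  have hcost : ∀ j, Measurable fun φ : FullState Ω => G.cost (G.acquired σ φ j) := fun j =>
    G.measurable_cost.comp (G.measurable_acquired σ j)
  simp only [← lintegral_cost_acquired]
  rw [← lintegral_finsetSum _ fun j _ => hcost j, ← lintegral_add_left hconst,
    lintegral_law μ hscore,
    lintegral_law μ (by fun_prop)]
  refine lintegral_mono fun ι => sum_ofReal_mul_le_of_cellBelief (P := G.part i) hμ.1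
    fun ω₀ hω₀ => ?_
  simp only [lintegral_add_left measurable_const, lintegral_const, measure_univ, mul_one,
    lintegral_lastAnn_eq_treeSum, lintegral_sum_cost_eq_treeSum]
  exact G.sum_cellBelief_mul_treeSum_le τ hμ h₁ hv hacq ι m hω₀

theorem expScore_echoExcept_le
    (hfin : ∀ k, (G.expCost μ fun φ => G.acquired (G.echoExcept v τ) φ k) ≠ ⊤) (m : ℕ) :
    G.expScore μ (G.ann (G.echoExcept v τ) m) ≤ G.expScore μ (fun _ => v) +
      ∑ j ∈ Finset.range m, (G.expCost μ fun φ => G.acquired (G.echoExcept v τ) φ j).toReal := by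
  have hnonneg : ∀ y, 0 ≤ G.expScore μ y + G.scoreBound := fun y => by
    linarith [(abs_le.1 (G.abs_expScore_le hμ y)).1]
  have hle := G.lintegral_posScore_echoExcept_le τ hμ h₁ hv hacq m
  have hsum := ENNReal.sum_ne_top.2 fun j (_ : j ∈ Finset.range m) => hfin j
  rw [G.lintegral_posScore hμ (G.measurable_ann _ m),
    G.lintegral_posScore hμ (y := fun _ => v) measurable_const] at hle
  have hreal := ENNReal.toReal_mono (ENNReal.add_ne_top.2 ⟨ENNReal.ofReal_ne_top, hsum⟩) hle
  rw [ENNReal.toReal_add ENNReal.ofReal_ne_top hsum, ENNReal.toReal_sum fun j _ => hfin j,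
    ENNReal.toReal_ofReal (hnonneg _), ENNReal.toReal_ofReal (hnonneg _)] at hreal
  linarith

theorem payoff_echoExcept_le : G.payoff μ (G.echoExcept v τ) i ≤
    ((if mover n 0 = i then G.β * (G.expScore μ (fun _ => v) - G.expScore μ fun _ => G.y₀)
      else 0 : ℝ) : EReal) := by
  set σ := G.echoExcept v τ
  have hecho : ∀ k, mover n k ≠ i → σ (mover n k) = G.echo v (mover n k) := fun k =>
    G.echoExcept_of_ne v τ
  have hcost : ∀ k, mover n k ≠ i → (G.expCost μ fun φ => G.acquired σ φ k) = 0 := fun k hk =>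
    G.expCost_of_echo (hecho k hk) μ
  by_cases hfin : ∀ k, (G.expCost μ fun φ => G.acquired σ φ k) ≠ ⊤
  · refine liminf_le_of_frequently_le' (Eventually.frequently ?_)
    filter_upwards [eventually_ge_atTop 1] with N hN
    obtain ⟨N, rfl⟩ := Nat.exists_eq_add_of_le' hN
    rw [sum_stagePayoff hfin, EReal.coe_le_coe_iff]
    refine partialPayoff_succ_le G.β_pos G.β_le_one
      (G.expScore_echoExcept_le τ hμ h₁ hv hacq hfin) (fun hi => ?_) (fun k hi => ?_)
      (fun k hi => by rw [hcost k hi, ENNReal.toReal_zero]) N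
    · rw [G.ann_succ_of_echo (hecho 0 hi), if_pos rfl]
    · rw [G.ann_succ_of_echo (hecho (k + 1) hi), if_neg k.succ_ne_zero]
  · push Not at hfin
    obtain ⟨k, hk⟩ := hfin
    obtain rfl : mover n k = i := by
      by_contra hi
      exact ENNReal.top_ne_zero (hk.symm.trans (hcost k hi))
    rw [payoff_of_expCost_eq_top hk]
    exact bot_le

omit hv in
theorem isNash_echo (hv : ∀ i ω, 0 < μ ω → mean (cellBelief (G.part i) μ ω) G.X = v) :
    G.IsNash μ (G.echo v) := fun i τ =>
  (G.payoff_echoExcept_le τ hμ h₁ (hv i) hacq).trans_eq (G.payoff_echo μ v i).symm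

end Game

/-! ### Comparison of the market and the poll -/

namespace Game

section Prior

variable {Ω : Type*} [Fintype Ω] {n : ℕ} (G : Game Ω n)

theorem netGain_free {γ : Ω → ℝ} (hγ : γ ∈ stdSimplex ℝ Ω) : G.netGain γ G.free = 0 := by
  have hgain : G.gain γ G.free.1 = 0 := by
    refine (tsum_congr fun τ => ?_).trans tsum_zero
    by_cases h0 : marg γ G.free.1 τ = 0
    · rw [h0, zero_mul]
    · simp only [G.posterior_free hγ h0, sub_self, mul_zero, Finset.sum_const_zero]
  rw [netGain, hgain, K_free, mul_zero]
  norm_num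

/-- The poll in which no trader acquires information. -/
def freePoll : G.PollChoice := fun _ _ => G.free

variable {μ : Ω → ℝ}

theorem isOptimal_freePoll (hμ : ∀ ω, 0 ≤ μ ω) (hacq : G.NoAcquisition μ) :
    G.freePoll.IsOptimal μ := by
  intro i ω hω R
  rw [freePoll, G.netGain_free (cellBelief_mem_stdSimplex hμ hω)]
  exact hacq ω hω i R

variable {G}

theorem mean_cellBelief_eq_X (hμ : ∀ ω, 0 ≤ μ ω) (hcertain : ¬G.SomeTraderUncertain μ) (i : Fin n)
    {ω : Ω} (hω : 0 < μ ω) : mean (cellBelief (G.part i) μ ω) G.X = G.X ω := by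
  have hγ := cellBelief_mem_stdSimplex (P := G.part i) hμ hω
  have hterm : ∀ ω', cellBelief (G.part i) μ ω ω' * G.X ω' =
      cellBelief (G.part i) μ ω ω' * G.X ω := by
    intro ω'
    rcases (hγ.1 ω').eq_or_lt with h0 | h0
    · rw [← h0, zero_mul, zero_mul]
    · obtain ⟨hr, hω'⟩ := rel_and_pos_of_cellBelief_pos hμ h0
      rw [show G.X ω = G.X ω' from not_not.1 fun hne => hcertain ⟨i, ω, ω', hω, hω', hr, hne⟩]
  rw [mean, Finset.sum_congr rfl fun ω' _ => hterm ω', ← Finset.sum_mul, hγ.2, one_mul]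

theorem NonSeparableAt.someTraderUncertain [NeZero n] (hμ : ∀ ω, 0 ≤ μ ω)
    (h : G.NonSeparableAt μ) : G.SomeTraderUncertain μ := by
  obtain ⟨v, ⟨ω, hω, hne⟩, hv⟩ := h
  by_contra hcertain
  exact hne ((mean_cellBelief_eq_X hμ hcertain 0 hω).symm.trans (hv 0 ω hω))

end Prior

variable {Ω : Type*} [Fintype Ω] [MeasurableSpace Ω] {n : ℕ} (G : Game Ω n) {μ : Ω → ℝ}

theorem isMarketPrediction_echo [NeZero n] (μ : Ω → ℝ) (v : G.Ann) :
    G.IsMarketPrediction μ (G.echo v) fun _ => (v : ℝ) := by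
  intro ε hε
  refine tendsto_const_nhds.congr' ?_
  filter_upwards [eventually_ge_atTop 1] with k hk
  obtain ⟨k, rfl⟩ := Nat.exists_eq_add_of_le' hk
  simp only [price_eq, ann_echo_succ, edist_self, nonpos_iff_eq_zero, hε.ne', Set.ofPred_false,
    measure_empty]

variable [MeasurableSingletonClass Ω]

theorem pollPosterior_freePoll (hμ : ∀ ω, 0 ≤ μ ω) (i : Fin n) :
    ∀ᵐ φ ∂(law μ), G.pollPosterior μ G.freePoll i φ = cellBelief (G.part i) μ φ.1 := by
  filter_upwards [ae_state_pos hμ, ae_realize_signal_pos μ (fun _ => G.free.1) i] with φ hω hτ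
  have hγ := cellBelief_mem_stdSimplex (P := G.part i) hμ hω
  exact G.posterior_free hγ (marg_pos hγ.1 (cellBelief_pos hμ hω ((G.part i).refl φ.1) hω) hτ).ne'

variable [NeZero n]

theorem pollPrediction_freePoll (hμ : ∀ ω, 0 ≤ μ ω) {v : ℝ}
    (hv : ∀ i ω, 0 < μ ω → mean (cellBelief (G.part i) μ ω) G.X = v) :
    ∀ᵐ φ ∂(law μ), G.pollPrediction μ G.freePoll φ = v := by
  filter_upwards [ae_state_pos hμ, ae_all_iff.2 (G.pollPosterior_freePoll hμ)] with φ hω hpost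
  have hmean : ∀ i, mean (G.pollPosterior μ G.freePoll i φ) G.X = v := fun i => by
    rw [hpost i, hv i φ.1 hω]
  simp only [pollPrediction_eq, hmean, Finset.sum_const, Finset.card_fin, nsmul_eq_mul]
  exact mul_div_cancel_left₀ v (Nat.cast_ne_zero.2 (NeZero.ne n))

/-- Nobody learns anything in the market equilibrium `echo`, which thus predicts no better than the
poll. -/
theorem marketAccuracy_le (h₁ : G.κ.SequentialProof) (hμ : μ ∈ stdSimplex ℝ Ω)
    (hns : G.NonSeparableAt μ) (hacq : G.NoAcquisition μ) :
    G.marketAccuracy μ ≤ G.accuracy μ (G.pollPrediction μ G.freePoll) := by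
  obtain ⟨v, ⟨ω, hω, -⟩, hv⟩ := hns
  obtain ⟨w, rfl⟩ : ∃ w : G.Ann, (w : ℝ) = v := ⟨G.meanAnn (cellBelief (G.part 0) μ ω), by
    rw [G.coe_meanAnn (cellBelief_mem_stdSimplex hμ.1 hω), hv 0 ω hω]⟩
  have haccuracy : G.accuracy μ (fun _ => (w : ℝ)) =
      G.accuracy μ (G.pollPrediction μ G.freePoll) :=
    integral_congr_ae ((G.pollPrediction_freePoll hμ.1 hv).mono fun φ hφ => by simp only [hφ])
  exact haccuracy ▸ (iInf₂_le (G.echo w) (G.isNash_echo hμ h₁ hacq hv)).trans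
    (iInf₂_le _ (G.isMarketPrediction_echo μ w))

variable {G}

theorem KSeparable.one_le_marketAccuracy (hG : G.KSeparable) (hμ : μ ∈ stdSimplex ℝ Ω) :
    1 ≤ G.marketAccuracy μ := by
  have := isProbabilityMeasure_law hμ
  refine le_iInf₂ fun σ hσ => le_iInf₂ fun p hp => ?_
  have hexact : ∀ᵐ φ ∂(law μ), p φ = G.X φ.1 := by
    filter_upwards [tendstoInMeasure_ae_unique hp (hσ.isMarketPrediction hμ),
      hσ.ae_mean_limitBelief_eq hμ hG] with φ hp_eq hlimit
    rw [hp_eq, hlimit]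
  have haccuracy : G.accuracy μ p = 1 := by
    rw [accuracy, integral_congr_ae (g := fun _ => (1 : ℝ)) (hexact.mono fun φ hφ => by simp [hφ])]
    simp
  rw [haccuracy, EReal.coe_one]

end Game

end InfoMarket

end

theorem mainTheorem5 {Ω : Type*} [Fintype Ω] [MeasurableSpace Ω] [MeasurableSingletonClass Ω]
    {n : ℕ} [NeZero n] (G : InfoMarket.Game Ω n)
    (h₁ : G.κ.SequentialProof) (h₂ : G.κ.NoExclusion) :
    (∀ μ ∈ stdSimplex ℝ Ω, ∀ σ : G.Profile, G.IsNash μ σ →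
      ∃ p, G.IsMarketPrediction μ σ p) ∧
    (G.KSeparable ↔
      ∀ μ ∈ stdSimplex ℝ Ω, G.SomeTraderUncertain μ →
        ∀ ρ : G.PollChoice, ρ.IsOptimal μ →
          (G.accuracy μ (G.pollPrediction μ ρ) : EReal) < G.marketAccuracy μ) := by
  refine ⟨fun μ hμ σ hσ => ⟨_, hσ.isMarketPrediction hμ⟩, fun hG μ hμ hunc ρ hρ => ?_, ?_⟩
  · refine lt_of_lt_of_le ?_ (hG.one_le_marketAccuracy hμ)
    exact_mod_cast hρ.accuracy_pollPrediction_lt_one h₂ hμ hunc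
  · rintro h ⟨μ, hμ, hns, hacq⟩
    exact (h μ hμ (hns.someTraderUncertain hμ.1) _ (G.isOptimal_freePoll hμ.1 hacq)).not_ge
      (G.marketAccuracy_le h₁ hμ hns hacq)
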